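/- **Conventions.** All categories are assumed to be idempotent complete (every idempotent splits). - $\mathsf{Mnd}$ is the 2-category of monads. A 1-cell from a monad $(T,\eta,\mu)$ on $\mathbb A$ to a monad $(S,\eta',\mu')$ on $\mathbb C$ is a functor $H:\mathbb A\to\mathbb C$ with a natural isomorphism $\chi: HT\cong SH$ such that $\chi\cdot H\eta=\eta' H$ and $\chi\cdot H\mu=\mu' H\cdot S\chi\cdot\chi T$. A 2-cell is a natural transformation that commutes with these isomorphisms. The 2-category $\mathsf{Cmn}$ of comonads is defined dually. - $\mathsf{Adj}$ is the 2-category of adjunctions $F=(L\dashv R)$, $L:\mathbb A\to\mathbb B$. A 1-cell from $(L\dashv R)$ to $(L'\dashv R')$, with $L':\mathbb C\to\mathbb D$, is a pair of functors $H:\mathbb A\to\mathbb C$, $K:\mathbb B\to\mathbb D$ with natural isomorphisms $KL\cong L'H$ and $HR\cong R'K$ that carry the unit to the unit and the counit to the counit. A 2-cell is a pair of natural transformations that commute with these isomorphisms. - $\mathsf{AM}:\mathsf{Adj}\to\mathsf{Mnd}$ and $\mathsf{AC}:\mathsf{Adj}\to\mathsf{Cmn}$ send $L\dashv R$ to the monad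 $RL$ on $\mathbb A$ and to the comonad $LR$ on $\mathbb B$. - $\mathsf{EM}:\mathsf{Mnd}\to\mathsf{Adj}$ sends a monad $T$ on $\mathbb A$ to the free–forgetful adjunction between $\mathbb A$ and its Eilenberg–Moore category $\mathbb A^T$ of algebras. $\mathsf{KM}:\mathsf{Mnd}\to\mathsf{Adj}$ sends $T$ to the restriction of that adjunction to the full subcategory of projective algebras, i.e. retracts of free algebras (the idempotent completion of the Kleisli category of $T$). - $\mathsf{EC}:\mathsf{Cmn}\to\mathsf{Adj}$ sends a comonad $S$ on $\mathbb B$ to the forgetful–cofree adjunction between its Eilenberg–Moore category $\mathbb B^S$ of coalgebras and $\mathbb B$. $\mathsf{KC}:\mathsf{Cmn}\to\mathsf{Adj}$ sends $S$ to the restriction of that adjunction to the full subcategory of injective coalgebras, i.e. retracts of cofree coalgebras (the idempotent completion of the Kleisli category of $S$). All six are pseudofunctors. The comparison functors into the categories of (co)algebras give strong (pseudonatural) transformations $\mathrm{id}\to\mathsf{EM}\circ\mathsf{AM}$ and $\mathrm{id}\to\mathsf{EC}\circ\mathsf{AC}$, called units. The *Street monads* are $$\mathfrak M=\mathsf{AM}\circ\mathsf{EC}\circ\mathsf{AC}\circ\mathsf{KM}:\mathsf{Mnd}\to\mathsf{Mnd},\qquad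 \mathfrak E=\mathsf{AC}\circ\mathsf{EM}\circ\mathsf{AM}\circ\mathsf{KC}:\mathsf{Cmn}\to\mathsf{Cmn}.$$ The unit $\eta:\mathrm{id}\to\mathfrak M$ is the composite of the canonical isomorphism $\mathrm{id}\cong\mathsf{AM}\circ\mathsf{KM}$ with the image under $\mathsf{AM}$ of the unit of $\mathsf{EC}\circ\mathsf{AC}$ at $\mathsf{KM}$; the unit $\eta:\mathrm{id}\to\mathfrak E$ is the composite of $\mathrm{id}\cong\mathsf{AC}\circ\mathsf{KC}$ with the image under $\mathsf{AC}$ of the unit of $\mathsf{EM}\circ\mathsf{AM}$ at $\mathsf{KC}$. "Equivalence", for a 1-cell of a 2-category, means that it has an inverse up to invertible 2-cells. **Theorem.** (1) The Street monads are strictly idempotent: for every monad $T$ the 1-cells $\eta_{\mathfrak M T},\ \mathfrak M(\eta_T):\mathfrak M T\to\mathfrak M\mathfrak M T$ are equivalences, and for every comonad $S$ the 1-cells $\eta_{\mathfrak E S},\ \mathfrak E(\eta_S):\mathfrak E S\to\mathfrak E\mathfrak E S$ are equivalences. Thus $\mathfrak M\simeq\mathfrak M\mathfrak M$ and $\mathfrak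 E\simeq\mathfrak E\mathfrak E$ naturally. (2) An adjunction $F=(L\dashv R)$ is *nuclear*, i.e. $R$ is monadic and $L$ is comonadic, if and only if the units $F\to\mathsf{EM}\,\mathsf{AM}\,F$ and $F\to\mathsf{EC}\,\mathsf{AC}\,F$ are both equivalences in $\mathsf{Adj}$. (3) Let $\mathsf{Nuc}\subseteq\mathsf{Adj}$, $\mathsf{Mnd}^{\mathfrak M}\subseteq\mathsf{Mnd}$ and $\mathsf{Cmn}^{\mathfrak E}\subseteq\mathsf{Cmn}$ be the full sub-2-categories of the nuclear adjunctions, of the monads $T$ for which $\eta_T:T\to\mathfrak M T$ is an equivalence, and of the comonads $S$ for which $\eta_S:S\to\mathfrak E S$ is an equivalence. Then $\mathsf{AM}$ and $\mathsf{AC}$ restrict to equivalences of 2-categories (biequivalences) $$\mathsf{Cmn}^{\mathfrak E}\ \xleftarrow[\ \mathsf{AC}\ ]{\simeq}\ \mathsf{Nuc}\ \xrightarrow[\ \mathsf{AM}\ ]{\simeq}\ \mathsf{Mnd}^{\mathfrak M}.$$ -/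

import Mathlib

open CategoryTheory Bicategory

set_option linter.checkUnivs false

universe v u

namespace StreetNucleus


/-- A monad on a category in which all idempotents split. -/
structure Mnd where
  carrier : Type u
  [cat : Category.{v} carrier]
  [split : IsIdempotentComplete carrier]
  monad : Monad carrier

attribute [instance] Mnd.cat Mnd.split

namespace Mnd

/-- A morphism of monads `(A, T) ⟶ (C, S)`: a functor `H : A ⥤ C` with a natural isomorphism
`H T ≅ S H` that carries the unit and the multiplication of `T` to those of `S`. -/
structure Hom (T S : Mnd.{v, u}) where
  functor : T.carrier ⥤ S.carrier
  iso (a : T.carrier) : functor.obj (T.monad.obj a) ≅ S.monad.obj (functor.obj a)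
  natural {a b : T.carrier} (f : a ⟶ b) :
    functor.map (T.monad.map f) ≫ (iso b).hom = (iso a).hom ≫ S.monad.map (functor.map f)
  unit (a : T.carrier) :
    functor.map (T.monad.η.app a) ≫ (iso a).hom = S.monad.η.app (functor.obj a)
  mul (a : T.carrier) :
    functor.map (T.monad.μ.app a) ≫ (iso a).hom =
      (iso (T.monad.obj a)).hom ≫ S.monad.map (iso a).hom ≫ S.monad.μ.app (functor.obj a)

/-- A 2-cell between morphisms of monads: a natural transformation of the underlying functors
that commutes with the structure isomorphisms. -/
structure Hom₂ {T S : Mnd.{v, u}} (f g : Hom T S) where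
  nat : f.functor ⟶ g.functor
  comm (a : T.carrier) :
    nat.app (T.monad.obj a) ≫ (g.iso a).hom = (f.iso a).hom ≫ S.monad.map (nat.app a)

instance (T S : Mnd.{v, u}) : Category (Hom T S) where
  Hom f g := Hom₂ f g
  id f := { nat := 𝟙 _, comm := by simp }
  comp x y := { nat := x.nat ≫ y.nat, comm := fun a => by simp [reassoc_of% (x.comm _), y.comm] }

/-- The identity morphism of a monad. -/
def Hom.id (T : Mnd.{v, u}) : Hom T T where
  functor := 𝟭 _
  iso a := Iso.refl _
  natural f := by simp
  unit a := by simp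
  mul a := by simp

/-- The composite of two morphisms of monads. -/
def Hom.comp {T S R : Mnd.{v, u}} (f : Hom T S) (g : Hom S R) : Hom T R where
  functor := f.functor ⋙ g.functor
  iso a := g.functor.mapIso (f.iso a) ≪≫ g.iso (f.functor.obj a)
  natural h := by
    simp only [Functor.comp_map, Iso.trans_hom, Functor.mapIso_hom, Category.assoc, ← g.natural]
    simp only [← Functor.map_comp_assoc, f.natural]
  unit a := by
    simp only [Functor.comp_map, Iso.trans_hom, Functor.mapIso_hom, ← Functor.map_comp_assoc,
      f.unit, g.unit, Functor.comp_obj]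
  mul a := by
    have := g.mul (f.functor.obj a)
    have h2 := g.natural (f.iso a).hom
    simp only [Functor.comp_obj, Functor.comp_map, Iso.trans_hom, Functor.mapIso_hom,
      ← Functor.map_comp_assoc, f.mul]
    simp [this]
    rw [reassoc_of% h2]

instance : CategoryStruct Mnd.{v, u} where
  Hom T S := Hom T S
  id T := Hom.id T
  comp f g := Hom.comp f g

instance (T S : Mnd.{v, u}) : Category (T ⟶ S) := inferInstanceAs (Category (Hom T S))

theorem hom₂_ext {T S : Mnd.{v, u}} {f g : T ⟶ S} {x y : f ⟶ g}
    (h : ∀ a, x.nat.app a = y.nat.app a) : x = y := by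
  obtain ⟨x, hx⟩ := x
  obtain ⟨y, hy⟩ := y
  obtain rfl : x = y := NatTrans.ext (funext h)
  rfl

section

variable {T S R Q : Mnd.{v, u}}

@[simp] theorem id_functor (T : Mnd.{v, u}) : Hom.functor (𝟙 T) = 𝟭 T.carrier := rfl

@[simp] theorem comp_functor (f : T ⟶ S) (g : S ⟶ R) :
    Hom.functor (f ≫ g) = f.functor ⋙ g.functor := rfl

@[simp] theorem id_iso (T : Mnd.{v, u}) (a) : Hom.iso (𝟙 T) a = Iso.refl _ := rfl

@[simp] theorem comp_iso (f : T ⟶ S) (g : S ⟶ R) (a) :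
    Hom.iso (f ≫ g) a = g.functor.mapIso (f.iso a) ≪≫ g.iso (f.functor.obj a) := rfl

@[simp] theorem id_nat (f : T ⟶ S) (a) : (Hom₂.nat (𝟙 f)).app a = 𝟙 (f.functor.obj a) := rfl

@[simp] theorem comp_nat {f g h : T ⟶ S} (x : f ⟶ g) (y : g ⟶ h) (a) :
    (Hom₂.nat (x ≫ y)).app a = x.nat.app a ≫ y.nat.app a := rfl

/-- An invertible 2-cell, from a natural isomorphism of the underlying functors. -/
def isoMk {f g : T ⟶ S} (e : f.functor ≅ g.functor)
    (h : ∀ a, e.hom.app (T.monad.obj a) ≫ (g.iso a).hom =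
      (f.iso a).hom ≫ S.monad.map (e.hom.app a)) : f ≅ g where
  hom := { nat := e.hom, comm := h }
  inv :=
    { nat := e.inv
      comm := fun a => by
        rw [← cancel_epi (e.hom.app _), ← Category.assoc, ← Category.assoc, h,
          Iso.hom_inv_id_app]
        simp [← Functor.map_comp] }
  hom_inv_id := hom₂_ext fun _ => by simp
  inv_hom_id := hom₂_ext fun _ => by simp

@[simp] theorem isoMk_hom_nat {f g : T ⟶ S} (e : f.functor ≅ g.functor) (h) :
    (isoMk (f := f) (g := g) e h).hom.nat = e.hom := rfl

@[simp] theorem isoMk_inv_nat {f g : T ⟶ S} (e : f.functor ≅ g.functor) (h) :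
    (isoMk (f := f) (g := g) e h).inv.nat = e.inv := rfl

/-- Left whiskering of 2-cells. -/
def whiskerLeft (f : T ⟶ S) {g h : S ⟶ R} (x : g ⟶ h) : f ≫ g ⟶ f ≫ h :=
  Hom₂.mk (Functor.whiskerLeft f.functor x.nat) (fun a => by
    have := x.comm (f.functor.obj a)
    simp [← this])

/-- Right whiskering of 2-cells. -/
def whiskerRight {f g : T ⟶ S} (x : f ⟶ g) (h : S ⟶ R) : f ≫ h ⟶ g ≫ h :=
  Hom₂.mk (Functor.whiskerRight x.nat h.functor) (fun a => by
    have := x.comm a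
    simp
    rw [← h.natural, ← Functor.map_comp_assoc, this]
    simp)

@[simp] theorem whiskerLeft_nat (f : T ⟶ S) {g h : S ⟶ R} (x : g ⟶ h) (a) :
    (whiskerLeft f x).nat.app a = x.nat.app (f.functor.obj a) := rfl

@[simp] theorem whiskerRight_nat {f g : T ⟶ S} (x : f ⟶ g) (h : S ⟶ R) (a) :
    (whiskerRight x h).nat.app a = h.functor.map (x.nat.app a) := rfl

/-- The associator. -/
@[simps! hom_nat_app inv_nat_app]
def associator (f : T ⟶ S) (g : S ⟶ R) (h : R ⟶ Q) : (f ≫ g) ≫ h ≅ f ≫ g ≫ h :=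
  isoMk (f := (f ≫ g) ≫ h) (g := f ≫ g ≫ h) (Functor.associator _ _ _) (fun a => by simp)

/-- The left unitor. -/
@[simps! hom_nat_app inv_nat_app]
def leftUnitor (f : T ⟶ S) : 𝟙 T ≫ f ≅ f :=
  isoMk (f := 𝟙 T ≫ f) (g := f) (Functor.leftUnitor _) (fun a => by simp)

/-- The right unitor. -/
@[simps! hom_nat_app inv_nat_app]
def rightUnitor (f : T ⟶ S) : f ≫ 𝟙 S ≅ f :=
  isoMk (f := f ≫ 𝟙 S) (g := f) (Functor.rightUnitor _) (fun a => by simp)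

end

/-- The 2-category of monads. -/
instance : Bicategory Mnd.{v, u} where
  homCategory := inferInstance
  whiskerLeft := whiskerLeft
  whiskerRight := whiskerRight
  associator := associator
  leftUnitor := leftUnitor
  rightUnitor := rightUnitor
  whiskerLeft_id _ _ := hom₂_ext fun _ => by simp
  whiskerLeft_comp _ _ _ _ _ _ := hom₂_ext fun _ => by simp
  id_whiskerLeft _ := hom₂_ext fun _ => by simp
  comp_whiskerLeft _ _ _ _ _ := hom₂_ext fun _ => by simp
  id_whiskerRight _ _ := hom₂_ext fun _ => by simp
  comp_whiskerRight _ _ _ := hom₂_ext fun _ => by simp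
  whiskerRight_id _ := hom₂_ext fun _ => by simp
  whiskerRight_comp _ _ _ := hom₂_ext fun _ => by simp
  whisker_assoc _ _ _ _ _ := hom₂_ext fun _ => by simp
  whisker_exchange _ _ := hom₂_ext fun _ => by simp
  pentagon _ _ _ _ := hom₂_ext fun _ => by simp
  triangle _ _ := hom₂_ext fun _ => by simp

end Mnd

/-- A comonad on a category in which all idempotents split. -/
structure Cmn where
  carrier : Type u
  [cat : Category.{v} carrier]
  [split : IsIdempotentComplete carrier]
  comonad : Comonad carrier

attribute [instance] Cmn.cat Cmn.split

namespace Cmn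

/-- A morphism of comonads `(A, T) ⟶ (C, S)`: a functor `H : A ⥤ C` with a natural isomorphism
`H T ≅ S H` that carries the counit and the comultiplication of `T` to those of `S`. -/
structure Hom (T S : Cmn.{v, u}) where
  functor : T.carrier ⥤ S.carrier
  iso (a : T.carrier) : functor.obj (T.comonad.obj a) ≅ S.comonad.obj (functor.obj a)
  natural {a b : T.carrier} (f : a ⟶ b) :
    functor.map (T.comonad.map f) ≫ (iso b).hom = (iso a).hom ≫ S.comonad.map (functor.map f)
  counit (a : T.carrier) :
    (iso a).hom ≫ S.comonad.ε.app (functor.obj a) = functor.map (T.comonad.ε.app a)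
  comul (a : T.carrier) :
    functor.map (T.comonad.δ.app a) ≫ (iso (T.comonad.obj a)).hom ≫ S.comonad.map (iso a).hom =
      (iso a).hom ≫ S.comonad.δ.app (functor.obj a)

/-- A 2-cell between morphisms of comonads: a natural transformation of the underlying functors
that commutes with the structure isomorphisms. -/
structure Hom₂ {T S : Cmn.{v, u}} (f g : Hom T S) where
  nat : f.functor ⟶ g.functor
  comm (a : T.carrier) :
    nat.app (T.comonad.obj a) ≫ (g.iso a).hom = (f.iso a).hom ≫ S.comonad.map (nat.app a)

instance (T S : Cmn.{v, u}) : Category (Hom T S) where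
  Hom f g := Hom₂ f g
  id f := { nat := 𝟙 _, comm := by simp }
  comp x y := { nat := x.nat ≫ y.nat, comm := fun a => by simp [reassoc_of% (x.comm _), y.comm] }

/-- The identity morphism of a comonad. -/
def Hom.id (T : Cmn.{v, u}) : Hom T T where
  functor := 𝟭 _
  iso a := Iso.refl _
  natural f := by simp
  counit a := by simp
  comul a := by simp

/-- The composite of two morphisms of comonads. -/
def Hom.comp {T S R : Cmn.{v, u}} (f : Hom T S) (g : Hom S R) : Hom T R where
  functor := f.functor ⋙ g.functor
  iso a := g.functor.mapIso (f.iso a) ≪≫ g.iso (f.functor.obj a)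
  natural h := by
    simp only [Functor.comp_map, Iso.trans_hom, Functor.mapIso_hom, Category.assoc, ← g.natural]
    simp only [← Functor.map_comp_assoc, f.natural]
  counit a := by
    simp only [Functor.comp_map, Iso.trans_hom, Functor.mapIso_hom, Category.assoc, g.counit,
      ← Functor.map_comp, f.counit, Functor.comp_obj]
  comul a := by
    have h1 := g.comul (f.functor.obj a)
    have h2 := g.natural (f.iso a).hom
    have h3 := congrArg g.functor.map (f.comul a)
    simp only [Functor.map_comp] at h3
    simp only [Functor.comp_obj, Functor.comp_map, Iso.trans_hom, Functor.mapIso_hom,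
      Functor.map_comp, Category.assoc, ← h1]
    rw [← reassoc_of% h3, reassoc_of% h2]

instance : CategoryStruct Cmn.{v, u} where
  Hom T S := Hom T S
  id T := Hom.id T
  comp f g := Hom.comp f g

instance (T S : Cmn.{v, u}) : Category (T ⟶ S) := inferInstanceAs (Category (Hom T S))

theorem hom₂_ext {T S : Cmn.{v, u}} {f g : T ⟶ S} {x y : f ⟶ g}
    (h : ∀ a, x.nat.app a = y.nat.app a) : x = y := by
  obtain ⟨x, hx⟩ := x
  obtain ⟨y, hy⟩ := y
  obtain rfl : x = y := NatTrans.ext (funext h)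
  rfl

section

variable {T S R Q : Cmn.{v, u}}

@[simp] theorem id_functor (T : Cmn.{v, u}) : Hom.functor (𝟙 T) = 𝟭 T.carrier := rfl

@[simp] theorem comp_functor (f : T ⟶ S) (g : S ⟶ R) :
    Hom.functor (f ≫ g) = f.functor ⋙ g.functor := rfl

@[simp] theorem id_iso (T : Cmn.{v, u}) (a) : Hom.iso (𝟙 T) a = Iso.refl _ := rfl

@[simp] theorem comp_iso (f : T ⟶ S) (g : S ⟶ R) (a) :
    Hom.iso (f ≫ g) a = g.functor.mapIso (f.iso a) ≪≫ g.iso (f.functor.obj a) := rfl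

@[simp] theorem id_nat (f : T ⟶ S) (a) : (Hom₂.nat (𝟙 f)).app a = 𝟙 (f.functor.obj a) := rfl

@[simp] theorem comp_nat {f g h : T ⟶ S} (x : f ⟶ g) (y : g ⟶ h) (a) :
    (Hom₂.nat (x ≫ y)).app a = x.nat.app a ≫ y.nat.app a := rfl

/-- An invertible 2-cell, from a natural isomorphism of the underlying functors. -/
def isoMk {f g : T ⟶ S} (e : f.functor ≅ g.functor)
    (h : ∀ a, e.hom.app (T.comonad.obj a) ≫ (g.iso a).hom =
      (f.iso a).hom ≫ S.comonad.map (e.hom.app a)) : f ≅ g where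
  hom := { nat := e.hom, comm := h }
  inv :=
    { nat := e.inv
      comm := fun a => by
        rw [← cancel_epi (e.hom.app _), ← Category.assoc, ← Category.assoc, h,
          Iso.hom_inv_id_app]
        simp [← Functor.map_comp] }
  hom_inv_id := hom₂_ext fun _ => by simp
  inv_hom_id := hom₂_ext fun _ => by simp

@[simp] theorem isoMk_hom_nat {f g : T ⟶ S} (e : f.functor ≅ g.functor) (h) :
    (isoMk (f := f) (g := g) e h).hom.nat = e.hom := rfl

@[simp] theorem isoMk_inv_nat {f g : T ⟶ S} (e : f.functor ≅ g.functor) (h) :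
    (isoMk (f := f) (g := g) e h).inv.nat = e.inv := rfl

/-- Left whiskering of 2-cells. -/
def whiskerLeft (f : T ⟶ S) {g h : S ⟶ R} (x : g ⟶ h) : f ≫ g ⟶ f ≫ h :=
  Hom₂.mk (Functor.whiskerLeft f.functor x.nat) (fun a => by
    have := x.comm (f.functor.obj a)
    simp [← this])

/-- Right whiskering of 2-cells. -/
def whiskerRight {f g : T ⟶ S} (x : f ⟶ g) (h : S ⟶ R) : f ≫ h ⟶ g ≫ h :=
  Hom₂.mk (Functor.whiskerRight x.nat h.functor) (fun a => by
    have := x.comm a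
    simp
    rw [← h.natural, ← Functor.map_comp_assoc, this]
    simp)

@[simp] theorem whiskerLeft_nat (f : T ⟶ S) {g h : S ⟶ R} (x : g ⟶ h) (a) :
    (whiskerLeft f x).nat.app a = x.nat.app (f.functor.obj a) := rfl

@[simp] theorem whiskerRight_nat {f g : T ⟶ S} (x : f ⟶ g) (h : S ⟶ R) (a) :
    (whiskerRight x h).nat.app a = h.functor.map (x.nat.app a) := rfl

/-- The associator. -/
@[simps! hom_nat_app inv_nat_app]
def associator (f : T ⟶ S) (g : S ⟶ R) (h : R ⟶ Q) : (f ≫ g) ≫ h ≅ f ≫ g ≫ h :=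
  isoMk (f := (f ≫ g) ≫ h) (g := f ≫ g ≫ h) (Functor.associator _ _ _) (fun a => by simp)

/-- The left unitor. -/
@[simps! hom_nat_app inv_nat_app]
def leftUnitor (f : T ⟶ S) : 𝟙 T ≫ f ≅ f :=
  isoMk (f := 𝟙 T ≫ f) (g := f) (Functor.leftUnitor _) (fun a => by simp)

/-- The right unitor. -/
@[simps! hom_nat_app inv_nat_app]
def rightUnitor (f : T ⟶ S) : f ≫ 𝟙 S ≅ f :=
  isoMk (f := f ≫ 𝟙 S) (g := f) (Functor.rightUnitor _) (fun a => by simp)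

end

/-- The 2-category of comonads. -/
instance : Bicategory Cmn.{v, u} where
  homCategory := inferInstance
  whiskerLeft := whiskerLeft
  whiskerRight := whiskerRight
  associator := associator
  leftUnitor := leftUnitor
  rightUnitor := rightUnitor
  whiskerLeft_id _ _ := hom₂_ext fun _ => by simp
  whiskerLeft_comp _ _ _ _ _ _ := hom₂_ext fun _ => by simp
  id_whiskerLeft _ := hom₂_ext fun _ => by simp
  comp_whiskerLeft _ _ _ _ _ := hom₂_ext fun _ => by simp
  id_whiskerRight _ _ := hom₂_ext fun _ => by simp
  comp_whiskerRight _ _ _ := hom₂_ext fun _ => by simp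
  whiskerRight_id _ := hom₂_ext fun _ => by simp
  whiskerRight_comp _ _ _ := hom₂_ext fun _ => by simp
  whisker_assoc _ _ _ _ _ := hom₂_ext fun _ => by simp
  whisker_exchange _ _ := hom₂_ext fun _ => by simp
  pentagon _ _ _ _ := hom₂_ext fun _ => by simp
  triangle _ _ := hom₂_ext fun _ => by simp

end Cmn

/-- An adjunction `L ⊣ R` between two categories in which all idempotents split. -/
structure Adj where
  A : Type u
  B : Type u
  [catA : Category.{v} A]
  [catB : Category.{v} B]
  [splitA : IsIdempotentComplete A]
  [splitB : IsIdempotentComplete B]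
  L : A ⥤ B
  R : B ⥤ A
  adj : L ⊣ R

attribute [instance] Adj.catA Adj.catB Adj.splitA Adj.splitB

namespace Adj

/-- A morphism of adjunctions: a pair of functors `H`, `K` with natural isomorphisms `K L ≅ L H`
and `H R ≅ R K` that carry the unit to the unit and the counit to the counit. -/
structure Hom (F G : Adj.{v, u}) where
  H : F.A ⥤ G.A
  K : F.B ⥤ G.B
  isoL (a : F.A) : K.obj (F.L.obj a) ≅ G.L.obj (H.obj a)
  isoR (b : F.B) : H.obj (F.R.obj b) ≅ G.R.obj (K.obj b)
  naturalL {a a' : F.A} (f : a ⟶ a') :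
    K.map (F.L.map f) ≫ (isoL a').hom = (isoL a).hom ≫ G.L.map (H.map f)
  naturalR {b b' : F.B} (f : b ⟶ b') :
    H.map (F.R.map f) ≫ (isoR b').hom = (isoR b).hom ≫ G.R.map (K.map f)
  unit (a : F.A) :
    H.map (F.adj.unit.app a) ≫ (isoR (F.L.obj a)).hom ≫ G.R.map (isoL a).hom =
      G.adj.unit.app (H.obj a)
  counit (b : F.B) :
    (isoL (F.R.obj b)).hom ≫ G.L.map (isoR b).hom ≫ G.adj.counit.app (K.obj b) =
      K.map (F.adj.counit.app b)

/-- A 2-cell between morphisms of adjunctions: a pair of natural transformations that commute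
with the structure isomorphisms. -/
structure Hom₂ {F G : Adj.{v, u}} (f g : Hom F G) where
  natH : f.H ⟶ g.H
  natK : f.K ⟶ g.K
  commL (a : F.A) :
    natK.app (F.L.obj a) ≫ (g.isoL a).hom = (f.isoL a).hom ≫ G.L.map (natH.app a)
  commR (b : F.B) :
    natH.app (F.R.obj b) ≫ (g.isoR b).hom = (f.isoR b).hom ≫ G.R.map (natK.app b)

instance (F G : Adj.{v, u}) : Category (Hom F G) where
  Hom f g := Hom₂ f g
  id f := { natH := 𝟙 _, natK := 𝟙 _, commL := by simp, commR := by simp }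
  comp x y :=
    { natH := x.natH ≫ y.natH
      natK := x.natK ≫ y.natK
      commL := fun a => by simp [reassoc_of% (x.commL _), y.commL]
      commR := fun a => by simp [reassoc_of% (x.commR _), y.commR] }

/-- The identity morphism of an adjunction. -/
def Hom.id (F : Adj.{v, u}) : Hom F F where
  H := 𝟭 _
  K := 𝟭 _
  isoL a := Iso.refl _
  isoR b := Iso.refl _
  naturalL f := by simp
  naturalR f := by simp
  unit a := by simp
  counit a := by simp

/-- The composite of two morphisms of adjunctions. -/
def Hom.comp {F G E : Adj.{v, u}} (f : Hom F G) (g : Hom G E) : Hom F E where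
  H := f.H ⋙ g.H
  K := f.K ⋙ g.K
  isoL a := g.K.mapIso (f.isoL a) ≪≫ g.isoL (f.H.obj a)
  isoR b := g.H.mapIso (f.isoR b) ≪≫ g.isoR (f.K.obj b)
  naturalL h := by
    simp only [Functor.comp_map, Iso.trans_hom, Functor.mapIso_hom, Category.assoc, ← g.naturalL]
    simp only [← Functor.map_comp_assoc, f.naturalL]
  naturalR h := by
    simp only [Functor.comp_map, Iso.trans_hom, Functor.mapIso_hom, Category.assoc, ← g.naturalR]
    simp only [← Functor.map_comp_assoc, f.naturalR]
  unit a := by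
    have h1 := g.naturalR (f.isoL a).hom
    have h2 := congrArg g.H.map (f.unit a)
    simp only [Functor.map_comp] at h2
    simp only [Functor.comp_obj, Functor.comp_map, Iso.trans_hom, Functor.mapIso_hom,
      Functor.map_comp, Category.assoc]
    rw [← reassoc_of% h1, reassoc_of% h2, g.unit]
  counit b := by
    have h1 := g.naturalL (f.isoR b).hom
    have h2 := congrArg g.K.map (f.counit b)
    simp only [Functor.map_comp] at h2
    simp only [Functor.comp_obj, Functor.comp_map, Iso.trans_hom, Functor.mapIso_hom,
      Functor.map_comp, Category.assoc]
    rw [← reassoc_of% h1, g.counit, h2]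

instance : CategoryStruct Adj.{v, u} where
  Hom F G := Hom F G
  id F := Hom.id F
  comp f g := Hom.comp f g

instance (F G : Adj.{v, u}) : Category (F ⟶ G) := inferInstanceAs (Category (Hom F G))

theorem hom₂_ext {F G : Adj.{v, u}} {f g : F ⟶ G} {x y : f ⟶ g}
    (h : ∀ a, x.natH.app a = y.natH.app a) (h' : ∀ b, x.natK.app b = y.natK.app b) : x = y := by
  obtain ⟨x, x', _, _⟩ := x
  obtain ⟨y, y', _, _⟩ := y
  obtain rfl : x = y := NatTrans.ext (funext h)
  obtain rfl : x' = y' := NatTrans.ext (funext h')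
  rfl

section

variable {F G E D : Adj.{v, u}}

@[simp] theorem id_H (F : Adj.{v, u}) : Hom.H (𝟙 F) = 𝟭 F.A := rfl

@[simp] theorem id_K (F : Adj.{v, u}) : Hom.K (𝟙 F) = 𝟭 F.B := rfl

@[simp] theorem comp_H (f : F ⟶ G) (g : G ⟶ E) : Hom.H (f ≫ g) = f.H ⋙ g.H := rfl

@[simp] theorem comp_K (f : F ⟶ G) (g : G ⟶ E) : Hom.K (f ≫ g) = f.K ⋙ g.K := rfl

@[simp] theorem id_isoL (F : Adj.{v, u}) (a) : Hom.isoL (𝟙 F) a = Iso.refl _ := rfl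

@[simp] theorem id_isoR (F : Adj.{v, u}) (b) : Hom.isoR (𝟙 F) b = Iso.refl _ := rfl

@[simp] theorem comp_isoL (f : F ⟶ G) (g : G ⟶ E) (a) :
    Hom.isoL (f ≫ g) a = g.K.mapIso (f.isoL a) ≪≫ g.isoL (f.H.obj a) := rfl

@[simp] theorem comp_isoR (f : F ⟶ G) (g : G ⟶ E) (b) :
    Hom.isoR (f ≫ g) b = g.H.mapIso (f.isoR b) ≪≫ g.isoR (f.K.obj b) := rfl

@[simp] theorem id_natH (f : F ⟶ G) (a) : (Hom₂.natH (𝟙 f)).app a = 𝟙 (f.H.obj a) := rfl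

@[simp] theorem id_natK (f : F ⟶ G) (b) : (Hom₂.natK (𝟙 f)).app b = 𝟙 (f.K.obj b) := rfl

@[simp] theorem comp_natH {f g h : F ⟶ G} (x : f ⟶ g) (y : g ⟶ h) (a) :
    (Hom₂.natH (x ≫ y)).app a = x.natH.app a ≫ y.natH.app a := rfl

@[simp] theorem comp_natK {f g h : F ⟶ G} (x : f ⟶ g) (y : g ⟶ h) (b) :
    (Hom₂.natK (x ≫ y)).app b = x.natK.app b ≫ y.natK.app b := rfl

/-- An invertible 2-cell, from natural isomorphisms of the underlying functors. -/
def isoMk {f g : F ⟶ G} (e : f.H ≅ g.H) (e' : f.K ≅ g.K)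
    (h : ∀ a, e'.hom.app (F.L.obj a) ≫ (g.isoL a).hom =
      (f.isoL a).hom ≫ G.L.map (e.hom.app a))
    (h' : ∀ b, e.hom.app (F.R.obj b) ≫ (g.isoR b).hom =
      (f.isoR b).hom ≫ G.R.map (e'.hom.app b)) : f ≅ g where
  hom := { natH := e.hom, natK := e'.hom, commL := h, commR := h' }
  inv :=
    { natH := e.inv
      natK := e'.inv
      commL := fun a => by
        rw [← cancel_epi (e'.hom.app _), ← Category.assoc, ← Category.assoc, h,
          Iso.hom_inv_id_app]
        simp [← Functor.map_comp]
      commR := fun a => by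
        rw [← cancel_epi (e.hom.app _), ← Category.assoc, ← Category.assoc, h',
          Iso.hom_inv_id_app]
        simp [← Functor.map_comp] }
  hom_inv_id := hom₂_ext (fun _ => by simp) (fun _ => by simp)
  inv_hom_id := hom₂_ext (fun _ => by simp) (fun _ => by simp)

@[simp] theorem isoMk_hom_natH {f g : F ⟶ G} (e : f.H ≅ g.H) (e' : f.K ≅ g.K) (h) (h') :
    (isoMk (f := f) (g := g) e e' h h').hom.natH = e.hom := rfl

@[simp] theorem isoMk_hom_natK {f g : F ⟶ G} (e : f.H ≅ g.H) (e' : f.K ≅ g.K) (h) (h') :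
    (isoMk (f := f) (g := g) e e' h h').hom.natK = e'.hom := rfl

@[simp] theorem isoMk_inv_natH {f g : F ⟶ G} (e : f.H ≅ g.H) (e' : f.K ≅ g.K) (h) (h') :
    (isoMk (f := f) (g := g) e e' h h').inv.natH = e.inv := rfl

@[simp] theorem isoMk_inv_natK {f g : F ⟶ G} (e : f.H ≅ g.H) (e' : f.K ≅ g.K) (h) (h') :
    (isoMk (f := f) (g := g) e e' h h').inv.natK = e'.inv := rfl

/-- Left whiskering of 2-cells. -/
def whiskerLeft (f : F ⟶ G) {g h : G ⟶ E} (x : g ⟶ h) : f ≫ g ⟶ f ≫ h :=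
  Hom₂.mk (Functor.whiskerLeft f.H x.natH) (Functor.whiskerLeft f.K x.natK)
    (fun a => by
      have := x.commL (f.H.obj a)
      simp [← this])
    (fun b => by
      have := x.commR (f.K.obj b)
      simp [← this])

/-- Right whiskering of 2-cells. -/
def whiskerRight {f g : F ⟶ G} (x : f ⟶ g) (h : G ⟶ E) : f ≫ h ⟶ g ≫ h :=
  Hom₂.mk (Functor.whiskerRight x.natH h.H) (Functor.whiskerRight x.natK h.K)
    (fun a => by
      have := x.commL a
      simp
      rw [← h.naturalL, ← Functor.map_comp_assoc, this]
      simp)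
    (fun b => by
      have := x.commR b
      simp
      rw [← h.naturalR, ← Functor.map_comp_assoc, this]
      simp)

@[simp] theorem whiskerLeft_natH (f : F ⟶ G) {g h : G ⟶ E} (x : g ⟶ h) (a) :
    (whiskerLeft f x).natH.app a = x.natH.app (f.H.obj a) := rfl

@[simp] theorem whiskerLeft_natK (f : F ⟶ G) {g h : G ⟶ E} (x : g ⟶ h) (b) :
    (whiskerLeft f x).natK.app b = x.natK.app (f.K.obj b) := rfl

@[simp] theorem whiskerRight_natH {f g : F ⟶ G} (x : f ⟶ g) (h : G ⟶ E) (a) :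
    (whiskerRight x h).natH.app a = h.H.map (x.natH.app a) := rfl

@[simp] theorem whiskerRight_natK {f g : F ⟶ G} (x : f ⟶ g) (h : G ⟶ E) (b) :
    (whiskerRight x h).natK.app b = h.K.map (x.natK.app b) := rfl

/-- The associator. -/
@[simps! hom_natH_app inv_natH_app hom_natK_app inv_natK_app]
def associator (f : F ⟶ G) (g : G ⟶ E) (h : E ⟶ D) : (f ≫ g) ≫ h ≅ f ≫ g ≫ h :=
  isoMk (f := (f ≫ g) ≫ h) (g := f ≫ g ≫ h) (Functor.associator _ _ _)
    (Functor.associator _ _ _) (fun a => by simp) (fun b => by simp)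

/-- The left unitor. -/
@[simps! hom_natH_app inv_natH_app hom_natK_app inv_natK_app]
def leftUnitor (f : F ⟶ G) : 𝟙 F ≫ f ≅ f :=
  isoMk (f := 𝟙 F ≫ f) (g := f) (Functor.leftUnitor _) (Functor.leftUnitor _)
    (fun a => by simp) (fun b => by simp)

/-- The right unitor. -/
@[simps! hom_natH_app inv_natH_app hom_natK_app inv_natK_app]
def rightUnitor (f : F ⟶ G) : f ≫ 𝟙 G ≅ f :=
  isoMk (f := f ≫ 𝟙 G) (g := f) (Functor.rightUnitor _) (Functor.rightUnitor _)
    (fun a => by simp) (fun b => by simp)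

end

/-- The 2-category of adjunctions. -/
instance : Bicategory Adj.{v, u} where
  homCategory := inferInstance
  whiskerLeft := whiskerLeft
  whiskerRight := whiskerRight
  associator := associator
  leftUnitor := leftUnitor
  rightUnitor := rightUnitor
  whiskerLeft_id _ _ := hom₂_ext (fun _ => by simp) (fun _ => by simp)
  whiskerLeft_comp _ _ _ _ _ _ := hom₂_ext (fun _ => by simp) (fun _ => by simp)
  id_whiskerLeft _ := hom₂_ext (fun _ => by simp) (fun _ => by simp)
  comp_whiskerLeft _ _ _ _ _ := hom₂_ext (fun _ => by simp) (fun _ => by simp)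
  id_whiskerRight _ _ := hom₂_ext (fun _ => by simp) (fun _ => by simp)
  comp_whiskerRight _ _ _ := hom₂_ext (fun _ => by simp) (fun _ => by simp)
  whiskerRight_id _ := hom₂_ext (fun _ => by simp) (fun _ => by simp)
  whiskerRight_comp _ _ _ := hom₂_ext (fun _ => by simp) (fun _ => by simp)
  whisker_assoc _ _ _ _ _ := hom₂_ext (fun _ => by simp) (fun _ => by simp)
  whisker_exchange _ _ := hom₂_ext (fun _ => by simp) (fun _ => by simp)
  pentagon _ _ _ _ := hom₂_ext (fun _ => by simp) (fun _ => by simp)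
  triangle _ _ := hom₂_ext (fun _ => by simp) (fun _ => by simp)

end Adj

/-- The monad `R L` induced by an adjunction `L ⊣ R`. -/
abbrev adjMonad (F : Adj.{v, u}) : Mnd.{v, u} where
  carrier := F.A
  monad := F.adj.toMonad

/-- The comonad `L R` induced by an adjunction `L ⊣ R`. -/
abbrev adjComonad (F : Adj.{v, u}) : Cmn.{v, u} where
  carrier := F.B
  comonad := F.adj.toComonad

/-- The morphism of induced monads given by a morphism of adjunctions. -/
def adjMonadMap {F G : Adj.{v, u}} (f : F ⟶ G) : adjMonad F ⟶ adjMonad G :=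
  Mnd.Hom.mk (T := adjMonad F) (S := adjMonad G) f.H
    (fun a => f.isoR (F.L.obj a) ≪≫ G.R.mapIso (f.isoL a))
    (fun {a b} h => by
      change f.H.map (F.R.map (F.L.map h)) ≫ (f.isoR (F.L.obj b)).hom ≫ G.R.map (f.isoL b).hom =
        ((f.isoR (F.L.obj a)).hom ≫ G.R.map (f.isoL a).hom) ≫ G.R.map (G.L.map (f.H.map h))
      rw [reassoc_of% (f.naturalR _), ← G.R.map_comp, f.naturalL]
      simp)
    (fun a => f.unit a)
    (fun a => by
      change f.H.map (F.R.map (F.adj.counit.app (F.L.obj a))) ≫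
          (f.isoR (F.L.obj a)).hom ≫ G.R.map (f.isoL a).hom =
        ((f.isoR (F.L.obj (F.R.obj (F.L.obj a)))).hom ≫
            G.R.map (f.isoL (F.R.obj (F.L.obj a))).hom) ≫
          G.R.map (G.L.map ((f.isoR (F.L.obj a)).hom ≫ G.R.map (f.isoL a).hom)) ≫
            G.R.map (G.adj.counit.app (G.L.obj (f.H.obj a)))
      have h := f.naturalR (F.adj.counit.app (F.L.obj a))
      simp only [Functor.comp_obj, Functor.id_obj] at h
      rw [reassoc_of% h, ← f.counit]
      simp only [Functor.map_comp, Category.assoc]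
      simp only [← Functor.map_comp]
      simp)

/-- The morphism of induced comonads given by a morphism of adjunctions. -/
def adjComonadMap {F G : Adj.{v, u}} (f : F ⟶ G) : adjComonad F ⟶ adjComonad G :=
  Cmn.Hom.mk (T := adjComonad F) (S := adjComonad G) f.K
    (fun b => f.isoL (F.R.obj b) ≪≫ G.L.mapIso (f.isoR b))
    (fun {a b} h => by
      change f.K.map (F.L.map (F.R.map h)) ≫ (f.isoL (F.R.obj b)).hom ≫ G.L.map (f.isoR b).hom =
        ((f.isoL (F.R.obj a)).hom ≫ G.L.map (f.isoR a).hom) ≫ G.L.map (G.R.map (f.K.map h))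
      rw [reassoc_of% (f.naturalL _), ← G.L.map_comp, f.naturalR]
      simp)
    (fun b => by
      change ((f.isoL (F.R.obj b)).hom ≫ G.L.map (f.isoR b).hom) ≫
        G.adj.counit.app (f.K.obj b) = f.K.map (F.adj.counit.app b)
      rw [Category.assoc, f.counit])
    (fun b => by
      change f.K.map (F.L.map (F.adj.unit.app (F.R.obj b))) ≫
          ((f.isoL (F.R.obj (F.L.obj (F.R.obj b)))).hom ≫
            G.L.map (f.isoR (F.L.obj (F.R.obj b))).hom) ≫
          G.L.map (G.R.map ((f.isoL (F.R.obj b)).hom ≫ G.L.map (f.isoR b).hom)) =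
        ((f.isoL (F.R.obj b)).hom ≫ G.L.map (f.isoR b).hom) ≫
          G.L.map (G.adj.unit.app (G.R.obj (f.K.obj b)))
      have h := f.naturalL (F.adj.unit.app (F.R.obj b))
      have h2 := f.unit (F.R.obj b)
      simp only [Functor.comp_obj, Functor.id_obj] at h
      rw [Category.assoc, reassoc_of% h]
      simp only [Functor.map_comp, Category.assoc]
      simp only [← Functor.map_comp]
      rw [G.R.map_comp, reassoc_of% h2]
      simp)

/-- `AM`: the pseudofunctor that sends an adjunction to the monad it induces. -/
def AM : Adj.{v, u} ⥤ᵖ Mnd.{v, u} where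
  obj := adjMonad
  map := adjMonadMap
  map₂ {F G f g} x := Mnd.Hom₂.mk (f := adjMonadMap f) (g := adjMonadMap g) x.natH (fun a => by
    change x.natH.app (F.R.obj (F.L.obj a)) ≫ (g.isoR (F.L.obj a)).hom ≫ G.R.map (g.isoL a).hom =
      ((f.isoR (F.L.obj a)).hom ≫ G.R.map (f.isoL a).hom) ≫ G.R.map (G.L.map (x.natH.app a))
    rw [reassoc_of% (x.commR _), ← Functor.map_comp, x.commL]
    simp)
  map₂_id _ := rfl
  map₂_comp _ _ := rfl
  mapId F := Mnd.isoMk (f := adjMonadMap (𝟙 F)) (g := 𝟙 (adjMonad F)) (Iso.refl _) (fun a => by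
    change 𝟙 (F.R.obj (F.L.obj a)) ≫ 𝟙 (F.R.obj (F.L.obj a)) =
      (𝟙 (F.R.obj (F.L.obj a)) ≫ F.R.map (𝟙 (F.L.obj a))) ≫ F.R.map (F.L.map (𝟙 a))
    simp)
  mapComp {F G E} f g := Mnd.isoMk (f := adjMonadMap (f ≫ g)) (g := adjMonadMap f ≫ adjMonadMap g)
    (Iso.refl _) (fun a => by
      change 𝟙 (g.H.obj (f.H.obj (F.R.obj (F.L.obj a)))) ≫
          g.H.map ((f.isoR (F.L.obj a)).hom ≫ G.R.map (f.isoL a).hom) ≫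
            (g.isoR (G.L.obj (f.H.obj a))).hom ≫ E.R.map (g.isoL (f.H.obj a)).hom =
        ((g.H.map (f.isoR (F.L.obj a)).hom ≫ (g.isoR (f.K.obj (F.L.obj a))).hom) ≫
          E.R.map (g.K.map (f.isoL a).hom ≫ (g.isoL (f.H.obj a)).hom)) ≫
            E.R.map (E.L.map (𝟙 (g.H.obj (f.H.obj a))))
      have h := g.naturalR (f.isoL a).hom
      simp [reassoc_of% h])
  map₂_whisker_left _ _ _ _ := Mnd.hom₂_ext fun _ =>
    ((Category.id_comp _).trans (Category.comp_id _)).symm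
  map₂_whisker_right _ _ := Mnd.hom₂_ext fun _ =>
    ((Category.id_comp _).trans (Category.comp_id _)).symm
  map₂_associator {_ _ _ E} f g h := Mnd.hom₂_ext fun a => by
    change 𝟙 (h.H.obj (g.H.obj (f.H.obj a))) =
      𝟙 _ ≫ h.H.map (𝟙 (g.H.obj (f.H.obj a))) ≫ 𝟙 _ ≫ 𝟙 _ ≫ 𝟙 _
    simp
  map₂_left_unitor {F G} f := Mnd.hom₂_ext fun a => by
    change 𝟙 (f.H.obj a) = 𝟙 _ ≫ f.H.map (𝟙 a) ≫ 𝟙 _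
    simp
  map₂_right_unitor {F G} f := Mnd.hom₂_ext fun a => by
    change 𝟙 (f.H.obj a) = 𝟙 _ ≫ 𝟙 _ ≫ 𝟙 _
    simp

/-- `AC`: the pseudofunctor that sends an adjunction to the comonad it induces. -/
def AC : Adj.{v, u} ⥤ᵖ Cmn.{v, u} where
  obj := adjComonad
  map := adjComonadMap
  map₂ {F G f g} x :=
    Cmn.Hom₂.mk (f := adjComonadMap f) (g := adjComonadMap g) x.natK (fun b => by
      change x.natK.app (F.L.obj (F.R.obj b)) ≫
          (g.isoL (F.R.obj b)).hom ≫ G.L.map (g.isoR b).hom =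
        ((f.isoL (F.R.obj b)).hom ≫ G.L.map (f.isoR b).hom) ≫ G.L.map (G.R.map (x.natK.app b))
      rw [reassoc_of% (x.commL _), ← Functor.map_comp, x.commR]
      simp)
  map₂_id _ := rfl
  map₂_comp _ _ := rfl
  mapId F := Cmn.isoMk (f := adjComonadMap (𝟙 F)) (g := 𝟙 (adjComonad F)) (Iso.refl _)
    (fun b => by
      change 𝟙 (F.L.obj (F.R.obj b)) ≫ 𝟙 (F.L.obj (F.R.obj b)) =
        (𝟙 (F.L.obj (F.R.obj b)) ≫ F.L.map (𝟙 (F.R.obj b))) ≫ F.L.map (F.R.map (𝟙 b))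
      simp)
  mapComp {F G E} f g :=
    Cmn.isoMk (f := adjComonadMap (f ≫ g)) (g := adjComonadMap f ≫ adjComonadMap g)
      (Iso.refl _) (fun b => by
        change 𝟙 (g.K.obj (f.K.obj (F.L.obj (F.R.obj b)))) ≫
            g.K.map ((f.isoL (F.R.obj b)).hom ≫ G.L.map (f.isoR b).hom) ≫
              (g.isoL (G.R.obj (f.K.obj b))).hom ≫ E.L.map (g.isoR (f.K.obj b)).hom =
          ((g.K.map (f.isoL (F.R.obj b)).hom ≫ (g.isoL (f.H.obj (F.R.obj b))).hom) ≫
            E.L.map (g.H.map (f.isoR b).hom ≫ (g.isoR (f.K.obj b)).hom)) ≫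
              E.L.map (E.R.map (𝟙 (g.K.obj (f.K.obj b))))
        have h := g.naturalL (f.isoR b).hom
        simp [reassoc_of% h])
  map₂_whisker_left _ _ _ _ := Cmn.hom₂_ext fun _ =>
    ((Category.id_comp _).trans (Category.comp_id _)).symm
  map₂_whisker_right _ _ := Cmn.hom₂_ext fun _ =>
    ((Category.id_comp _).trans (Category.comp_id _)).symm
  map₂_associator f g h := Cmn.hom₂_ext fun b => by
    change 𝟙 (h.K.obj (g.K.obj (f.K.obj b))) =
      𝟙 _ ≫ h.K.map (𝟙 (g.K.obj (f.K.obj b))) ≫ 𝟙 _ ≫ 𝟙 _ ≫ 𝟙 _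
    simp
  map₂_left_unitor f := Cmn.hom₂_ext fun b => by
    change 𝟙 (f.K.obj b) = 𝟙 _ ≫ f.K.map (𝟙 b) ≫ 𝟙 _
    simp
  map₂_right_unitor f := Cmn.hom₂_ext fun b => by
    change 𝟙 (f.K.obj b) = 𝟙 _ ≫ 𝟙 _ ≫ 𝟙 _
    simp

instance {C : Type u} [Category.{v} C] [IsIdempotentComplete C] (T : Monad C) :
    IsIdempotentComplete T.Algebra where
  idempotents_split X p hp := by
    obtain ⟨Y, i, e, h₁, h₂⟩ := IsIdempotentComplete.idempotents_split X.A p.f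
      (congrArg Monad.Algebra.Hom.f hp)
    have hpa : T.map p.f ≫ X.a = X.a ≫ p.f := p.h
    have hpi : i ≫ p.f = i := by rw [← h₂, reassoc_of% h₁]
    have hpe : p.f ≫ e = e := by rw [← h₂, Category.assoc, h₁, Category.comp_id]
    let Z : T.Algebra :=
      { A := Y
        a := T.map i ≫ X.a ≫ e
        unit := by
          have h := T.η.naturality i
          simp only [Functor.id_map] at h
          rw [← reassoc_of% h, X.unit_assoc, h₁]
        assoc := by
          have h := T.μ.naturality i
          simp only [Functor.comp_map] at h
          rw [← reassoc_of% h, X.assoc_assoc]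
          simp only [Functor.map_comp, Category.assoc]
          rw [← T.map_comp_assoc e i, h₂, reassoc_of% hpa, hpe] }
    refine ⟨Z, { f := i, h := ?_ }, { f := e, h := ?_ }, ?_, ?_⟩
    · change T.map i ≫ X.a = (T.map i ≫ X.a ≫ e) ≫ i
      simp only [Category.assoc, h₂]
      rw [← hpa, ← T.map_comp_assoc, hpi]
    · change T.map e ≫ T.map i ≫ X.a ≫ e = X.a ≫ e
      rw [← T.map_comp_assoc e i, h₂, reassoc_of% hpa, hpe]
    · ext; exact h₁
    · ext; exact h₂

instance {C : Type u} [Category.{v} C] [IsIdempotentComplete C] (G : Comonad C) :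
    IsIdempotentComplete G.Coalgebra where
  idempotents_split X p hp := by
    obtain ⟨Y, i, e, h₁, h₂⟩ := IsIdempotentComplete.idempotents_split X.A p.f
      (congrArg Comonad.Coalgebra.Hom.f hp)
    have hpa : X.a ≫ G.map p.f = p.f ≫ X.a := p.h
    have hpi : i ≫ p.f = i := by rw [← h₂, reassoc_of% h₁]
    have hpe : p.f ≫ e = e := by rw [← h₂, Category.assoc, h₁, Category.comp_id]
    let Z : G.Coalgebra :=
      { A := Y
        a := i ≫ X.a ≫ G.map e
        counit := by
          have h := G.ε.naturality e
          simp only [Functor.id_map] at h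
          simp only [Category.assoc]
          rw [h, X.counit_assoc, h₁]
        coassoc := by
          have h := G.δ.naturality e
          simp only [Functor.comp_map] at h
          simp only [Category.assoc, Functor.map_comp]
          rw [h, X.coassoc_assoc, ← G.map_comp_assoc e i, h₂, reassoc_of% hpa, reassoc_of% hpi] }
    refine ⟨Z, { f := i, h := ?_ }, { f := e, h := ?_ }, ?_, ?_⟩
    · change (i ≫ X.a ≫ G.map e) ≫ G.map i = i ≫ X.a
      simp only [Category.assoc]
      rw [← G.map_comp, h₂, hpa, reassoc_of% hpi]
    · change X.a ≫ G.map e = e ≫ i ≫ X.a ≫ G.map e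
      rw [reassoc_of% h₂, ← reassoc_of% hpa, ← G.map_comp, hpe]
    · ext; exact h₁
    · ext; exact h₂

/-- The functor between the categories of algebras given by a morphism of monads. -/
def algMap {T S : Mnd.{v, u}} (f : T ⟶ S) : T.monad.Algebra ⥤ S.monad.Algebra where
  obj X :=
    { A := f.functor.obj X.A
      a := (f.iso X.A).inv ≫ f.functor.map X.a
      unit := by rw [← f.unit]; simp [← Functor.map_comp, X.unit]
      assoc := by
        have h₁ := f.mul X.A
        have h₂ := f.natural X.a
        rw [← cancel_epi (S.monad.map (f.iso X.A).hom), ← cancel_epi (f.iso (T.monad.obj X.A)).hom,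
          ← reassoc_of% h₁]
        simp only [Iso.hom_inv_id_assoc, ← Functor.map_comp, Functor.map_comp_assoc, X.assoc]
        simp only [Functor.map_comp, Iso.map_hom_inv_id_assoc, ← reassoc_of% h₂,
          Iso.hom_inv_id_assoc] }
  map {X Y} h :=
    { f := f.functor.map h.f
      h := by
        change S.monad.map (f.functor.map h.f) ≫ (f.iso Y.A).inv ≫ f.functor.map Y.a =
          ((f.iso X.A).inv ≫ f.functor.map X.a) ≫ f.functor.map h.f
        have h₂ := f.natural h.f
        rw [← cancel_epi (f.iso X.A).hom, ← reassoc_of% h₂]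
        simp [← Functor.map_comp] }

/-- The functor between the categories of coalgebras given by a morphism of comonads. -/
def coalgMap {T S : Cmn.{v, u}} (f : T ⟶ S) : T.comonad.Coalgebra ⥤ S.comonad.Coalgebra where
  obj X :=
    { A := f.functor.obj X.A
      a := f.functor.map X.a ≫ (f.iso X.A).hom
      counit := by
        rw [Category.assoc, f.counit, ← Functor.map_comp, X.counit, CategoryTheory.Functor.map_id]
      coassoc := by
        have h₁ := f.comul X.A
        have h₂ := f.natural X.a
        simp only [Category.assoc, Functor.map_comp]
        rw [← h₁, ← Functor.map_comp_assoc, X.coassoc, Functor.map_comp_assoc, reassoc_of% h₂] }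
  map {X Y} h :=
    { f := f.functor.map h.f
      h := by
        change (f.functor.map X.a ≫ (f.iso X.A).hom) ≫ S.comonad.map (f.functor.map h.f) =
          f.functor.map h.f ≫ f.functor.map Y.a ≫ (f.iso Y.A).hom
        have h₂ := f.natural h.f
        rw [Category.assoc, ← h₂, ← Functor.map_comp_assoc, ← Functor.map_comp_assoc, h.h] }

/-- The category of algebras of a monad, as an adjunction. -/
abbrev emObj (T : Mnd.{v, max u v}) : Adj.{v, max u v} where
  A := T.carrier
  B := T.monad.Algebra
  L := T.monad.free
  R := T.monad.forget
  adj := T.monad.adj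

/-- The category of coalgebras of a comonad, as an adjunction. -/
abbrev ecObj (S : Cmn.{v, max u v}) : Adj.{v, max u v} where
  A := S.comonad.Coalgebra
  B := S.carrier
  L := S.comonad.forget
  R := S.comonad.cofree
  adj := S.comonad.adj

theorem alg_unit {C : Type u} [Category.{v} C] (T : Monad C) (a : C) :
    T.adj.unit.app a = T.η.app a := by
  simp
  rfl

theorem alg_counit {C : Type u} [Category.{v} C] (T : Monad C) (X : T.Algebra) :
    (T.adj.counit.app X).f = X.a := by
  simp
  rfl

theorem coalg_counit {C : Type u} [Category.{v} C] (T : Comonad C) (a : C) :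
    T.adj.counit.app a = T.ε.app a := by
  simp
  rfl

theorem coalg_unit {C : Type u} [Category.{v} C] (T : Comonad C) (X : T.Coalgebra) :
    (T.adj.unit.app X).f = X.a := by
  simp
  rfl

/-- The morphism of adjunctions between categories of algebras given by a morphism of monads. -/
def emMap {T S : Mnd.{v, max u v}} (f : T ⟶ S) : emObj T ⟶ emObj S :=
  Adj.Hom.mk (F := emObj T) (G := emObj S) f.functor (algMap f)
    (fun a => Monad.Algebra.isoMk (f.iso a) (by
      have h := f.mul a
      change S.monad.map (f.iso a).hom ≫ S.monad.μ.app (f.functor.obj a) =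
        ((f.iso (T.monad.obj a)).inv ≫ f.functor.map (T.monad.μ.app a)) ≫ (f.iso a).hom
      rw [Category.assoc, h, Iso.inv_hom_id_assoc]))
    (fun X => Iso.refl _)
    (fun h => by ext; exact f.natural h)
    (fun h => (Category.comp_id _).trans (Category.id_comp _).symm)
    (fun a => by
      change f.functor.map (T.monad.adj.unit.app a) ≫ 𝟙 _ ≫ (f.iso a).hom =
        S.monad.adj.unit.app (f.functor.obj a)
      rw [alg_unit, alg_unit]
      change f.functor.map (T.monad.η.app a) ≫ 𝟙 (f.functor.obj (T.monad.obj a)) ≫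
        (f.iso a).hom = _
      rw [Category.id_comp, f.unit])
    (fun X => by
      ext
      change (f.iso X.A).hom ≫ S.monad.map (𝟙 _) ≫
        (S.monad.adj.counit.app ((algMap f).obj X)).f =
          f.functor.map (T.monad.adj.counit.app X).f
      rw [alg_counit, alg_counit]
      change (f.iso X.A).hom ≫ S.monad.map (𝟙 (f.functor.obj X.A)) ≫
        (f.iso X.A).inv ≫ f.functor.map X.a = f.functor.map X.a
      simp)

/-- The morphism of adjunctions between categories of coalgebras given by a morphism of
comonads. -/
def ecMap {T S : Cmn.{v, max u v}} (f : T ⟶ S) : ecObj T ⟶ ecObj S :=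
  Adj.Hom.mk (F := ecObj T) (G := ecObj S) (coalgMap f) f.functor
    (fun X => Iso.refl _)
    (fun b => Comonad.Coalgebra.isoMk (f.iso b) (by
      have h := f.comul b
      change (f.functor.map (T.comonad.δ.app b) ≫ (f.iso (T.comonad.obj b)).hom) ≫
        S.comonad.map (f.iso b).hom = (f.iso b).hom ≫ S.comonad.δ.app (f.functor.obj b)
      rw [Category.assoc, h]))
    (fun h => (Category.comp_id _).trans (Category.id_comp _).symm)
    (fun h => by ext; exact f.natural h)
    (fun X => by
      ext
      change f.functor.map (T.comonad.adj.unit.app X).f ≫ (f.iso X.A).hom ≫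
        S.comonad.map (𝟙 _) = (S.comonad.adj.unit.app ((coalgMap f).obj X)).f
      rw [coalg_unit, coalg_unit]
      change f.functor.map X.a ≫ (f.iso X.A).hom ≫ S.comonad.map (𝟙 (f.functor.obj X.A)) =
        f.functor.map X.a ≫ (f.iso X.A).hom
      simp)
    (fun b => by
      change 𝟙 _ ≫ (f.iso b).hom ≫ S.comonad.adj.counit.app (f.functor.obj b) =
        f.functor.map (T.comonad.adj.counit.app b)
      rw [coalg_counit, coalg_counit]
      change 𝟙 _ ≫ (f.iso b).hom ≫ S.comonad.ε.app (f.functor.obj b) =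
        f.functor.map (T.comonad.ε.app b)
      rw [Category.id_comp, f.counit])

/-- `EM`: the pseudofunctor that sends a monad to the adjunction between its base and its
(Eilenberg–Moore) category of algebras. -/
def EM : Mnd.{v, max u v} ⥤ᵖ Adj.{v, max u v} where
  obj := emObj
  map := emMap
  map₂ {T S f g} x := Adj.Hom₂.mk (f := emMap f) (g := emMap g) x.nat
    { app := fun X =>
        { f := x.nat.app X.A
          h := by
            change S.monad.map (x.nat.app X.A) ≫ (g.iso X.A).inv ≫ g.functor.map X.a =
              ((f.iso X.A).inv ≫ f.functor.map X.a) ≫ x.nat.app X.A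
            have h := x.comm X.A
            rw [← cancel_epi (f.iso X.A).hom, ← reassoc_of% h]
            simp }
      naturality := fun X Y h => by ext; exact x.nat.naturality h.f }
    (fun a => by ext; exact x.comm a)
    (fun X => (Category.comp_id _).trans (Category.id_comp _).symm)
  map₂_id _ := rfl
  map₂_comp _ _ := rfl
  mapId T := Adj.isoMk (f := emMap (𝟙 T)) (g := 𝟙 (emObj T)) (Iso.refl _)
    (NatIso.ofComponents (fun X => Monad.Algebra.isoMk (Iso.refl _) (by
        change T.monad.map (𝟙 X.A) ≫ X.a = (𝟙 _ ≫ X.a) ≫ 𝟙 X.A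
        simp)) (fun {X Y} h => by
        ext
        exact (Category.comp_id h.f).trans (Category.id_comp h.f).symm))
    (fun a => by
      ext
      change 𝟙 (T.monad.obj a) ≫ 𝟙 (T.monad.obj a) = 𝟙 (T.monad.obj a) ≫ T.monad.map (𝟙 a)
      simp)
    (fun X => by
      change 𝟙 X.A ≫ 𝟙 X.A = 𝟙 X.A ≫ 𝟙 X.A
      rfl)
  mapComp {T S R} f g := Adj.isoMk (f := emMap (f ≫ g)) (g := emMap f ≫ emMap g) (Iso.refl _)
    (NatIso.ofComponents (fun X => Monad.Algebra.isoMk (Iso.refl _) (by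
        change R.monad.map (𝟙 _) ≫ (g.iso (f.functor.obj X.A)).inv ≫
            g.functor.map ((f.iso X.A).inv ≫ f.functor.map X.a) =
          (((g.functor.mapIso (f.iso X.A) ≪≫ g.iso (f.functor.obj X.A)).inv) ≫
            g.functor.map (f.functor.map X.a)) ≫ 𝟙 _
        simp)) (fun {X Y} h => by
        ext
        exact (Category.comp_id (g.functor.map (f.functor.map h.f))).trans
          (Category.id_comp _).symm))
    (fun a => by
      ext
      change 𝟙 _ ≫ g.functor.map (f.iso a).hom ≫ (g.iso (f.functor.obj a)).hom =
        (g.functor.map (f.iso a).hom ≫ (g.iso (f.functor.obj a)).hom) ≫ R.monad.map (𝟙 _)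
      simp)
    (fun X => by
      change 𝟙 _ ≫ g.functor.map (𝟙 (f.functor.obj X.A)) ≫ 𝟙 (g.functor.obj _) = 𝟙 _ ≫ 𝟙 _
      simp)
  map₂_whisker_left f _ _ x := Adj.hom₂_ext
    (fun _ => ((Category.id_comp _).trans (Category.comp_id _)).symm)
    (fun X => by ext; exact ((Category.id_comp _).trans (Category.comp_id _)).symm)
  map₂_whisker_right x g := Adj.hom₂_ext
    (fun _ => ((Category.id_comp _).trans (Category.comp_id _)).symm)
    (fun X => by ext; exact ((Category.id_comp _).trans (Category.comp_id _)).symm)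
  map₂_associator f g h := Adj.hom₂_ext
    (fun a => by
      change 𝟙 (h.functor.obj (g.functor.obj (f.functor.obj a))) =
        𝟙 _ ≫ h.functor.map (𝟙 (g.functor.obj (f.functor.obj a))) ≫ 𝟙 _ ≫ 𝟙 _ ≫ 𝟙 _
      simp)
    (fun X => by
      ext
      change 𝟙 (h.functor.obj (g.functor.obj (f.functor.obj X.A))) =
        𝟙 _ ≫ h.functor.map (𝟙 (g.functor.obj (f.functor.obj X.A))) ≫ 𝟙 _ ≫ 𝟙 _ ≫ 𝟙 _
      simp)
  map₂_left_unitor f := Adj.hom₂_ext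
    (fun a => by
      change 𝟙 (f.functor.obj a) = 𝟙 _ ≫ f.functor.map (𝟙 a) ≫ 𝟙 _
      simp)
    (fun X => by
      ext
      change 𝟙 (f.functor.obj X.A) = 𝟙 _ ≫ f.functor.map (𝟙 X.A) ≫ 𝟙 _
      simp)
  map₂_right_unitor f := Adj.hom₂_ext
    (fun a => by
      change 𝟙 (f.functor.obj a) = 𝟙 _ ≫ 𝟙 _ ≫ 𝟙 _
      simp)
    (fun X => by
      ext
      change 𝟙 (f.functor.obj X.A) = 𝟙 _ ≫ 𝟙 _ ≫ 𝟙 _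
      simp)

/-- `EC`: the pseudofunctor that sends a comonad to the adjunction between its
(Eilenberg–Moore) category of coalgebras and its base. -/
def EC : Cmn.{v, max u v} ⥤ᵖ Adj.{v, max u v} where
  obj := ecObj
  map := ecMap
  map₂ {T S f g} x := Adj.Hom₂.mk (f := ecMap f) (g := ecMap g)
    { app := fun X =>
        { f := x.nat.app X.A
          h := by
            change (f.functor.map X.a ≫ (f.iso X.A).hom) ≫ S.comonad.map (x.nat.app X.A) =
              x.nat.app X.A ≫ g.functor.map X.a ≫ (g.iso X.A).hom
            have h := x.comm X.A
            rw [Category.assoc, ← h, x.nat.naturality_assoc] }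
      naturality := fun X Y h => by ext; exact x.nat.naturality h.f }
    x.nat
    (fun X => (Category.comp_id _).trans (Category.id_comp _).symm)
    (fun a => by ext; exact x.comm a)
  map₂_id _ := rfl
  map₂_comp _ _ := rfl
  mapId T := Adj.isoMk (f := ecMap (𝟙 T)) (g := 𝟙 (ecObj T))
    (NatIso.ofComponents (fun X => Comonad.Coalgebra.isoMk (Iso.refl _) (by
        change (X.a ≫ 𝟙 _) ≫ T.comonad.map (𝟙 X.A) = 𝟙 X.A ≫ X.a
        simp)) (fun {X Y} h => by
        ext
        exact (Category.comp_id h.f).trans (Category.id_comp h.f).symm))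
    (Iso.refl _)
    (fun X => by
      change 𝟙 X.A ≫ 𝟙 X.A = 𝟙 X.A ≫ 𝟙 X.A
      rfl)
    (fun a => by
      ext
      change 𝟙 (T.comonad.obj a) ≫ 𝟙 (T.comonad.obj a) =
        𝟙 (T.comonad.obj a) ≫ T.comonad.map (𝟙 a)
      simp)
  mapComp {T S R} f g := Adj.isoMk (f := ecMap (f ≫ g)) (g := ecMap f ≫ ecMap g)
    (NatIso.ofComponents (fun X => Comonad.Coalgebra.isoMk (Iso.refl _) (by
        change (g.functor.map (f.functor.map X.a) ≫
            g.functor.map (f.iso X.A).hom ≫ (g.iso (f.functor.obj X.A)).hom) ≫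
              R.comonad.map (𝟙 _) =
          𝟙 _ ≫ g.functor.map (f.functor.map X.a ≫ (f.iso X.A).hom) ≫
            (g.iso (f.functor.obj X.A)).hom
        simp)) (fun {X Y} h => by
        ext
        exact (Category.comp_id (g.functor.map (f.functor.map h.f))).trans
          (Category.id_comp _).symm))
    (Iso.refl _)
    (fun X => by
      change 𝟙 _ ≫ g.functor.map (𝟙 (f.functor.obj X.A)) ≫ 𝟙 (g.functor.obj _) = 𝟙 _ ≫ 𝟙 _
      simp)
    (fun a => by
      ext
      change 𝟙 _ ≫ g.functor.map (f.iso a).hom ≫ (g.iso (f.functor.obj a)).hom =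
        (g.functor.map (f.iso a).hom ≫ (g.iso (f.functor.obj a)).hom) ≫ R.comonad.map (𝟙 _)
      simp)
  map₂_whisker_left f _ _ x := Adj.hom₂_ext
    (fun X => by ext; exact ((Category.id_comp _).trans (Category.comp_id _)).symm)
    (fun _ => ((Category.id_comp _).trans (Category.comp_id _)).symm)
  map₂_whisker_right x g := Adj.hom₂_ext
    (fun X => by ext; exact ((Category.id_comp _).trans (Category.comp_id _)).symm)
    (fun _ => ((Category.id_comp _).trans (Category.comp_id _)).symm)
  map₂_associator f g h := Adj.hom₂_ext
    (fun X => by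
      ext
      change 𝟙 (h.functor.obj (g.functor.obj (f.functor.obj X.A))) =
        𝟙 _ ≫ h.functor.map (𝟙 (g.functor.obj (f.functor.obj X.A))) ≫ 𝟙 _ ≫ 𝟙 _ ≫ 𝟙 _
      simp)
    (fun a => by
      change 𝟙 (h.functor.obj (g.functor.obj (f.functor.obj a))) =
        𝟙 _ ≫ h.functor.map (𝟙 (g.functor.obj (f.functor.obj a))) ≫ 𝟙 _ ≫ 𝟙 _ ≫ 𝟙 _
      simp)
  map₂_left_unitor f := Adj.hom₂_ext
    (fun X => by
      ext
      change 𝟙 (f.functor.obj X.A) = 𝟙 _ ≫ f.functor.map (𝟙 X.A) ≫ 𝟙 _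
      simp)
    (fun a => by
      change 𝟙 (f.functor.obj a) = 𝟙 _ ≫ f.functor.map (𝟙 a) ≫ 𝟙 _
      simp)
  map₂_right_unitor f := Adj.hom₂_ext
    (fun X => by
      ext
      change 𝟙 (f.functor.obj X.A) = 𝟙 _ ≫ 𝟙 _ ≫ 𝟙 _
      simp)
    (fun a => by
      change 𝟙 (f.functor.obj a) = 𝟙 _ ≫ 𝟙 _ ≫ 𝟙 _
      simp)

/-- The objects of `B` that are retracts of some `L a`. For the adjunction of a monad with its
category of algebras these are the projective algebras, i.e. the retracts of free algebras. -/
def isProj (F : Adj.{v, u}) : ObjectProperty F.B :=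
  fun b => ∃ a : F.A, Nonempty (Retract b (F.L.obj a))

/-- The objects of `A` that are retracts of some `R b`. For the adjunction of a comonad with its
category of coalgebras these are the injective coalgebras, i.e. the retracts of cofree ones. -/
def isInj (F : Adj.{v, u}) : ObjectProperty F.A :=
  fun a => ∃ b : F.B, Nonempty (Retract a (F.R.obj b))

theorem isProj_L (F : Adj.{v, u}) (a : F.A) : isProj F (F.L.obj a) := ⟨a, ⟨Retract.refl _⟩⟩

theorem isInj_R (F : Adj.{v, u}) (b : F.B) : isInj F (F.R.obj b) := ⟨b, ⟨Retract.refl _⟩⟩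

theorem isProj_K {F G : Adj.{v, u}} (f : F ⟶ G) (b : F.B) (h : isProj F b) :
    isProj G (f.K.obj b) := by
  obtain ⟨a, ⟨r⟩⟩ := h
  exact ⟨f.H.obj a, ⟨(r.map f.K).trans (Retract.ofIso (f.isoL a))⟩⟩

theorem isInj_H {F G : Adj.{v, u}} (f : F ⟶ G) (a : F.A) (h : isInj F a) :
    isInj G (f.H.obj a) := by
  obtain ⟨b, ⟨r⟩⟩ := h
  exact ⟨f.K.obj b, ⟨(r.map f.H).trans (Retract.ofIso (f.isoR b))⟩⟩

instance (F : Adj.{v, u}) : IsIdempotentComplete (isProj F).FullSubcategory where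
  idempotents_split X p hp := by
    obtain ⟨Y, i, e, h₁, h₂⟩ := IsIdempotentComplete.idempotents_split X.obj p.hom
      (congrArg InducedCategory.Hom.hom hp)
    obtain ⟨a, ⟨r⟩⟩ := X.property
    let s : Retract Y X.obj := { i := i, r := e, retract := h₁ }
    exact ⟨⟨Y, a, ⟨s.trans r⟩⟩, ObjectProperty.homMk i, ObjectProperty.homMk e,
      by ext; exact h₁, by ext; exact h₂⟩

instance (F : Adj.{v, u}) : IsIdempotentComplete (isInj F).FullSubcategory where
  idempotents_split X p hp := by
    obtain ⟨Y, i, e, h₁, h₂⟩ := IsIdempotentComplete.idempotents_split X.obj p.hom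
      (congrArg InducedCategory.Hom.hom hp)
    obtain ⟨a, ⟨r⟩⟩ := X.property
    let s : Retract Y X.obj := { i := i, r := e, retract := h₁ }
    exact ⟨⟨Y, a, ⟨s.trans r⟩⟩, ObjectProperty.homMk i, ObjectProperty.homMk e,
      by ext; exact h₁, by ext; exact h₂⟩

/-- An adjunction `L ⊣ R`, with `B` cut down to the retracts of the objects `L a`. -/
abbrev projObj (F : Adj.{v, u}) : Adj.{v, u} where
  A := F.A
  B := (isProj F).FullSubcategory
  L := (isProj F).lift F.L (isProj_L F)
  R := (isProj F).ι ⋙ F.R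
  adj :=
    { unit := { app := fun a => F.adj.unit.app a, naturality := fun _ _ f => F.adj.unit.naturality f }
      counit :=
        { app := fun b => ObjectProperty.homMk (F.adj.counit.app b.obj)
          naturality := fun _ _ f => by ext; exact F.adj.counit.naturality f.hom }
      left_triangle_components := fun a => by ext; exact F.adj.left_triangle_components a
      right_triangle_components := fun b => F.adj.right_triangle_components b.obj }

/-- An adjunction `L ⊣ R`, with `A` cut down to the retracts of the objects `R b`. -/
abbrev injObj (F : Adj.{v, u}) : Adj.{v, u} where
  A := (isInj F).FullSubcategory
  B := F.B
  L := (isInj F).ι ⋙ F.L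
  R := (isInj F).lift F.R (isInj_R F)
  adj :=
    { unit :=
        { app := fun a => ObjectProperty.homMk (F.adj.unit.app a.obj)
          naturality := fun _ _ f => by ext; exact F.adj.unit.naturality f.hom }
      counit :=
        { app := fun b => F.adj.counit.app b, naturality := fun _ _ f => F.adj.counit.naturality f }
      left_triangle_components := fun a => F.adj.left_triangle_components a.obj
      right_triangle_components := fun b => by ext; exact F.adj.right_triangle_components b }

/-- The restriction of a morphism of adjunctions to the retracts of the objects `L a`. -/
def projMap {F G : Adj.{v, u}} (f : F ⟶ G) : projObj F ⟶ projObj G :=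
  Adj.Hom.mk (F := projObj F) (G := projObj G) f.H
    ((isProj G).lift ((isProj F).ι ⋙ f.K) (fun b => isProj_K f b.obj b.property))
    (fun a => (isProj G).isoMk (f.isoL a))
    (fun b => f.isoR b.obj)
    (fun h => by ext; exact f.naturalL h)
    (fun h => f.naturalR h.hom)
    (fun a => f.unit a)
    (fun b => by ext; exact f.counit b.obj)

/-- The restriction of a morphism of adjunctions to the retracts of the objects `R b`. -/
def injMap {F G : Adj.{v, u}} (f : F ⟶ G) : injObj F ⟶ injObj G :=
  Adj.Hom.mk (F := injObj F) (G := injObj G)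
    ((isInj G).lift ((isInj F).ι ⋙ f.H) (fun b => isInj_H f b.obj b.property)) f.K
    (fun a => f.isoL a.obj)
    (fun b => (isInj G).isoMk (f.isoR b))
    (fun h => f.naturalL h.hom)
    (fun h => by ext; exact f.naturalR h)
    (fun a => by ext; exact f.unit a.obj)
    (fun b => f.counit b)

/-- The pseudofunctor that sends an adjunction `L ⊣ R` to its restriction to the retracts of the
objects `L a`. -/
def projPart : Adj.{v, u} ⥤ᵖ Adj.{v, u} where
  obj := projObj
  map := projMap
  map₂ {F G f g} x := Adj.Hom₂.mk (f := projMap f) (g := projMap g) x.natH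
    { app := fun b => ObjectProperty.homMk (x.natK.app b.obj)
      naturality := fun _ _ h => by ext; exact x.natK.naturality h.hom }
    (fun a => by ext; exact x.commL a)
    (fun b => x.commR b.obj)
  map₂_id _ := rfl
  map₂_comp _ _ := rfl
  mapId F := Adj.isoMk (f := projMap (𝟙 F)) (g := 𝟙 (projObj F)) (Iso.refl _)
    (NatIso.ofComponents (fun b => (isProj F).isoMk (Iso.refl b.obj)) (fun {_ _} h => by
      ext
      exact (Category.comp_id h.hom).trans (Category.id_comp h.hom).symm))
    (fun a => by
      ext
      change 𝟙 (F.L.obj a) ≫ 𝟙 (F.L.obj a) = 𝟙 (F.L.obj a) ≫ F.L.map (𝟙 a)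
      simp)
    (fun b => by
      change 𝟙 (F.R.obj b.obj) ≫ 𝟙 (F.R.obj b.obj) = 𝟙 (F.R.obj b.obj) ≫ F.R.map (𝟙 b.obj)
      simp)
  mapComp {F G E} f g := Adj.isoMk (f := projMap (f ≫ g)) (g := projMap f ≫ projMap g)
    (Iso.refl _)
    (NatIso.ofComponents (fun b => (isProj E).isoMk (Iso.refl (g.K.obj (f.K.obj b.obj))))
      (fun {_ _} h => by
        ext
        exact (Category.comp_id (g.K.map (f.K.map h.hom))).trans (Category.id_comp _).symm))
    (fun a => by
      ext
      change 𝟙 _ ≫ g.K.map (f.isoL a).hom ≫ (g.isoL (f.H.obj a)).hom =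
        (g.K.map (f.isoL a).hom ≫ (g.isoL (f.H.obj a)).hom) ≫ E.L.map (𝟙 _)
      simp)
    (fun b => by
      change 𝟙 _ ≫ g.H.map (f.isoR b.obj).hom ≫ (g.isoR (f.K.obj b.obj)).hom =
        (g.H.map (f.isoR b.obj).hom ≫ (g.isoR (f.K.obj b.obj)).hom) ≫ E.R.map (𝟙 _)
      simp)
  map₂_whisker_left f _ _ x := Adj.hom₂_ext
    (fun _ => ((Category.id_comp _).trans (Category.comp_id _)).symm)
    (fun _ => by ext; exact ((Category.id_comp _).trans (Category.comp_id _)).symm)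
  map₂_whisker_right x g := Adj.hom₂_ext
    (fun _ => ((Category.id_comp _).trans (Category.comp_id _)).symm)
    (fun _ => by ext; exact ((Category.id_comp _).trans (Category.comp_id _)).symm)
  map₂_associator f g h := Adj.hom₂_ext
    (fun a => by
      change 𝟙 (h.H.obj (g.H.obj (f.H.obj a))) =
        𝟙 _ ≫ h.H.map (𝟙 (g.H.obj (f.H.obj a))) ≫ 𝟙 _ ≫ 𝟙 _ ≫ 𝟙 _
      simp)
    (fun b => by
      ext
      change 𝟙 (h.K.obj (g.K.obj (f.K.obj b.obj))) =
        𝟙 _ ≫ h.K.map (𝟙 (g.K.obj (f.K.obj b.obj))) ≫ 𝟙 _ ≫ 𝟙 _ ≫ 𝟙 _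
      simp)
  map₂_left_unitor f := Adj.hom₂_ext
    (fun a => by
      change 𝟙 (f.H.obj a) = 𝟙 _ ≫ f.H.map (𝟙 a) ≫ 𝟙 _
      simp)
    (fun b => by
      ext
      change 𝟙 (f.K.obj b.obj) = 𝟙 _ ≫ f.K.map (𝟙 b.obj) ≫ 𝟙 _
      simp)
  map₂_right_unitor f := Adj.hom₂_ext
    (fun a => by
      change 𝟙 (f.H.obj a) = 𝟙 _ ≫ 𝟙 _ ≫ 𝟙 _
      simp)
    (fun b => by
      ext
      change 𝟙 (f.K.obj b.obj) = 𝟙 _ ≫ 𝟙 _ ≫ 𝟙 _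
      simp)

/-- The pseudofunctor that sends an adjunction `L ⊣ R` to its restriction to the retracts of the
objects `R b`. -/
def injPart : Adj.{v, u} ⥤ᵖ Adj.{v, u} where
  obj := injObj
  map := injMap
  map₂ {F G f g} x := Adj.Hom₂.mk (f := injMap f) (g := injMap g)
    { app := fun a => ObjectProperty.homMk (x.natH.app a.obj)
      naturality := fun _ _ h => by ext; exact x.natH.naturality h.hom }
    x.natK
    (fun a => x.commL a.obj)
    (fun b => by ext; exact x.commR b)
  map₂_id _ := rfl
  map₂_comp _ _ := rfl
  mapId F := Adj.isoMk (f := injMap (𝟙 F)) (g := 𝟙 (injObj F))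
    (NatIso.ofComponents (fun a => (isInj F).isoMk (Iso.refl a.obj)) (fun {_ _} h => by
      ext
      exact (Category.comp_id h.hom).trans (Category.id_comp h.hom).symm))
    (Iso.refl _)
    (fun a => by
      change 𝟙 (F.L.obj a.obj) ≫ 𝟙 (F.L.obj a.obj) = 𝟙 (F.L.obj a.obj) ≫ F.L.map (𝟙 a.obj)
      simp)
    (fun b => by
      ext
      change 𝟙 (F.R.obj b) ≫ 𝟙 (F.R.obj b) = 𝟙 (F.R.obj b) ≫ F.R.map (𝟙 b)
      simp)
  mapComp {F G E} f g := Adj.isoMk (f := injMap (f ≫ g)) (g := injMap f ≫ injMap g)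
    (NatIso.ofComponents (fun a => (isInj E).isoMk (Iso.refl (g.H.obj (f.H.obj a.obj))))
      (fun {_ _} h => by
        ext
        exact (Category.comp_id (g.H.map (f.H.map h.hom))).trans (Category.id_comp _).symm))
    (Iso.refl _)
    (fun a => by
      change 𝟙 _ ≫ g.K.map (f.isoL a.obj).hom ≫ (g.isoL (f.H.obj a.obj)).hom =
        (g.K.map (f.isoL a.obj).hom ≫ (g.isoL (f.H.obj a.obj)).hom) ≫ E.L.map (𝟙 _)
      simp)
    (fun b => by
      ext
      change 𝟙 _ ≫ g.H.map (f.isoR b).hom ≫ (g.isoR (f.K.obj b)).hom =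
        (g.H.map (f.isoR b).hom ≫ (g.isoR (f.K.obj b)).hom) ≫ E.R.map (𝟙 _)
      simp)
  map₂_whisker_left f _ _ x := Adj.hom₂_ext
    (fun _ => by ext; exact ((Category.id_comp _).trans (Category.comp_id _)).symm)
    (fun _ => ((Category.id_comp _).trans (Category.comp_id _)).symm)
  map₂_whisker_right x g := Adj.hom₂_ext
    (fun _ => by ext; exact ((Category.id_comp _).trans (Category.comp_id _)).symm)
    (fun _ => ((Category.id_comp _).trans (Category.comp_id _)).symm)
  map₂_associator f g h := Adj.hom₂_ext
    (fun a => by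
      ext
      change 𝟙 (h.H.obj (g.H.obj (f.H.obj a.obj))) =
        𝟙 _ ≫ h.H.map (𝟙 (g.H.obj (f.H.obj a.obj))) ≫ 𝟙 _ ≫ 𝟙 _ ≫ 𝟙 _
      simp)
    (fun b => by
      change 𝟙 (h.K.obj (g.K.obj (f.K.obj b))) =
        𝟙 _ ≫ h.K.map (𝟙 (g.K.obj (f.K.obj b))) ≫ 𝟙 _ ≫ 𝟙 _ ≫ 𝟙 _
      simp)
  map₂_left_unitor f := Adj.hom₂_ext
    (fun a => by
      ext
      change 𝟙 (f.H.obj a.obj) = 𝟙 _ ≫ f.H.map (𝟙 a.obj) ≫ 𝟙 _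
      simp)
    (fun b => by
      change 𝟙 (f.K.obj b) = 𝟙 _ ≫ f.K.map (𝟙 b) ≫ 𝟙 _
      simp)
  map₂_right_unitor f := Adj.hom₂_ext
    (fun a => by
      ext
      change 𝟙 (f.H.obj a.obj) = 𝟙 _ ≫ 𝟙 _ ≫ 𝟙 _
      simp)
    (fun b => by
      change 𝟙 (f.K.obj b) = 𝟙 _ ≫ 𝟙 _ ≫ 𝟙 _
      simp)

/-- `KM`: the pseudofunctor that sends a monad to the adjunction between its base and its
category of projective algebras, the completion of its Kleisli category (the category of free
algebras) under splitting of idempotents. -/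
def KM : Mnd.{v, max u v} ⥤ᵖ Adj.{v, max u v} := EM.{v, u}.comp projPart

/-- `KC`: the pseudofunctor that sends a comonad to the adjunction between its category of
injective coalgebras, the completion of its Kleisli category (the category of cofree coalgebras)
under splitting of idempotents, and its base. -/
def KC : Cmn.{v, max u v} ⥤ᵖ Adj.{v, max u v} := EC.{v, u}.comp injPart

/-- The Street monad on the 2-category of monads. -/
def streetM : Mnd.{v, max u v} ⥤ᵖ Mnd.{v, max u v} :=
  KM.{v, u}.comp (AC.comp (EC.{v, u}.comp AM))

/-- The Street monad on the 2-category of comonads. -/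
def streetE : Cmn.{v, max u v} ⥤ᵖ Cmn.{v, max u v} :=
  KC.{v, u}.comp (AM.comp (EM.{v, u}.comp AC))

/-- The comparison morphism from an adjunction to the adjunction of the category of coalgebras of
the comonad it induces. -/
def compareEC (F : Adj.{v, max u v}) : F ⟶ EC.{v, u}.obj (AC.obj F) :=
  Adj.Hom.mk (F := F) (G := ecObj (adjComonad F)) (Comonad.comparison F.adj) (𝟭 F.B)
    (fun a => Iso.refl (F.L.obj a))
    (fun b => Comonad.Coalgebra.isoMk (Iso.refl (F.L.obj (F.R.obj b))) (by
      change F.L.map (F.adj.unit.app (F.R.obj b)) ≫ F.L.map (F.R.map (𝟙 (F.L.obj (F.R.obj b)))) =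
        𝟙 (F.L.obj (F.R.obj b)) ≫ F.L.map (F.adj.unit.app (F.R.obj b))
      simp))
    (fun f => (Category.comp_id (F.L.map f)).trans (Category.id_comp (F.L.map f)).symm)
    (fun f => by
      ext
      exact (Category.comp_id (F.L.map (F.R.map f))).trans (Category.id_comp _).symm)
    (fun a => by
      ext
      change F.L.map (F.adj.unit.app a) ≫ 𝟙 _ ≫ F.L.map (F.R.map (𝟙 (F.L.obj a))) =
        ((adjComonad F).comonad.adj.unit.app ((Comonad.comparison F.adj).obj a)).f
      rw [coalg_unit]
      change F.L.map (F.adj.unit.app a) ≫ 𝟙 (F.L.obj (F.R.obj (F.L.obj a))) ≫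
        F.L.map (F.R.map (𝟙 (F.L.obj a))) = F.L.map (F.adj.unit.app a)
      simp)
    (fun b => by
      change 𝟙 (F.L.obj (F.R.obj b)) ≫ 𝟙 (F.L.obj (F.R.obj b)) ≫
        (adjComonad F).comonad.adj.counit.app b = F.adj.counit.app b
      rw [coalg_counit]
      change 𝟙 (F.L.obj (F.R.obj b)) ≫ 𝟙 (F.L.obj (F.R.obj b)) ≫ F.adj.counit.app b = _
      simp)

/-- The comparison morphism from an adjunction to the adjunction of the category of algebras of
the monad it induces. -/
def compareEM (F : Adj.{v, max u v}) : F ⟶ EM.{v, u}.obj (AM.obj F) :=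
  Adj.Hom.mk (F := F) (G := emObj (adjMonad F)) (𝟭 F.A) (Monad.comparison F.adj)
    (fun a => Monad.Algebra.isoMk (Iso.refl (F.R.obj (F.L.obj a))) (by
      change F.R.map (F.L.map (𝟙 (F.R.obj (F.L.obj a)))) ≫ F.R.map (F.adj.counit.app (F.L.obj a)) =
        F.R.map (F.adj.counit.app (F.L.obj a)) ≫ 𝟙 (F.R.obj (F.L.obj a))
      simp))
    (fun b => Iso.refl (F.R.obj b))
    (fun f => by
      ext
      exact (Category.comp_id (F.R.map (F.L.map f))).trans (Category.id_comp _).symm)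
    (fun f => (Category.comp_id (F.R.map f)).trans (Category.id_comp (F.R.map f)).symm)
    (fun a => by
      change F.adj.unit.app a ≫ 𝟙 (F.R.obj (F.L.obj a)) ≫ 𝟙 (F.R.obj (F.L.obj a)) =
        (adjMonad F).monad.adj.unit.app a
      rw [alg_unit]
      change F.adj.unit.app a ≫ 𝟙 (F.R.obj (F.L.obj a)) ≫ 𝟙 (F.R.obj (F.L.obj a)) =
        F.adj.unit.app a
      simp)
    (fun b => by
      ext
      change 𝟙 (F.R.obj (F.L.obj (F.R.obj b))) ≫ F.R.map (F.L.map (𝟙 (F.R.obj b))) ≫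
        ((adjMonad F).monad.adj.counit.app ((Monad.comparison F.adj).obj b)).f =
          F.R.map (F.adj.counit.app b)
      rw [alg_counit]
      change 𝟙 (F.R.obj (F.L.obj (F.R.obj b))) ≫ F.R.map (F.L.map (𝟙 (F.R.obj b))) ≫
        F.R.map (F.adj.counit.app b) = F.R.map (F.adj.counit.app b)
      simp)

/-- The naturality of the comparison with coalgebras. -/
def compareECNat {F G : Adj.{v, max u v}} (f : F ⟶ G) :
    f ≫ compareEC.{v, u} G ≅ compareEC.{v, u} F ≫ EC.{v, u}.map (AC.map f) :=
  Adj.isoMk (f := f ≫ compareEC.{v, u} G) (g := compareEC.{v, u} F ≫ EC.{v, u}.map (AC.map f))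
    (NatIso.ofComponents
      (fun a => Comonad.Coalgebra.isoMk (f.isoL a).symm (by
        change G.L.map (G.adj.unit.app (f.H.obj a)) ≫ G.L.map (G.R.map (f.isoL a).inv) =
          (f.isoL a).inv ≫ f.K.map (F.L.map (F.adj.unit.app a)) ≫
            (f.isoL (F.R.obj (F.L.obj a))).hom ≫ G.L.map (f.isoR (F.L.obj a)).hom
        have h := f.naturalL (F.adj.unit.app a)
        simp only [Functor.comp_obj, Functor.id_obj] at h
        rw [reassoc_of% h, Iso.inv_hom_id_assoc, ← f.unit, ← Functor.map_comp, ← Functor.map_comp]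
        simp))
      (fun {a b} h => by
        refine Comonad.Coalgebra.Hom.ext' _ _ _ _ ?_
        change G.L.map (f.H.map h) ≫ (f.isoL b).inv = (f.isoL a).inv ≫ f.K.map (F.L.map h)
        have h' := f.naturalL h
        rw [← cancel_epi (f.isoL a).hom, ← reassoc_of% h']
        simp))
    (Iso.refl _)
    (fun a => by
      change 𝟙 (f.K.obj (F.L.obj a)) ≫ f.K.map (𝟙 (F.L.obj a)) ≫ 𝟙 (f.K.obj (F.L.obj a)) =
        ((f.isoL a).hom ≫ 𝟙 _) ≫ (f.isoL a).inv
      simp)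
    (fun b => by
      refine Comonad.Coalgebra.Hom.ext' _ _ _ _ ?_
      change (f.isoL (F.R.obj b)).inv ≫ f.K.map (𝟙 (F.L.obj (F.R.obj b))) ≫
          (f.isoL (F.R.obj b)).hom ≫ G.L.map (f.isoR b).hom =
        (G.L.map (f.isoR b).hom ≫ 𝟙 _) ≫ G.L.map (G.R.map (𝟙 (f.K.obj b)))
      simp)

/-- The naturality of the comparison with algebras. -/
def compareEMNat {F G : Adj.{v, max u v}} (f : F ⟶ G) :
    f ≫ compareEM.{v, u} G ≅ compareEM.{v, u} F ≫ EM.{v, u}.map (AM.map f) :=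
  Adj.isoMk (f := f ≫ compareEM.{v, u} G) (g := compareEM.{v, u} F ≫ EM.{v, u}.map (AM.map f))
    (Iso.refl _)
    (NatIso.ofComponents
      (fun b => Monad.Algebra.isoMk (f.isoR b).symm (by
        change G.R.map (G.L.map (f.isoR b).inv) ≫
            (f.isoR (F.L.obj (F.R.obj b)) ≪≫ G.R.mapIso (f.isoL (F.R.obj b))).inv ≫
              f.H.map (F.R.map (F.adj.counit.app b)) =
          G.R.map (G.adj.counit.app (f.K.obj b)) ≫ (f.isoR b).inv
        have h := f.naturalR (F.adj.counit.app b)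
        simp only [Functor.comp_obj, Functor.id_obj] at h
        rw [← cancel_mono (f.isoR b).hom]
        simp only [Category.assoc, h, ← f.counit]
        simp [← Functor.map_comp_assoc, ← Functor.map_comp]))
      (fun {a b} h => by
        refine Monad.Algebra.Hom.ext' _ _ _ _ ?_
        change G.R.map (f.K.map h) ≫ (f.isoR b).inv = (f.isoR a).inv ≫ f.H.map (F.R.map h)
        have h' := f.naturalR h
        rw [← cancel_epi (f.isoR a).hom, ← reassoc_of% h']
        simp))
    (fun a => by
      refine Monad.Algebra.Hom.ext' _ _ _ _ ?_
      change (f.isoR (F.L.obj a)).inv ≫ f.H.map (𝟙 (F.R.obj (F.L.obj a))) ≫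
          (f.isoR (F.L.obj a)).hom ≫ G.R.map (f.isoL a).hom =
        (G.R.map (f.isoL a).hom ≫ 𝟙 _) ≫ G.R.map (G.L.map (𝟙 (f.H.obj a)))
      simp)
    (fun b => by
      change 𝟙 (f.H.obj (F.R.obj b)) ≫ f.H.map (𝟙 (F.R.obj b)) ≫ 𝟙 (f.H.obj (F.R.obj b)) =
        ((f.isoR b).hom ≫ 𝟙 _) ≫ (f.isoR b).inv
      simp)

/-- The unit of `EC ∘ AC`, given by the comparison functors to the categories of coalgebras. -/
def unitEC : Pseudofunctor.StrongTrans (Pseudofunctor.id Adj.{v, max u v})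
    (AC.comp EC.{v, u}) where
  app := compareEC
  naturality f := compareECNat f
  naturality_naturality {F G f g} x := Adj.hom₂_ext
    (fun a => by
      refine Comonad.Coalgebra.Hom.ext' _ _ _ _ ?_
      change G.L.map (x.natH.app a) ≫ (g.isoL a).inv = (f.isoL a).inv ≫ x.natK.app (F.L.obj a)
      rw [← cancel_epi (f.isoL a).hom]
      have h := x.commL a
      rw [← reassoc_of% h]
      simp)
    (fun b => (Category.comp_id _).trans (Category.id_comp _).symm)
  naturality_id F := Adj.hom₂_ext
    (fun a => by
      refine Comonad.Coalgebra.Hom.ext' _ _ _ _ ?_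
      change 𝟙 (F.L.obj a) ≫ 𝟙 (F.L.obj a) ≫ 𝟙 (F.L.obj a) =
        F.L.map (𝟙 a) ≫ 𝟙 (F.L.obj a) ≫ 𝟙 (F.L.obj a)
      simp only [Category.comp_id]
      exact (F.L.map_id a).symm)
    (fun b => by
      change 𝟙 b ≫ 𝟙 b ≫ 𝟙 b = 𝟙 b ≫ 𝟙 b ≫ 𝟙 b
      rfl)
  naturality_comp {F G E} f g := Adj.hom₂_ext
    (fun a => by
      refine Comonad.Coalgebra.Hom.ext' _ _ _ _ ?_
      change (g.K.mapIso (f.isoL a) ≪≫ g.isoL (f.H.obj a)).inv ≫ 𝟙 _ ≫ 𝟙 _ =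
        E.L.map (𝟙 _) ≫ 𝟙 _ ≫ (g.isoL (f.H.obj a)).inv ≫ 𝟙 _ ≫ g.K.map (f.isoL a).inv ≫ 𝟙 _
      simp)
    (fun b => by
      change 𝟙 (g.K.obj (f.K.obj b)) ≫ 𝟙 _ ≫ 𝟙 _ =
        𝟙 _ ≫ 𝟙 _ ≫ 𝟙 _ ≫ 𝟙 _ ≫ g.K.map (𝟙 (f.K.obj b)) ≫ 𝟙 _
      simp)

/-- The unit of `EM ∘ AM`, given by the comparison functors to the categories of algebras. -/
def unitEM : Pseudofunctor.StrongTrans (Pseudofunctor.id Adj.{v, max u v})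
    (AM.comp EM.{v, u}) where
  app := compareEM
  naturality f := compareEMNat f
  naturality_naturality {F G f g} x := Adj.hom₂_ext
    (fun b => (Category.comp_id _).trans (Category.id_comp _).symm)
    (fun b => by
      refine Monad.Algebra.Hom.ext' _ _ _ _ ?_
      change G.R.map (x.natK.app b) ≫ (g.isoR b).inv = (f.isoR b).inv ≫ x.natH.app (F.R.obj b)
      rw [← cancel_epi (f.isoR b).hom]
      have h := x.commR b
      rw [← reassoc_of% h]
      simp)
  naturality_id F := Adj.hom₂_ext
    (fun a => by
      change 𝟙 a ≫ 𝟙 a ≫ 𝟙 a = 𝟙 a ≫ 𝟙 a ≫ 𝟙 a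
      rfl)
    (fun b => by
      refine Monad.Algebra.Hom.ext' _ _ _ _ ?_
      change 𝟙 (F.R.obj b) ≫ 𝟙 (F.R.obj b) ≫ 𝟙 (F.R.obj b) =
        F.R.map (𝟙 b) ≫ 𝟙 (F.R.obj b) ≫ 𝟙 (F.R.obj b)
      simp only [Category.comp_id]
      exact (F.R.map_id b).symm)
  naturality_comp {F G E} f g := Adj.hom₂_ext
    (fun a => by
      change 𝟙 (g.H.obj (f.H.obj a)) ≫ 𝟙 _ ≫ 𝟙 _ =
        𝟙 _ ≫ 𝟙 _ ≫ 𝟙 _ ≫ 𝟙 _ ≫ g.H.map (𝟙 (f.H.obj a)) ≫ 𝟙 _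
      simp)
    (fun b => by
      refine Monad.Algebra.Hom.ext' _ _ _ _ ?_
      change (g.H.mapIso (f.isoR b) ≪≫ g.isoR (f.K.obj b)).inv ≫ 𝟙 _ ≫ 𝟙 _ =
        E.R.map (𝟙 _) ≫ 𝟙 _ ≫ (g.isoR (f.K.obj b)).inv ≫ 𝟙 _ ≫ g.H.map (f.isoR b).inv ≫ 𝟙 _
      simp)

/-- The canonical isomorphism from a monad to the monad induced by its adjunction with the
projective algebras. -/
def toAMKM (T : Mnd.{v, max u v}) : T ⟶ AM.obj (KM.{v, u}.obj T) :=
  Mnd.Hom.mk (T := T) (S := adjMonad (projObj (emObj T))) (𝟭 T.carrier)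
    (fun a => Iso.refl (T.monad.obj a))
    (fun f => (Category.comp_id (T.monad.map f)).trans (Category.id_comp (T.monad.map f)).symm)
    (fun a => by
      change T.monad.η.app a ≫ 𝟙 (T.monad.obj a) = T.monad.adj.unit.app a
      rw [Category.comp_id, alg_unit])
    (fun a => by
      change T.monad.μ.app a ≫ 𝟙 (T.monad.obj a) = 𝟙 (T.monad.obj (T.monad.obj a)) ≫
        T.monad.map (𝟙 (T.monad.obj a)) ≫ (T.monad.adj.counit.app (T.monad.free.obj a)).f
      rw [alg_counit, CategoryTheory.Functor.map_id, Category.comp_id]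
      exact ((Category.id_comp _).trans (Category.id_comp (T.monad.μ.app a))).symm)

/-- The canonical isomorphism from a comonad to the comonad induced by its adjunction with the
injective coalgebras. -/
def toACKC (S : Cmn.{v, max u v}) : S ⟶ AC.obj (KC.{v, u}.obj S) :=
  Cmn.Hom.mk (T := S) (S := adjComonad (injObj (ecObj S))) (𝟭 S.carrier)
    (fun a => Iso.refl (S.comonad.obj a))
    (fun f =>
      (Category.comp_id (S.comonad.map f)).trans (Category.id_comp (S.comonad.map f)).symm)
    (fun a => by
      change 𝟙 (S.comonad.obj a) ≫ S.comonad.adj.counit.app a = S.comonad.ε.app a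
      rw [coalg_counit]
      simp)
    (fun a => by
      change S.comonad.δ.app a ≫ 𝟙 (S.comonad.obj (S.comonad.obj a)) ≫
          S.comonad.map (𝟙 (S.comonad.obj a)) =
        𝟙 (S.comonad.obj a) ≫ (S.comonad.adj.unit.app (S.comonad.cofree.obj a)).f
      rw [coalg_unit, CategoryTheory.Functor.map_id, Category.comp_id]
      exact (Category.comp_id _).trans (Category.id_comp (S.comonad.δ.app a)).symm)

/-- The naturality of `toAMKM`. -/
def toAMKMNat {T S : Mnd.{v, max u v}} (f : T ⟶ S) :
    f ≫ toAMKM.{v, u} S ≅ toAMKM.{v, u} T ≫ AM.map (KM.{v, u}.map f) :=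
  Mnd.isoMk (f := f ≫ toAMKM.{v, u} S) (g := toAMKM.{v, u} T ≫ AM.map (KM.{v, u}.map f))
    (Iso.refl _) (fun a => by
      change 𝟙 (f.functor.obj (T.monad.obj a)) ≫ f.functor.map (𝟙 (T.monad.obj a)) ≫
          𝟙 (f.functor.obj (T.monad.obj a)) ≫ (f.iso a).hom =
        ((f.iso a).hom ≫ 𝟙 (S.monad.obj (f.functor.obj a))) ≫ S.monad.map (𝟙 (f.functor.obj a))
      simp)

/-- The naturality of `toACKC`. -/
def toACKCNat {T S : Cmn.{v, max u v}} (f : T ⟶ S) :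
    f ≫ toACKC.{v, u} S ≅ toACKC.{v, u} T ≫ AC.map (KC.{v, u}.map f) :=
  Cmn.isoMk (f := f ≫ toACKC.{v, u} S) (g := toACKC.{v, u} T ≫ AC.map (KC.{v, u}.map f))
    (Iso.refl _) (fun a => by
      change 𝟙 (f.functor.obj (T.comonad.obj a)) ≫ f.functor.map (𝟙 (T.comonad.obj a)) ≫
          𝟙 (f.functor.obj (T.comonad.obj a)) ≫ (f.iso a).hom =
        ((f.iso a).hom ≫ 𝟙 (S.comonad.obj (f.functor.obj a))) ≫
          S.comonad.map (𝟙 (f.functor.obj a))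
      simp)

/-- The unit of the Street monad on monads, at a monad `T`: the composite of `T ≅ AM (KM T)` and
of the image under `AM` of the unit of `EC ∘ AC` at `KM T`. -/
def unitMApp (T : Mnd.{v, max u v}) : T ⟶ streetM.{v, u}.obj T :=
  toAMKM.{v, u} T ≫ AM.map (unitEC.{v, u}.app (KM.{v, u}.obj T))

/-- The unit of the Street monad on comonads, at a comonad `S`: the composite of `S ≅ AC (KC S)`
and of the image under `AC` of the unit of `EM ∘ AM` at `KC S`. -/
def unitEApp (S : Cmn.{v, max u v}) : S ⟶ streetE.{v, u}.obj S :=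
  toACKC.{v, u} S ≫ AC.map (unitEM.{v, u}.app (KC.{v, u}.obj S))

/-- The naturality of the unit of the Street monad on monads. -/
def unitMNat {T S : Mnd.{v, max u v}} (f : T ⟶ S) :
    f ≫ unitMApp.{v, u} S ≅ unitMApp.{v, u} T ≫ streetM.{v, u}.map f :=
  (α_ _ _ _).symm ≪≫ whiskerRightIso (toAMKMNat f) _ ≪≫ α_ _ _ _ ≪≫
    whiskerLeftIso _ ((AM.mapComp _ _).symm ≪≫
      AM.map₂Iso (unitEC.{v, u}.naturality (KM.{v, u}.map f)) ≪≫ AM.mapComp _ _) ≪≫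
    (α_ _ _ _).symm

/-- The naturality of the unit of the Street monad on comonads. -/
def unitENat {T S : Cmn.{v, max u v}} (f : T ⟶ S) :
    f ≫ unitEApp.{v, u} S ≅ unitEApp.{v, u} T ≫ streetE.{v, u}.map f :=
  (α_ _ _ _).symm ≪≫ whiskerRightIso (toACKCNat f) _ ≪≫ α_ _ _ _ ≪≫
    whiskerLeftIso _ ((AC.mapComp _ _).symm ≪≫
      AC.map₂Iso (unitEM.{v, u}.naturality (KC.{v, u}.map f)) ≪≫ AC.mapComp _ _) ≪≫
    (α_ _ _ _).symm

/-- The morphism of the base category underlying a component of a 2-cell into `streetM.obj S`. -/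
def undM {T S : Mnd.{v, max u v}} {f g : T ⟶ streetM.{v, u}.obj S} (x : f ⟶ g) (a : T.carrier) :
    (f.functor.obj a).A.obj.A ⟶ (g.functor.obj a).A.obj.A :=
  (x.nat.app a).f.hom.f

theorem undM_ext {T S : Mnd.{v, max u v}} {f g : T ⟶ streetM.{v, u}.obj S} {x y : f ⟶ g}
    (h : ∀ a, undM x a = undM y a) : x = y :=
  Mnd.hom₂_ext fun a => Comonad.Coalgebra.Hom.ext' _ _ _ _ (ObjectProperty.hom_ext _
    (Monad.Algebra.Hom.ext' _ _ _ _ (h a)))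

theorem undM_comp {T S : Mnd.{v, max u v}} {f g h : T ⟶ streetM.{v, u}.obj S} (x : f ⟶ g)
    (y : g ⟶ h) (a : T.carrier) : undM (x ≫ y) a = undM x a ≫ undM y a := rfl

theorem undM_whiskerLeft {T S R : Mnd.{v, max u v}} (f : T ⟶ S) {g h : S ⟶ streetM.{v, u}.obj R}
    (x : g ⟶ h) (a : T.carrier) : undM (f ◁ x) a = undM x (f.functor.obj a) := rfl

theorem undM_whiskerRight {T S R : Mnd.{v, max u v}} {f g : T ⟶ streetM.{v, u}.obj S} (x : f ⟶ g)
    (h : S ⟶ R) (a : T.carrier) :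
    undM (x ▷ streetM.{v, u}.map h) a = h.functor.map (undM x a) := rfl

theorem undM_unitMApp {T S : Mnd.{v, max u v}} {f g : T ⟶ S} (x : f ⟶ g) (a : T.carrier) :
    undM (x ▷ unitMApp.{v, u} S) a = S.monad.map (x.nat.app a) := rfl

theorem undM_map₂ {Q T S : Mnd.{v, max u v}} {f g : T ⟶ S} (x : f ⟶ g)
    (h : Q ⟶ streetM.{v, u}.obj T) (a : Q.carrier) :
    undM (h ◁ streetM.{v, u}.map₂ x) a = x.nat.app (h.functor.obj a).A.obj.A := rfl

theorem undM_unitMNat {T S : Mnd.{v, max u v}} (f : T ⟶ S) (a : T.carrier) :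
    undM (unitMNat.{v, u} f).hom a = (f.iso a).inv := by
  change 𝟙 _ ≫ S.monad.map (𝟙 _) ≫ 𝟙 _ ≫ (𝟙 _ ≫ (f.iso a).inv ≫ 𝟙 _) ≫ 𝟙 _ = (f.iso a).inv
  simp

theorem undM_associator_hom {T S R Q : Mnd.{v, max u v}} (f : T ⟶ S) (g : S ⟶ R)
    (h : R ⟶ streetM.{v, u}.obj Q) (a : T.carrier) : undM (α_ f g h).hom a = 𝟙 _ := rfl

theorem undM_associator_inv {T S R Q : Mnd.{v, max u v}} (f : T ⟶ S) (g : S ⟶ R)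
    (h : R ⟶ streetM.{v, u}.obj Q) (a : T.carrier) : undM (α_ f g h).inv a = 𝟙 _ := rfl

theorem undM_leftUnitor {T S : Mnd.{v, max u v}} (f : T ⟶ streetM.{v, u}.obj S)
    (a : T.carrier) : undM (λ_ f).hom a = 𝟙 _ := rfl

theorem undM_rightUnitor {T S : Mnd.{v, max u v}} (f : T ⟶ streetM.{v, u}.obj S)
    (a : T.carrier) : undM (ρ_ f).inv a = 𝟙 _ := rfl

theorem undM_mapId (T : Mnd.{v, max u v}) (X : (streetM.{v, u}.obj T).carrier) :
    undM (streetM.{v, u}.mapId T).hom X = 𝟙 X.A.obj.A := by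
  change (𝟙 X.A.obj.A ≫ 𝟙 X.A.obj.A) ≫ 𝟙 X.A.obj.A ≫ 𝟙 X.A.obj.A ≫ 𝟙 X.A.obj.A = 𝟙 _
  simp

theorem undM_mapComp {T S R : Mnd.{v, max u v}} (f : T ⟶ S) (g : S ⟶ R)
    (X : (streetM.{v, u}.obj T).carrier) :
    undM (streetM.{v, u}.mapComp f g).hom X = 𝟙 (g.functor.obj (f.functor.obj X.A.obj.A)) := by
  change (𝟙 (g.functor.obj (f.functor.obj X.A.obj.A)) ≫ 𝟙 _) ≫ 𝟙 _ ≫ 𝟙 _ ≫ 𝟙 _ = 𝟙 _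
  simp

theorem unitM_naturality {T S : Mnd.{v, max u v}} {f g : T ⟶ S} (x : f ⟶ g) :
    x ▷ unitMApp.{v, u} S ≫ (unitMNat g).hom =
      (unitMNat f).hom ≫ unitMApp.{v, u} T ◁ streetM.{v, u}.map₂ x := undM_ext fun a => by
  rw [undM_comp, undM_comp, undM_unitMNat, undM_unitMNat, undM_unitMApp, undM_map₂]
  change S.monad.map (x.nat.app a) ≫ (g.iso a).inv = (f.iso a).inv ≫ x.nat.app (T.monad.obj a)
  rw [← cancel_epi (f.iso a).hom]
  have h := x.comm a
  rw [← reassoc_of% h]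
  simp

theorem unitM_naturality_id (T : Mnd.{v, max u v}) :
    (unitMNat.{v, u} (𝟙 T)).hom ≫ unitMApp.{v, u} T ◁ (streetM.{v, u}.mapId T).hom =
      𝟙 (𝟙 T) ▷ unitMApp.{v, u} T ≫ (λ_ (unitMApp.{v, u} T)).hom ≫
        (ρ_ (unitMApp.{v, u} T)).inv := undM_ext fun a => by
  rw [undM_comp, undM_comp, undM_comp, undM_unitMNat, undM_unitMApp, undM_whiskerLeft,
    undM_mapId, undM_leftUnitor, undM_rightUnitor]
  change 𝟙 (T.monad.obj a) ≫ 𝟙 (T.monad.obj a) =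
    T.monad.map (𝟙 a) ≫ 𝟙 (T.monad.obj a) ≫ 𝟙 (T.monad.obj a)
  simp

theorem unitM_naturality_comp {T S R : Mnd.{v, max u v}} (f : T ⟶ S) (g : S ⟶ R) :
    (unitMNat.{v, u} (f ≫ g)).hom ≫ unitMApp.{v, u} T ◁ (streetM.{v, u}.mapComp f g).hom =
      𝟙 (f ≫ g) ▷ unitMApp.{v, u} R ≫ (α_ f g (unitMApp.{v, u} R)).hom ≫
        f ◁ (unitMNat.{v, u} g).hom ≫ (α_ f (unitMApp.{v, u} S) (streetM.{v, u}.map g)).inv ≫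
          (unitMNat.{v, u} f).hom ▷ streetM.{v, u}.map g ≫
            (α_ (unitMApp.{v, u} T) (streetM.{v, u}.map f) (streetM.{v, u}.map g)).hom :=
  undM_ext fun a => by
  simp only [undM_comp]
  rw [undM_unitMNat, undM_unitMApp, undM_whiskerLeft, undM_mapComp, undM_associator_hom,
    undM_whiskerLeft, undM_unitMNat, undM_associator_inv, undM_whiskerRight, undM_unitMNat,
    undM_associator_hom]
  change (g.functor.mapIso (f.iso a) ≪≫ g.iso (f.functor.obj a)).inv ≫ 𝟙 _ =
    R.monad.map (𝟙 _) ≫ 𝟙 _ ≫ (g.iso (f.functor.obj a)).inv ≫ 𝟙 _ ≫ g.functor.map (f.iso a).inv ≫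
      𝟙 _
  simp

/-- The unit of the Street monad on monads. -/
def unitM : Pseudofunctor.StrongTrans (Pseudofunctor.id Mnd.{v, max u v}) streetM.{v, u} where
  app := unitMApp
  naturality f := unitMNat f
  naturality_naturality x := unitM_naturality x
  naturality_id T := unitM_naturality_id T
  naturality_comp f g := unitM_naturality_comp f g

/-- The morphism of the base category underlying a component of a 2-cell into `streetE.obj S`. -/
def undE {T S : Cmn.{v, max u v}} {f g : T ⟶ streetE.{v, u}.obj S} (x : f ⟶ g) (a : T.carrier) :
    (f.functor.obj a).A.obj.A ⟶ (g.functor.obj a).A.obj.A :=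
  (x.nat.app a).f.hom.f

theorem undE_ext {T S : Cmn.{v, max u v}} {f g : T ⟶ streetE.{v, u}.obj S} {x y : f ⟶ g}
    (h : ∀ a, undE x a = undE y a) : x = y :=
  Cmn.hom₂_ext fun a => Monad.Algebra.Hom.ext' _ _ _ _ (ObjectProperty.hom_ext _
    (Comonad.Coalgebra.Hom.ext' _ _ _ _ (h a)))

theorem undE_comp {T S : Cmn.{v, max u v}} {f g h : T ⟶ streetE.{v, u}.obj S} (x : f ⟶ g)
    (y : g ⟶ h) (a : T.carrier) : undE (x ≫ y) a = undE x a ≫ undE y a := rfl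

theorem undE_whiskerLeft {T S R : Cmn.{v, max u v}} (f : T ⟶ S) {g h : S ⟶ streetE.{v, u}.obj R}
    (x : g ⟶ h) (a : T.carrier) : undE (f ◁ x) a = undE x (f.functor.obj a) := rfl

theorem undE_whiskerRight {T S R : Cmn.{v, max u v}} {f g : T ⟶ streetE.{v, u}.obj S} (x : f ⟶ g)
    (h : S ⟶ R) (a : T.carrier) :
    undE (x ▷ streetE.{v, u}.map h) a = h.functor.map (undE x a) := rfl

theorem undE_unitEApp {T S : Cmn.{v, max u v}} {f g : T ⟶ S} (x : f ⟶ g) (a : T.carrier) :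
    undE (x ▷ unitEApp.{v, u} S) a = S.comonad.map (x.nat.app a) := rfl

theorem undE_map₂ {Q T S : Cmn.{v, max u v}} {f g : T ⟶ S} (x : f ⟶ g)
    (h : Q ⟶ streetE.{v, u}.obj T) (a : Q.carrier) :
    undE (h ◁ streetE.{v, u}.map₂ x) a = x.nat.app (h.functor.obj a).A.obj.A := rfl

theorem undE_unitENat {T S : Cmn.{v, max u v}} (f : T ⟶ S) (a : T.carrier) :
    undE (unitENat.{v, u} f).hom a = (f.iso a).inv := by
  change 𝟙 _ ≫ S.comonad.map (𝟙 _) ≫ 𝟙 _ ≫ (𝟙 _ ≫ (f.iso a).inv ≫ 𝟙 _) ≫ 𝟙 _ = (f.iso a).inv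
  simp

theorem undE_associator_hom {T S R Q : Cmn.{v, max u v}} (f : T ⟶ S) (g : S ⟶ R)
    (h : R ⟶ streetE.{v, u}.obj Q) (a : T.carrier) : undE (α_ f g h).hom a = 𝟙 _ := rfl

theorem undE_associator_inv {T S R Q : Cmn.{v, max u v}} (f : T ⟶ S) (g : S ⟶ R)
    (h : R ⟶ streetE.{v, u}.obj Q) (a : T.carrier) : undE (α_ f g h).inv a = 𝟙 _ := rfl

theorem undE_leftUnitor {T S : Cmn.{v, max u v}} (f : T ⟶ streetE.{v, u}.obj S)
    (a : T.carrier) : undE (λ_ f).hom a = 𝟙 _ := rfl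

theorem undE_rightUnitor {T S : Cmn.{v, max u v}} (f : T ⟶ streetE.{v, u}.obj S)
    (a : T.carrier) : undE (ρ_ f).inv a = 𝟙 _ := rfl

theorem undE_mapId (T : Cmn.{v, max u v}) (X : (streetE.{v, u}.obj T).carrier) :
    undE (streetE.{v, u}.mapId T).hom X = 𝟙 X.A.obj.A := by
  change (𝟙 X.A.obj.A ≫ 𝟙 X.A.obj.A) ≫ 𝟙 X.A.obj.A ≫ 𝟙 X.A.obj.A ≫ 𝟙 X.A.obj.A = 𝟙 _
  simp

theorem undE_mapComp {T S R : Cmn.{v, max u v}} (f : T ⟶ S) (g : S ⟶ R)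
    (X : (streetE.{v, u}.obj T).carrier) :
    undE (streetE.{v, u}.mapComp f g).hom X = 𝟙 (g.functor.obj (f.functor.obj X.A.obj.A)) := by
  change (𝟙 (g.functor.obj (f.functor.obj X.A.obj.A)) ≫ 𝟙 _) ≫ 𝟙 _ ≫ 𝟙 _ ≫ 𝟙 _ = 𝟙 _
  simp

theorem unitE_naturality {T S : Cmn.{v, max u v}} {f g : T ⟶ S} (x : f ⟶ g) :
    x ▷ unitEApp.{v, u} S ≫ (unitENat g).hom =
      (unitENat f).hom ≫ unitEApp.{v, u} T ◁ streetE.{v, u}.map₂ x := undE_ext fun a => by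
  rw [undE_comp, undE_comp, undE_unitENat, undE_unitENat, undE_unitEApp, undE_map₂]
  change S.comonad.map (x.nat.app a) ≫ (g.iso a).inv = (f.iso a).inv ≫ x.nat.app (T.comonad.obj a)
  rw [← cancel_epi (f.iso a).hom]
  have h := x.comm a
  rw [← reassoc_of% h]
  simp

theorem unitE_naturality_id (T : Cmn.{v, max u v}) :
    (unitENat.{v, u} (𝟙 T)).hom ≫ unitEApp.{v, u} T ◁ (streetE.{v, u}.mapId T).hom =
      𝟙 (𝟙 T) ▷ unitEApp.{v, u} T ≫ (λ_ (unitEApp.{v, u} T)).hom ≫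
        (ρ_ (unitEApp.{v, u} T)).inv := undE_ext fun a => by
  rw [undE_comp, undE_comp, undE_comp, undE_unitENat, undE_unitEApp, undE_whiskerLeft,
    undE_mapId, undE_leftUnitor, undE_rightUnitor]
  change 𝟙 (T.comonad.obj a) ≫ 𝟙 (T.comonad.obj a) =
    T.comonad.map (𝟙 a) ≫ 𝟙 (T.comonad.obj a) ≫ 𝟙 (T.comonad.obj a)
  simp

theorem unitE_naturality_comp {T S R : Cmn.{v, max u v}} (f : T ⟶ S) (g : S ⟶ R) :
    (unitENat.{v, u} (f ≫ g)).hom ≫ unitEApp.{v, u} T ◁ (streetE.{v, u}.mapComp f g).hom =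
      𝟙 (f ≫ g) ▷ unitEApp.{v, u} R ≫ (α_ f g (unitEApp.{v, u} R)).hom ≫
        f ◁ (unitENat.{v, u} g).hom ≫ (α_ f (unitEApp.{v, u} S) (streetE.{v, u}.map g)).inv ≫
          (unitENat.{v, u} f).hom ▷ streetE.{v, u}.map g ≫
            (α_ (unitEApp.{v, u} T) (streetE.{v, u}.map f) (streetE.{v, u}.map g)).hom :=
  undE_ext fun a => by
  simp only [undE_comp]
  rw [undE_unitENat, undE_unitEApp, undE_whiskerLeft, undE_mapComp, undE_associator_hom,
    undE_whiskerLeft, undE_unitENat, undE_associator_inv, undE_whiskerRight, undE_unitENat,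
    undE_associator_hom]
  change (g.functor.mapIso (f.iso a) ≪≫ g.iso (f.functor.obj a)).inv ≫ 𝟙 _ =
    R.comonad.map (𝟙 _) ≫ 𝟙 _ ≫ (g.iso (f.functor.obj a)).inv ≫ 𝟙 _ ≫ g.functor.map (f.iso a).inv ≫
      𝟙 _
  simp

/-- The unit of the Street monad on comonads. -/
def unitE : Pseudofunctor.StrongTrans (Pseudofunctor.id Cmn.{v, max u v}) streetE.{v, u} where
  app := unitEApp
  naturality f := unitENat f
  naturality_naturality x := unitE_naturality x
  naturality_id T := unitE_naturality_id T
  naturality_comp f g := unitE_naturality_comp f g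

section

universe w₁ w₂ v₁ v₂ u₁ u₂

variable {B : Type u₁} [Bicategory.{w₁, v₁} B] {C : Type u₂} [Bicategory.{w₂, v₂} C]

/-- A 1-cell of a bicategory is an equivalence if it has an inverse up to invertible 2-cells. -/
def IsEquiv {a b : B} (f : a ⟶ b) : Prop := ∃ e : a ≌ b, e.hom = f

/-- A pseudofunctor is a biequivalence if it is an equivalence on the categories of morphisms and
reaches every object up to equivalence. -/
structure IsBiequivalence (F : B ⥤ᵖ C) : Prop where
  isEquivalence (a b : B) : (F.mapFunctor a b).IsEquivalence
  essSurj (c : C) : ∃ b : B, Nonempty (F.obj b ≌ c)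

/-- The full sub-bicategory of the objects with a given property. -/
abbrev FullSub (P : B → Prop) : Type u₁ := InducedBicategory B (Subtype.val : {b // P b} → B)

/-- The restriction of a pseudofunctor to full sub-bicategories. -/
def restrict (F : B ⥤ᵖ C) {P : B → Prop} {Q : C → Prop} (h : ∀ b, P b → Q (F.obj b)) :
    FullSub P ⥤ᵖ FullSub Q where
  obj X := (⟨F.obj X.1, h X.1 X.2⟩ : {c // Q c})
  map f := InducedBicategory.mkHom (F.map f.hom)
  map₂ x := InducedBicategory.mkHom₂ (F.map₂ x.hom)
  mapId X := InducedBicategory.isoMk (F.mapId X.1)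
  mapComp f g := InducedBicategory.isoMk (F.mapComp f.hom g.hom)
  map₂_id f := InducedBicategory.hom₂_ext (F.map₂_id f.hom)
  map₂_comp x y := InducedBicategory.hom₂_ext (F.map₂_comp x.hom y.hom)
  map₂_whisker_left f _ _ x := InducedBicategory.hom₂_ext (F.map₂_whisker_left f.hom x.hom)
  map₂_whisker_right x f := InducedBicategory.hom₂_ext (F.map₂_whisker_right x.hom f.hom)
  map₂_associator f g h := InducedBicategory.hom₂_ext (F.map₂_associator f.hom g.hom h.hom)
  map₂_left_unitor f := InducedBicategory.hom₂_ext (F.map₂_left_unitor f.hom)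
  map₂_right_unitor f := InducedBicategory.hom₂_ext (F.map₂_right_unitor f.hom)

end

/-- An adjunction is nuclear if its right adjoint is monadic and its left adjoint is comonadic. -/
def IsNuclear (F : Adj.{v, u}) : Prop :=
  (Monad.comparison F.adj).IsEquivalence ∧ (Comonad.comparison F.adj).IsEquivalence

/-- A monad is fixed by the Street monad if the unit of the Street monad is an equivalence at it. -/
def IsFixedM (T : Mnd.{v, max u v}) : Prop := IsEquiv (unitM.{v, u}.app T)

/-- A comonad is fixed by the Street monad if the unit of the Street monad is an equivalence
at it. -/
def IsFixedE (S : Cmn.{v, max u v}) : Prop := IsEquiv (unitE.{v, u}.app S)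

/-- The 2-category of nuclear adjunctions. -/
abbrev Nuc : Type _ := FullSub IsNuclear.{v, max u v}

/-- The 2-category of algebras of the Street monad on monads. -/
abbrev AlgM : Type _ := FullSub IsFixedM.{v, u}

/-- The 2-category of algebras of the Street monad on comonads. -/
abbrev AlgE : Type _ := FullSub IsFixedE.{v, u}

end StreetNucleus

/-!
The proof rests on one fact: the monad induced by an adjunction `F = (L ⊣ R)` is fixed by the Street
monad if and only if `L` is comonadic (`isFixedM_adjMonad_iff`), and dually the comonad induced by
`F` is fixed if and only if `R` is monadic (`isFixedE_adjComonad_iff`).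

A morphism of monads, of comonads or of adjunctions is an equivalence if and only if its underlying
functors are, because quasi-inverses inherit the structure isomorphisms. So a monad `T` is fixed if
and only if the free functor from the base to the projective algebras is comonadic. Two observations
about the retracts of the objects `L a` turn this into the criterion.

* The comparison functor of `F` restricts to an equivalence between the retracts of the objects
  `L a` and the projective algebras of `R L`: the counit splits at such retracts, which makes the
  comparison fully faithful there, and it reaches every projective algebra because idempotents split
  (`isEquivalence_projMap_compareEM_K`).
* A coalgebra `b ⟶ L R b` exhibits `b` as a retract of `L (R b)`. Hence cutting the codomain of `L`
  down to these retracts does not change the coalgebras, nor the comonadicity of `L`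
  (`isComonadic_projObj_iff`).

The Street monad takes its values among the monads induced by the adjunctions of categories of
coalgebras, whose left adjoints are comonadic, so its values are fixed. Its value at the unit is an
equivalence because the comparison of an adjunction with coalgebras is the identity on the right
category. An adjunction is nuclear if and only if both comparisons are equivalences of adjunctions,
since each of them is the identity on one of the two categories. Finally, when the right adjoint of
`G` is monadic, morphisms of monads into the monad of `G` lift along `AM` up to isomorphism, and
2-cells between them lift uniquely (`exists_AM_map_iso`, `AM_map₂_surjective`,
`AM_map₂_injective`); and the adjunction of a fixed monad with its category of algebras is nuclear. The statements about comonads are dual.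
-/

namespace StreetNucleus

/-! ### Equivalences in the 2-categories of monads, comonads and adjunctions -/

section

universe w₁ w₂ v₁ v₂ u₁ u₂

variable {B : Type u₁} [Bicategory.{w₁, v₁} B] {C : Type u₂} [Bicategory.{w₂, v₂} C]

theorem IsEquiv.of_inverse {a b : B} {f : a ⟶ b} (g : b ⟶ a) (unit : 𝟙 a ≅ f ≫ g)
    (counit : g ≫ f ≅ 𝟙 b) : IsEquiv f :=
  ⟨Bicategory.Equivalence.mkOfAdjointifyCounit unit counit, rfl⟩

/-- A pseudofunctor carries equivalences to equivalences. -/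
theorem IsEquiv.map (F : B ⥤ᵖ C) {a b : B} {f : a ⟶ b} (h : IsEquiv f) : IsEquiv (F.map f) := by
  obtain ⟨e, rfl⟩ := h
  exact IsEquiv.of_inverse (F.map e.inv) ((F.mapId _).symm ≪≫ F.map₂Iso e.unit ≪≫ F.mapComp _ _)
    ((F.mapComp _ _).symm ≪≫ F.map₂Iso e.counit ≪≫ F.mapId _)

end

namespace Mnd

variable {T S : Mnd.{v, u}}

/-- The underlying natural isomorphism of an invertible 2-cell. -/
def natIso {f g : T ⟶ S} (e : f ≅ g) : f.functor ≅ g.functor where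
  hom := e.hom.nat
  inv := e.inv.nat
  hom_inv_id := congrArg Hom₂.nat e.hom_inv_id
  inv_hom_id := congrArg Hom₂.nat e.inv_hom_id

/-- A quasi-inverse `G` of the functor of a morphism of monads, as a morphism of monads. Its
structure isomorphism is the one that makes the counit of the equivalence a 2-cell. -/
noncomputable def inverse (f : T ⟶ S) [f.functor.Full] [f.functor.Faithful]
    (G : S.carrier ⥤ T.carrier) (ε' : G ⋙ f.functor ≅ 𝟭 _) : S ⟶ T :=
  Mnd.Hom.mk (T := S) (S := T) G
    (fun c => f.functor.preimageIso
      (ε'.app (S.monad.obj c) ≪≫ S.monad.mapIso (ε'.app c).symm ≪≫ (f.iso (G.obj c)).symm))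
    (fun {a b} h => f.functor.map_injective (by
      have h₁ := f.natural (G.map h)
      have h₂ : f.functor.map (G.map (S.monad.map h)) ≫ ε'.hom.app (S.monad.obj b) =
        ε'.hom.app (S.monad.obj a) ≫ S.monad.map h := ε'.hom.naturality (S.monad.map h)
      have h₃ : h ≫ ε'.inv.app b = ε'.inv.app a ≫ f.functor.map (G.map h) := ε'.inv.naturality h
      have h₄ : (f.iso (G.obj a)).inv ≫ f.functor.map (T.monad.map (G.map h)) =
          S.monad.map (f.functor.map (G.map h)) ≫ (f.iso (G.obj b)).inv := by
        rw [Iso.inv_comp_eq, ← Category.assoc, Iso.eq_comp_inv, h₁]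
      simp [reassoc_of% h₂, h₄]
      rw [← Functor.map_comp, h₃, Functor.map_comp]))
    (fun c => f.functor.map_injective (by
      have h₁ : f.functor.map (G.map (S.monad.η.app c)) ≫ ε'.hom.app (S.monad.obj c) =
        ε'.hom.app c ≫ S.monad.η.app c := ε'.hom.naturality (S.monad.η.app c)
      have h₂ := S.monad.η.naturality (ε'.inv.app c)
      simp only [Functor.id_map, Functor.id_obj, Functor.comp_obj] at h₂
      rw [← cancel_mono (f.iso (G.obj c)).hom, f.unit]
      simp [reassoc_of% h₁, ← h₂]))
    (fun c => f.functor.map_injective (by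
      have h₁ : f.functor.map (G.map (S.monad.μ.app c)) ≫ ε'.hom.app (S.monad.obj c) =
        ε'.hom.app (S.monad.obj (S.monad.obj c)) ≫ S.monad.μ.app c :=
        ε'.hom.naturality (S.monad.μ.app c)
      have h₂ := S.monad.μ.naturality (ε'.inv.app c)
      simp only [Functor.comp_map, Functor.id_obj, Functor.comp_obj] at h₂
      have h₃ := f.mul (G.obj c)
      have h₄ := f.natural (f.functor.preimage
        (ε'.hom.app (S.monad.obj c) ≫ S.monad.map (ε'.inv.app c) ≫ (f.iso (G.obj c)).inv))
      simp only [Functor.map_preimage, Functor.id_obj, Functor.comp_obj] at h₄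
      rw [← cancel_mono (f.iso (G.obj c)).hom]
      simp [reassoc_of% h₁, h₃, reassoc_of% h₄, h₂]))

/-- A morphism of monads is an equivalence if and only if its functor is one, because a quasi-inverse
of the functor inherits the structure isomorphism. -/
theorem isEquiv_iff (f : T ⟶ S) : IsEquiv f ↔ f.functor.IsEquivalence := by
  constructor
  · rintro ⟨e, rfl⟩
    exact (CategoryTheory.Equivalence.mk e.hom.functor e.inv.functor (natIso e.unit)
      (natIso e.counit)).isEquivalence_functor
  · intro _
    let G := f.functor.inv
    let ε' : G ⋙ f.functor ≅ 𝟭 _ := f.functor.asEquivalence.counitIso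
    refine IsEquiv.of_inverse (inverse f G ε')
      (isoMk (f := 𝟙 T) (g := f ≫ inverse f G ε')
        (NatIso.ofComponents
          (fun a => f.functor.preimageIso (ε'.app (f.functor.obj a)).symm) (fun {a b} h => ?_))
        (fun a => f.functor.map_injective ?_))
      (isoMk (f := inverse f G ε' ≫ f) (g := 𝟙 S) ε' (fun c => ?_))
    · refine f.functor.map_injective ?_
      have h₁ : f.functor.map h ≫ ε'.inv.app (f.functor.obj b) =
        ε'.inv.app (f.functor.obj a) ≫ f.functor.map (G.map (f.functor.map h)) :=
        ε'.inv.naturality (f.functor.map h)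
      change f.functor.map (h ≫ f.functor.preimage _) =
        f.functor.map (f.functor.preimage _ ≫ G.map (f.functor.map h))
      rw [Functor.map_comp, Functor.map_comp, Functor.map_preimage, Functor.map_preimage]
      exact h₁
    · have h₁ : f.functor.map (G.map (f.iso a).hom) ≫ ε'.hom.app (S.monad.obj (f.functor.obj a)) =
        ε'.hom.app (f.functor.obj (T.monad.obj a)) ≫ (f.iso a).hom := ε'.hom.naturality _
      have h₂ := f.natural (f.functor.preimage (ε'.inv.app (f.functor.obj a)))
      simp only [Functor.map_preimage] at h₂
      have h₃ : f.functor.map (T.monad.map (f.functor.preimage (ε'.inv.app (f.functor.obj a)))) =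
        (f.iso a).hom ≫ S.monad.map (ε'.inv.app (f.functor.obj a)) ≫
          (f.iso (G.obj (f.functor.obj a))).inv := by
        rw [← Category.assoc, Iso.eq_comp_inv]
        exact h₂
      simp [inverse, h₃, reassoc_of% h₁]
    · simp [inverse]

end Mnd

namespace Cmn

variable {T S : Cmn.{v, u}}

/-- The underlying natural isomorphism of an invertible 2-cell. -/
def natIso {f g : T ⟶ S} (e : f ≅ g) : f.functor ≅ g.functor where
  hom := e.hom.nat
  inv := e.inv.nat
  hom_inv_id := congrArg Hom₂.nat e.hom_inv_id
  inv_hom_id := congrArg Hom₂.nat e.inv_hom_id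

/-- A quasi-inverse `G` of the functor of a morphism of comonads, as a morphism of comonads. Its
structure isomorphism is the one that makes the counit of the equivalence a 2-cell. -/
noncomputable def inverse (f : T ⟶ S) [f.functor.Full] [f.functor.Faithful]
    (G : S.carrier ⥤ T.carrier) (ε' : G ⋙ f.functor ≅ 𝟭 _) : S ⟶ T :=
  Cmn.Hom.mk (T := S) (S := T) G
    (fun c => f.functor.preimageIso
      (ε'.app (S.comonad.obj c) ≪≫ S.comonad.mapIso (ε'.app c).symm ≪≫ (f.iso (G.obj c)).symm))
    (fun {a b} h => f.functor.map_injective (by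
      have h₁ := f.natural (G.map h)
      have h₂ : f.functor.map (G.map (S.comonad.map h)) ≫ ε'.hom.app (S.comonad.obj b) =
        ε'.hom.app (S.comonad.obj a) ≫ S.comonad.map h := ε'.hom.naturality (S.comonad.map h)
      have h₃ : h ≫ ε'.inv.app b = ε'.inv.app a ≫ f.functor.map (G.map h) := ε'.inv.naturality h
      have h₄ : (f.iso (G.obj a)).inv ≫ f.functor.map (T.comonad.map (G.map h)) =
          S.comonad.map (f.functor.map (G.map h)) ≫ (f.iso (G.obj b)).inv := by
        rw [Iso.inv_comp_eq, ← Category.assoc, Iso.eq_comp_inv, h₁]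
      simp [reassoc_of% h₂, h₄]
      rw [← Functor.map_comp, h₃, Functor.map_comp]))
    (fun c => f.functor.map_injective (by
      have h₁ : f.functor.map (G.map (S.comonad.ε.app c)) ≫ ε'.hom.app c =
        ε'.hom.app (S.comonad.obj c) ≫ S.comonad.ε.app c := ε'.hom.naturality (S.comonad.ε.app c)
      have h₂ := S.comonad.ε.naturality (ε'.inv.app c)
      simp only [Functor.id_map, Functor.id_obj, Functor.comp_obj] at h₂
      rw [← cancel_mono (ε'.hom.app c)]
      simp [h₁, ← f.counit, h₂]))
    (fun c => f.functor.map_injective (by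
      have h₁ : f.functor.map (G.map (S.comonad.δ.app c)) ≫
          ε'.hom.app (S.comonad.obj (S.comonad.obj c)) =
        ε'.hom.app (S.comonad.obj c) ≫ S.comonad.δ.app c :=
        ε'.hom.naturality (S.comonad.δ.app c)
      have h₂ := S.comonad.δ.naturality (ε'.inv.app c)
      simp only [Functor.comp_map, Functor.id_obj, Functor.comp_obj] at h₂
      have h₃ := f.comul (G.obj c)
      have h₄ := f.natural (f.functor.preimage
        (ε'.hom.app (S.comonad.obj c) ≫ S.comonad.map (ε'.inv.app c) ≫ (f.iso (G.obj c)).inv))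
      simp only [Functor.map_preimage, Functor.id_obj, Functor.comp_obj] at h₄
      rw [← cancel_mono (f.iso (T.comonad.obj (G.obj c))).hom,
        ← cancel_mono (S.comonad.map (f.iso (G.obj c)).hom)]
      simp [reassoc_of% h₁, h₃, reassoc_of% h₄, h₂]))

/-- A morphism of comonads is an equivalence if and only if its functor is one, because a
quasi-inverse of the functor inherits the structure isomorphism. -/
theorem isEquiv_iff (f : T ⟶ S) : IsEquiv f ↔ f.functor.IsEquivalence := by
  constructor
  · rintro ⟨e, rfl⟩
    exact (CategoryTheory.Equivalence.mk e.hom.functor e.inv.functor (natIso e.unit)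
      (natIso e.counit)).isEquivalence_functor
  · intro _
    let G := f.functor.inv
    let ε' : G ⋙ f.functor ≅ 𝟭 _ := f.functor.asEquivalence.counitIso
    refine IsEquiv.of_inverse (inverse f G ε')
      (isoMk (f := 𝟙 T) (g := f ≫ inverse f G ε')
        (NatIso.ofComponents
          (fun a => f.functor.preimageIso (ε'.app (f.functor.obj a)).symm) (fun {a b} h => ?_))
        (fun a => f.functor.map_injective ?_))
      (isoMk (f := inverse f G ε' ≫ f) (g := 𝟙 S) ε' (fun c => ?_))
    · refine f.functor.map_injective ?_
      have h₁ : f.functor.map h ≫ ε'.inv.app (f.functor.obj b) =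
        ε'.inv.app (f.functor.obj a) ≫ f.functor.map (G.map (f.functor.map h)) :=
        ε'.inv.naturality (f.functor.map h)
      change f.functor.map (h ≫ f.functor.preimage _) =
        f.functor.map (f.functor.preimage _ ≫ G.map (f.functor.map h))
      rw [Functor.map_comp, Functor.map_comp, Functor.map_preimage, Functor.map_preimage]
      exact h₁
    · have h₁ : f.functor.map (G.map (f.iso a).hom) ≫ ε'.hom.app (S.comonad.obj (f.functor.obj a)) =
        ε'.hom.app (f.functor.obj (T.comonad.obj a)) ≫ (f.iso a).hom := ε'.hom.naturality _
      have h₂ := f.natural (f.functor.preimage (ε'.inv.app (f.functor.obj a)))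
      simp only [Functor.map_preimage] at h₂
      have h₃ : f.functor.map (T.comonad.map (f.functor.preimage (ε'.inv.app (f.functor.obj a)))) =
        (f.iso a).hom ≫ S.comonad.map (ε'.inv.app (f.functor.obj a)) ≫
          (f.iso (G.obj (f.functor.obj a))).inv := by
        rw [← Category.assoc, Iso.eq_comp_inv]
        exact h₂
      simp [inverse, h₃, reassoc_of% h₁]
    · simp [inverse]

end Cmn

namespace Adj

variable {F E : Adj.{v, u}}

/-- The natural isomorphism of left components underlying an invertible 2-cell. -/
def natIsoH {f g : F ⟶ E} (e : f ≅ g) : f.H ≅ g.H where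
  hom := e.hom.natH
  inv := e.inv.natH
  hom_inv_id := congrArg Hom₂.natH e.hom_inv_id
  inv_hom_id := congrArg Hom₂.natH e.inv_hom_id

/-- The natural isomorphism of right components underlying an invertible 2-cell. -/
def natIsoK {f g : F ⟶ E} (e : f ≅ g) : f.K ≅ g.K where
  hom := e.hom.natK
  inv := e.inv.natK
  hom_inv_id := congrArg Hom₂.natK e.hom_inv_id
  inv_hom_id := congrArg Hom₂.natK e.inv_hom_id

/-- Quasi-inverses of the functors of a morphism of adjunctions, as a morphism of adjunctions. Its
structure isomorphisms are the ones that make the counits of the equivalences a 2-cell. -/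
noncomputable def inverse (f : F ⟶ E) [f.H.Full] [f.H.Faithful] [f.K.Full] [f.K.Faithful]
    (H' : E.A ⥤ F.A) (K' : E.B ⥤ F.B) (ε₁ : H' ⋙ f.H ≅ 𝟭 _) (ε₂ : K' ⋙ f.K ≅ 𝟭 _) : E ⟶ F :=
  Adj.Hom.mk (F := E) (G := F) H' K'
    (fun c => f.K.preimageIso
      (ε₂.app (E.L.obj c) ≪≫ E.L.mapIso (ε₁.app c).symm ≪≫ (f.isoL (H'.obj c)).symm))
    (fun d => f.H.preimageIso
      (ε₁.app (E.R.obj d) ≪≫ E.R.mapIso (ε₂.app d).symm ≪≫ (f.isoR (K'.obj d)).symm))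
    (fun {a b} h => f.K.map_injective (by
      have h₁ := f.naturalL (H'.map h)
      have h₂ : f.K.map (K'.map (E.L.map h)) ≫ ε₂.hom.app (E.L.obj b) =
        ε₂.hom.app (E.L.obj a) ≫ E.L.map h := ε₂.hom.naturality (E.L.map h)
      have h₃ : h ≫ ε₁.inv.app b = ε₁.inv.app a ≫ f.H.map (H'.map h) := ε₁.inv.naturality h
      have h₄ : (f.isoL (H'.obj a)).inv ≫ f.K.map (F.L.map (H'.map h)) =
          E.L.map (f.H.map (H'.map h)) ≫ (f.isoL (H'.obj b)).inv := by
        rw [Iso.inv_comp_eq, ← Category.assoc, Iso.eq_comp_inv, h₁]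
      simp [reassoc_of% h₂, h₄]
      rw [← Functor.map_comp, h₃, Functor.map_comp]))
    (fun {a b} h => f.H.map_injective (by
      have h₁ := f.naturalR (K'.map h)
      have h₂ : f.H.map (H'.map (E.R.map h)) ≫ ε₁.hom.app (E.R.obj b) =
        ε₁.hom.app (E.R.obj a) ≫ E.R.map h := ε₁.hom.naturality (E.R.map h)
      have h₃ : h ≫ ε₂.inv.app b = ε₂.inv.app a ≫ f.K.map (K'.map h) := ε₂.inv.naturality h
      have h₄ : (f.isoR (K'.obj a)).inv ≫ f.H.map (F.R.map (K'.map h)) =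
          E.R.map (f.K.map (K'.map h)) ≫ (f.isoR (K'.obj b)).inv := by
        rw [Iso.inv_comp_eq, ← Category.assoc, Iso.eq_comp_inv, h₁]
      simp [reassoc_of% h₂, h₄]
      rw [← Functor.map_comp, h₃, Functor.map_comp]))
    (fun c => f.H.map_injective (by
      have h₁ : f.H.map (H'.map (E.adj.unit.app c)) ≫ ε₁.hom.app (E.R.obj (E.L.obj c)) =
        ε₁.hom.app c ≫ E.adj.unit.app c := ε₁.hom.naturality (E.adj.unit.app c)
      have h₂ := E.adj.unit.naturality (ε₁.inv.app c)
      have h₃ := f.unit (H'.obj c)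
      have h₄ := f.naturalR (f.K.preimage
        (ε₂.hom.app (E.L.obj c) ≫ E.L.map (ε₁.inv.app c) ≫ (f.isoL (H'.obj c)).inv))
      simp only [Functor.map_preimage, Functor.id_obj, Functor.comp_obj, Functor.id_map,
        Functor.comp_map] at h₂ h₄
      rw [← cancel_mono ((f.isoR (F.L.obj (H'.obj c))).hom ≫ E.R.map (f.isoL (H'.obj c)).hom), h₃]
      simp [reassoc_of% h₁, reassoc_of% h₄, ← h₂]))
    (fun d => f.K.map_injective (by
      have h₁ : f.K.map (K'.map (E.adj.counit.app d)) ≫ ε₂.hom.app d =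
        ε₂.hom.app (E.L.obj (E.R.obj d)) ≫ E.adj.counit.app d :=
        ε₂.hom.naturality (E.adj.counit.app d)
      have h₂ := E.adj.counit.naturality (ε₂.inv.app d)
      have h₃ := f.counit (K'.obj d)
      have h₄ := f.naturalL (f.H.preimage
        (ε₁.hom.app (E.R.obj d) ≫ E.R.map (ε₂.inv.app d) ≫ (f.isoR (K'.obj d)).inv))
      simp only [Functor.map_preimage, Functor.id_obj, Functor.comp_obj, Functor.id_map,
        Functor.comp_map] at h₂ h₄
      rw [← cancel_mono (ε₂.hom.app d)]
      simp [h₁, ← h₃, reassoc_of% h₄, h₂]))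

/-- A morphism of adjunctions is an equivalence if and only if both of its functors are. -/
theorem isEquiv_iff (f : F ⟶ E) : IsEquiv f ↔ f.H.IsEquivalence ∧ f.K.IsEquivalence := by
  constructor
  · rintro ⟨e, rfl⟩
    exact ⟨(CategoryTheory.Equivalence.mk e.hom.H e.inv.H (natIsoH e.unit)
      (natIsoH e.counit)).isEquivalence_functor,
      (CategoryTheory.Equivalence.mk e.hom.K e.inv.K (natIsoK e.unit)
      (natIsoK e.counit)).isEquivalence_functor⟩
  · rintro ⟨_, _⟩
    let H' := f.H.inv
    let K' := f.K.inv
    let ε₁ : H' ⋙ f.H ≅ 𝟭 _ := f.H.asEquivalence.counitIso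
    let ε₂ : K' ⋙ f.K ≅ 𝟭 _ := f.K.asEquivalence.counitIso
    refine IsEquiv.of_inverse (inverse f H' K' ε₁ ε₂)
      (isoMk (f := 𝟙 F) (g := f ≫ inverse f H' K' ε₁ ε₂)
        (NatIso.ofComponents
          (fun a => f.H.preimageIso (ε₁.app (f.H.obj a)).symm) (fun {a b} h => ?_))
        (NatIso.ofComponents
          (fun a => f.K.preimageIso (ε₂.app (f.K.obj a)).symm) (fun {a b} h => ?_))
        (fun a => f.K.map_injective ?_) (fun b => f.H.map_injective ?_))
      (isoMk (f := inverse f H' K' ε₁ ε₂ ≫ f) (g := 𝟙 E) ε₁ ε₂ (fun c => ?_) (fun d => ?_))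
    · refine f.H.map_injective ?_
      have h₁ : f.H.map h ≫ ε₁.inv.app (f.H.obj b) =
        ε₁.inv.app (f.H.obj a) ≫ f.H.map (H'.map (f.H.map h)) :=
        ε₁.inv.naturality (f.H.map h)
      change f.H.map (h ≫ f.H.preimage _) = f.H.map (f.H.preimage _ ≫ H'.map (f.H.map h))
      rw [Functor.map_comp, Functor.map_comp, Functor.map_preimage, Functor.map_preimage]
      exact h₁
    · refine f.K.map_injective ?_
      have h₁ : f.K.map h ≫ ε₂.inv.app (f.K.obj b) =
        ε₂.inv.app (f.K.obj a) ≫ f.K.map (K'.map (f.K.map h)) :=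
        ε₂.inv.naturality (f.K.map h)
      change f.K.map (h ≫ f.K.preimage _) = f.K.map (f.K.preimage _ ≫ K'.map (f.K.map h))
      rw [Functor.map_comp, Functor.map_comp, Functor.map_preimage, Functor.map_preimage]
      exact h₁
    · have h₁ : f.K.map (K'.map (f.isoL a).hom) ≫ ε₂.hom.app (E.L.obj (f.H.obj a)) =
        ε₂.hom.app (f.K.obj (F.L.obj a)) ≫ (f.isoL a).hom := ε₂.hom.naturality _
      have h₂ := f.naturalL (f.H.preimage (ε₁.inv.app (f.H.obj a)))
      simp only [Functor.map_preimage] at h₂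
      have h₃ : f.K.map (F.L.map (f.H.preimage (ε₁.inv.app (f.H.obj a)))) =
        (f.isoL a).hom ≫ E.L.map (ε₁.inv.app (f.H.obj a)) ≫
          (f.isoL (H'.obj (f.H.obj a))).inv := by
        rw [← Category.assoc, Iso.eq_comp_inv]
        exact h₂
      simp [inverse, h₃, reassoc_of% h₁]
    · have h₁ : f.H.map (H'.map (f.isoR b).hom) ≫ ε₁.hom.app (E.R.obj (f.K.obj b)) =
        ε₁.hom.app (f.H.obj (F.R.obj b)) ≫ (f.isoR b).hom := ε₁.hom.naturality _
      have h₂ := f.naturalR (f.K.preimage (ε₂.inv.app (f.K.obj b)))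
      simp only [Functor.map_preimage] at h₂
      have h₃ : f.H.map (F.R.map (f.K.preimage (ε₂.inv.app (f.K.obj b)))) =
        (f.isoR b).hom ≫ E.R.map (ε₂.inv.app (f.K.obj b)) ≫
          (f.isoR (K'.obj (f.K.obj b))).inv := by
        rw [← Category.assoc, Iso.eq_comp_inv]
        exact h₂
      simp [inverse, h₃, reassoc_of% h₁]
    · simp [inverse]
    · simp [inverse]

end Adj

/-! ### Comonadic left adjoints and monadic right adjoints -/

/-- The left adjoint of an adjunction is comonadic. -/
abbrev IsComonadic (F : Adj.{v, u}) : Prop := (Comonad.comparison F.adj).IsEquivalence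

/-- The right adjoint of an adjunction is monadic. -/
abbrev IsMonadic (F : Adj.{v, u}) : Prop := (Monad.comparison F.adj).IsEquivalence

/-- The left adjoints of two adjunctions `F` and `G` are comonadic together if there is a morphism
from `F` to `G` that is an equivalence on the left categories and on the coalgebras. -/
theorem isComonadic_iff_of_coalgMap {F G : Adj.{v, max u v}} (f : F ⟶ G)
    (h₁ : f.H.IsEquivalence) (h₂ : (coalgMap (adjComonadMap f)).IsEquivalence) :
    IsComonadic F ↔ IsComonadic G := by
  have e : f.H ⋙ Comonad.comparison G.adj ≅
    Comonad.comparison F.adj ⋙ coalgMap (adjComonadMap f) :=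
    Adj.natIsoH (compareECNat.{v, u} f)
  constructor
  · intro _
    have := Functor.isEquivalence_of_iso e.symm
    exact Functor.isEquivalence_of_comp_left f.H _
  · intro _
    have := Functor.isEquivalence_of_iso e
    exact Functor.isEquivalence_of_comp_right _ (coalgMap (adjComonadMap f))

/-- The right adjoints of two adjunctions `F` and `G` are monadic together if there is a morphism
from `F` to `G` that is an equivalence on the right categories and on the algebras. -/
theorem isMonadic_iff_of_algMap {F G : Adj.{v, max u v}} (f : F ⟶ G)
    (h₁ : f.K.IsEquivalence) (h₂ : (algMap (adjMonadMap f)).IsEquivalence) :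
    IsMonadic F ↔ IsMonadic G := by
  have e : f.K ⋙ Monad.comparison G.adj ≅
    Monad.comparison F.adj ⋙ algMap (adjMonadMap f) :=
    Adj.natIsoK (compareEMNat.{v, u} f)
  constructor
  · intro _
    have := Functor.isEquivalence_of_iso e.symm
    exact Functor.isEquivalence_of_comp_left f.K _
  · intro _
    have := Functor.isEquivalence_of_iso e
    exact Functor.isEquivalence_of_comp_right _ (algMap (adjMonadMap f))

theorem isEquivalence_algMap {T S : Mnd.{v, max u v}} (f : T ⟶ S)
    (h : f.functor.IsEquivalence) : (algMap f).IsEquivalence :=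
  ((Adj.isEquiv_iff _).1 (((Mnd.isEquiv_iff f).2 h).map EM.{v, u})).2

theorem isEquivalence_coalgMap {T S : Cmn.{v, max u v}} (f : T ⟶ S)
    (h : f.functor.IsEquivalence) : (coalgMap f).IsEquivalence :=
  ((Adj.isEquiv_iff _).1 (((Cmn.isEquiv_iff f).2 h).map EC.{v, u})).1

theorem isComonadic_iff_of_isEquivalence {F G : Adj.{v, max u v}} (f : F ⟶ G)
    (h₁ : f.H.IsEquivalence) (h₂ : f.K.IsEquivalence) : IsComonadic F ↔ IsComonadic G :=
  isComonadic_iff_of_coalgMap.{v, u} f h₁ (isEquivalence_coalgMap.{v, u} (adjComonadMap f) h₂)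

theorem isMonadic_iff_of_isEquivalence {F G : Adj.{v, max u v}} (f : F ⟶ G)
    (h₁ : f.H.IsEquivalence) (h₂ : f.K.IsEquivalence) : IsMonadic F ↔ IsMonadic G :=
  isMonadic_iff_of_algMap.{v, u} f h₂ (isEquivalence_algMap.{v, u} (adjMonadMap f) h₁)

theorem isMonadic_emObj (T : Mnd.{v, max u v}) : IsMonadic (emObj.{v, u} T) where

theorem isComonadic_ecObj (S : Cmn.{v, max u v}) : IsComonadic (ecObj.{v, u} S) where

/-! ### Restriction to retracts of free and cofree objects -/

/-- The inclusion of the restriction of an adjunction `L ⊣ R` to the retracts of the `L a`. -/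
def projIncl (F : Adj.{v, u}) : projObj F ⟶ F :=
  Adj.Hom.mk (F := projObj F) (G := F) (𝟭 F.A) (isProj F).ι
    (fun a => Iso.refl (F.L.obj a))
    (fun b => Iso.refl (F.R.obj b.obj))
    (fun f => (Category.comp_id (F.L.map f)).trans (Category.id_comp (F.L.map f)).symm)
    (fun f => (Category.comp_id (F.R.map f.hom)).trans (Category.id_comp (F.R.map f.hom)).symm)
    (fun a => by
      change F.adj.unit.app a ≫ 𝟙 (F.R.obj (F.L.obj a)) ≫ F.R.map (𝟙 (F.L.obj a)) =
        F.adj.unit.app a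
      simp)
    (fun b => by
      change 𝟙 (F.L.obj (F.R.obj b.obj)) ≫ F.L.map (𝟙 (F.R.obj b.obj)) ≫
        F.adj.counit.app b.obj = F.adj.counit.app b.obj
      simp)

/-- The inclusion of the restriction of an adjunction `L ⊣ R` to the retracts of the `R b`. -/
def injIncl (F : Adj.{v, u}) : injObj F ⟶ F :=
  Adj.Hom.mk (F := injObj F) (G := F) (isInj F).ι (𝟭 F.B)
    (fun a => Iso.refl (F.L.obj a.obj))
    (fun b => Iso.refl (F.R.obj b))
    (fun f => (Category.comp_id (F.L.map f.hom)).trans (Category.id_comp (F.L.map f.hom)).symm)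
    (fun f => (Category.comp_id (F.R.map f)).trans (Category.id_comp (F.R.map f)).symm)
    (fun a => by
      change F.adj.unit.app a.obj ≫ 𝟙 (F.R.obj (F.L.obj a.obj)) ≫ F.R.map (𝟙 (F.L.obj a.obj)) =
        F.adj.unit.app a.obj
      simp)
    (fun b => by
      change 𝟙 (F.L.obj (F.R.obj b)) ≫ F.L.map (𝟙 (F.R.obj b)) ≫
        F.adj.counit.app b = F.adj.counit.app b
      simp)

/-- A coalgebra `b ⟶ L R b` of the comonad `L R` makes `b` a retract of `L (R b)`, so the
restriction to such retracts has the same coalgebras. -/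
theorem isEquivalence_coalgMap_projIncl (F : Adj.{v, u}) :
    (coalgMap (adjComonadMap (projIncl F))).IsEquivalence where
  faithful := ⟨fun {X Y f g} h => by
    refine Comonad.Coalgebra.Hom.ext' _ _ _ _ (ObjectProperty.hom_ext _ ?_)
    exact congrArg Comonad.Coalgebra.Hom.f h⟩
  full := ⟨fun {X Y} f => by
    let g : X.A.obj ⟶ Y.A.obj := f.f
    let x : X.A.obj ⟶ F.L.obj (F.R.obj X.A.obj) := X.a.hom
    let y : Y.A.obj ⟶ F.L.obj (F.R.obj Y.A.obj) := Y.a.hom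
    have h : (x ≫ 𝟙 _ ≫ F.L.map (𝟙 (F.R.obj X.A.obj))) ≫ F.L.map (F.R.map g) =
      g ≫ y ≫ 𝟙 _ ≫ F.L.map (𝟙 (F.R.obj Y.A.obj)) := f.h
    refine ⟨{ f := ObjectProperty.homMk g, h := ObjectProperty.hom_ext _ ?_ }, rfl⟩
    change x ≫ F.L.map (F.R.map g) = g ≫ y
    simpa only [CategoryTheory.Functor.map_id, Category.comp_id] using h⟩
  essSurj := ⟨fun X => by
    let b : (isProj F).FullSubcategory :=
      ⟨X.A, F.R.obj X.A, ⟨{ i := X.a, r := F.adj.counit.app X.A, retract := X.counit }⟩⟩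
    refine ⟨{ A := b, a := ObjectProperty.homMk X.a, counit := ?_, coassoc := ?_ },
      ⟨Comonad.Coalgebra.isoMk (Iso.refl X.A) ?_⟩⟩
    · ext; exact X.counit
    · ext; exact X.coassoc
    · let x : (show F.B from X.A) ⟶ F.L.obj (F.R.obj X.A) := X.a
      change (x ≫ 𝟙 _ ≫ F.L.map (𝟙 (F.R.obj X.A))) ≫ F.L.map (F.R.map (𝟙 _)) = 𝟙 _ ≫ x
      simp only [CategoryTheory.Functor.map_id, Category.comp_id, Category.id_comp]⟩

/-- An algebra `R L a ⟶ a` of the monad `R L` makes `a` a retract of `R (L a)`, so the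
restriction to such retracts has the same algebras. -/
theorem isEquivalence_algMap_injIncl (F : Adj.{v, u}) :
    (algMap (adjMonadMap (injIncl F))).IsEquivalence where
  faithful := ⟨fun {X Y f g} h => by
    refine Monad.Algebra.Hom.ext' _ _ _ _ (ObjectProperty.hom_ext _ ?_)
    exact congrArg Monad.Algebra.Hom.f h⟩
  full := ⟨fun {X Y} f => by
    let g : X.A.obj ⟶ Y.A.obj := f.f
    let x : F.R.obj (F.L.obj X.A.obj) ⟶ X.A.obj := X.a.hom
    let y : F.R.obj (F.L.obj Y.A.obj) ⟶ Y.A.obj := Y.a.hom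
    have h : F.R.map (F.L.map g) ≫ (F.R.map (𝟙 (F.L.obj Y.A.obj)) ≫ 𝟙 _) ≫ y =
      ((F.R.map (𝟙 (F.L.obj X.A.obj)) ≫ 𝟙 _) ≫ x) ≫ g := f.h
    refine ⟨{ f := ObjectProperty.homMk g, h := ObjectProperty.hom_ext _ ?_ }, rfl⟩
    change F.R.map (F.L.map g) ≫ y = x ≫ g
    simpa only [CategoryTheory.Functor.map_id, Category.comp_id, Category.id_comp] using h⟩
  essSurj := ⟨fun X => by
    let b : (isInj F).FullSubcategory :=
      ⟨X.A, F.L.obj X.A, ⟨{ i := F.adj.unit.app X.A, r := X.a, retract := X.unit }⟩⟩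
    refine ⟨{ A := b, a := ObjectProperty.homMk X.a, unit := ?_, assoc := ?_ },
      ⟨Monad.Algebra.isoMk (Iso.refl X.A) ?_⟩⟩
    · ext; exact X.unit
    · ext; exact X.assoc
    · let x : F.R.obj (F.L.obj X.A) ⟶ (show F.A from X.A) := X.a
      change F.R.map (F.L.map (𝟙 _)) ≫ x = ((F.R.map (𝟙 (F.L.obj X.A)) ≫ 𝟙 _) ≫ x) ≫ 𝟙 _
      simp only [CategoryTheory.Functor.map_id, Category.comp_id, Category.id_comp]⟩

theorem isComonadic_projObj_iff (F : Adj.{v, max u v}) :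
    IsComonadic (projObj F) ↔ IsComonadic F :=
  isComonadic_iff_of_coalgMap.{v, u} (projIncl F) (inferInstanceAs (𝟭 F.A).IsEquivalence)
    (isEquivalence_coalgMap_projIncl F)

theorem isMonadic_injObj_iff (F : Adj.{v, max u v}) :
    IsMonadic (injObj F) ↔ IsMonadic F :=
  isMonadic_iff_of_algMap.{v, u} (injIncl F) (inferInstanceAs (𝟭 F.B).IsEquivalence)
    (isEquivalence_algMap_injIncl F)

/-- The essential image of a fully faithful functor on an idempotent complete category is closed
under retracts. -/
theorem exists_iso_of_retract {C D : Type*} [Category* C] [Category* D] [IsIdempotentComplete C]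
    (F : C ⥤ D) [F.Full] [F.Faithful] {X : D} {c : C} (r : Retract X (F.obj c)) :
    ∃ Y : C, Nonempty (F.obj Y ≅ X) := by
  have hp : F.preimage (r.r ≫ r.i) ≫ F.preimage (r.r ≫ r.i) = F.preimage (r.r ≫ r.i) :=
    F.map_injective (by simp)
  obtain ⟨Y, i, e, h₁, h₂⟩ := IsIdempotentComplete.idempotents_split c _ hp
  have h₃ : F.map i ≫ F.map e = 𝟙 _ := by rw [← F.map_comp, h₁, F.map_id]
  have h₄ : F.map e ≫ F.map i = r.r ≫ r.i := by rw [← F.map_comp, h₂, F.map_preimage]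
  refine ⟨Y, ⟨⟨F.map i ≫ r.r, r.i ≫ F.map e, ?_, ?_⟩⟩⟩
  · rw [Category.assoc, ← reassoc_of% h₄, h₃, Category.comp_id, h₃]
  · rw [Category.assoc, reassoc_of% h₄, r.retract_assoc, r.retract]

/-- The counit of an adjunction `L ⊣ R` splits at the retracts of the objects `L a`. -/
theorem exists_section_counit {F : Adj.{v, u}} {b : F.B} (hb : isProj F b) :
    ∃ s : b ⟶ F.L.obj (F.R.obj b), s ≫ F.adj.counit.app b = 𝟙 b := by
  obtain ⟨a, ⟨r⟩⟩ := hb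
  exact ⟨r.i ≫ F.L.map (F.adj.unit.app a) ≫ F.L.map (F.R.map r.r), by simp⟩

/-- The unit of an adjunction `L ⊣ R` splits at the retracts of the objects `R b`. -/
theorem exists_retraction_unit {F : Adj.{v, u}} {a : F.A} (ha : isInj F a) :
    ∃ s : F.R.obj (F.L.obj a) ⟶ a, F.adj.unit.app a ≫ s = 𝟙 a := by
  obtain ⟨b, ⟨r⟩⟩ := ha
  exact ⟨F.R.map (F.L.map r.i) ≫ F.R.map (F.adj.counit.app b) ≫ r.r, by simp⟩

/-- The comparison functor of `L ⊣ R` restricts to an equivalence between the retracts of the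
objects `L a` and the projective algebras. It is fully faithful there because the counit splits,
and it reaches the retracts of free algebras because idempotents split. -/
theorem isEquivalence_projMap_compareEM_K (F : Adj.{v, max u v}) :
    (projMap (compareEM.{v, u} F)).K.IsEquivalence := by
  have h₁ : (projMap (compareEM.{v, u} F)).K.Faithful := ⟨fun {b b' f g} h => by
    obtain ⟨s, hs⟩ := exists_section_counit b.property
    have h' : F.R.map f.hom = F.R.map g.hom :=
      congrArg (fun k => Monad.Algebra.Hom.f (InducedCategory.Hom.hom k)) h
    ext
    rw [← Category.id_comp f.hom, ← Category.id_comp g.hom, ← hs, Category.assoc, Category.assoc]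
    have hf := F.adj.counit_naturality f.hom
    have hg := F.adj.counit_naturality g.hom
    rw [← hf, ← hg, h']⟩
  have h₂ : (projMap (compareEM.{v, u} F)).K.Full := ⟨fun {b b'} f => by
    obtain ⟨s, hs⟩ := exists_section_counit b.property
    let g : F.R.obj b.obj ⟶ F.R.obj b'.obj := f.hom.f
    have hg : F.R.map (F.L.map g) ≫ F.R.map (F.adj.counit.app b'.obj) =
      F.R.map (F.adj.counit.app b.obj) ≫ g := f.hom.h
    refine ⟨ObjectProperty.homMk (s ≫ F.L.map g ≫ F.adj.counit.app b'.obj), ?_⟩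
    refine ObjectProperty.hom_ext _ (Monad.Algebra.Hom.ext' _ _ _ _ ?_)
    change F.R.map (s ≫ F.L.map g ≫ F.adj.counit.app b'.obj) = g
    rw [Functor.map_comp, Functor.map_comp, hg, ← Functor.map_comp_assoc, hs]
    simp⟩
  have h₃ : (projMap (compareEM.{v, u} F)).K.EssSurj := ⟨fun X => by
    obtain ⟨a, ⟨r⟩⟩ := X.property
    let r' := r.trans (Retract.ofIso ((compareEM.{v, u} F).isoL a).symm)
    let r'' : Retract X ((projMap (compareEM.{v, u} F)).K.obj ((projObj F).L.obj a)) :=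
      { i := ObjectProperty.homMk r'.i
        r := ObjectProperty.homMk r'.r
        retract := ObjectProperty.hom_ext _ r'.retract }
    exact exists_iso_of_retract _ r''⟩
  exact { }

/-- The comparison functor of `L ⊣ R` restricts to an equivalence between the retracts of the
objects `R b` and the injective coalgebras. -/
theorem isEquivalence_injMap_compareEC_H (F : Adj.{v, max u v}) :
    (injMap (compareEC.{v, u} F)).H.IsEquivalence := by
  have h₁ : (injMap (compareEC.{v, u} F)).H.Faithful := ⟨fun {a a' f g} h => by
    obtain ⟨s, hs⟩ := exists_retraction_unit a'.property
    have h' : F.L.map f.hom = F.L.map g.hom :=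
      congrArg (fun k => Comonad.Coalgebra.Hom.f (InducedCategory.Hom.hom k)) h
    ext
    rw [← Category.comp_id f.hom, ← Category.comp_id g.hom, ← hs]
    have hf := F.adj.unit_naturality f.hom
    have hg := F.adj.unit_naturality g.hom
    rw [← reassoc_of% hf, ← reassoc_of% hg, h']⟩
  have h₂ : (injMap (compareEC.{v, u} F)).H.Full := ⟨fun {a a'} f => by
    obtain ⟨s, hs⟩ := exists_retraction_unit a'.property
    let g : F.L.obj a.obj ⟶ F.L.obj a'.obj := f.hom.f
    have hg : F.L.map (F.adj.unit.app a.obj) ≫ F.L.map (F.R.map g) =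
      g ≫ F.L.map (F.adj.unit.app a'.obj) := f.hom.h
    refine ⟨ObjectProperty.homMk (F.adj.unit.app a.obj ≫ F.R.map g ≫ s), ?_⟩
    refine ObjectProperty.hom_ext _ (Comonad.Coalgebra.Hom.ext' _ _ _ _ ?_)
    change F.L.map (F.adj.unit.app a.obj ≫ F.R.map g ≫ s) = g
    rw [Functor.map_comp, Functor.map_comp, reassoc_of% hg, ← Functor.map_comp, hs]
    simp⟩
  have h₃ : (injMap (compareEC.{v, u} F)).H.EssSurj := ⟨fun X => by
    obtain ⟨b, ⟨r⟩⟩ := X.property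
    let r' := r.trans (Retract.ofIso ((compareEC.{v, u} F).isoR b).symm)
    let r'' : Retract X ((injMap (compareEC.{v, u} F)).H.obj ((injObj F).R.obj b)) :=
      { i := ObjectProperty.homMk r'.i
        r := ObjectProperty.homMk r'.r
        retract := ObjectProperty.hom_ext _ r'.retract }
    exact exists_iso_of_retract _ r''⟩
  exact { }

/-! ### The monads and comonads fixed by the Street monads -/

theorem isFixedM_iff_isComonadic_projObj (T : Mnd.{v, max u v}) :
    IsFixedM.{v, u} T ↔ IsComonadic (projObj (emObj.{v, u} T)) := by
  refine (Mnd.isEquiv_iff _).trans ?_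
  change (𝟭 T.carrier ⋙ Comonad.comparison (projObj (emObj.{v, u} T)).adj).IsEquivalence ↔ _
  rw [Functor.id_comp]

theorem isFixedE_iff_isMonadic_injObj (S : Cmn.{v, max u v}) :
    IsFixedE.{v, u} S ↔ IsMonadic (injObj (ecObj.{v, u} S)) := by
  refine (Cmn.isEquiv_iff _).trans ?_
  change (𝟭 S.carrier ⋙ Monad.comparison (injObj (ecObj.{v, u} S)).adj).IsEquivalence ↔ _
  rw [Functor.id_comp]

/-- The comparison functor in the unit of the Street monad at `T` goes to the coalgebras over the
projective algebras, and these are the coalgebras over all algebras. -/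
theorem isFixedM_iff (T : Mnd.{v, max u v}) :
    IsFixedM.{v, u} T ↔ IsComonadic (emObj.{v, u} T) :=
  (isFixedM_iff_isComonadic_projObj T).trans (isComonadic_projObj_iff.{v, u} _)

/-- The comparison functor in the unit of the Street monad at `S` goes to the algebras over the
injective coalgebras, and these are the algebras over all coalgebras. -/
theorem isFixedE_iff (S : Cmn.{v, max u v}) :
    IsFixedE.{v, u} S ↔ IsMonadic (ecObj.{v, u} S) :=
  (isFixedE_iff_isMonadic_injObj S).trans (isMonadic_injObj_iff.{v, u} _)

/-- The monad induced by an adjunction is fixed by the Street monad if and only if the left adjoint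
is comonadic, since the projective algebras are the retracts of the objects `L a`. -/
theorem isFixedM_adjMonad_iff (F : Adj.{v, max u v}) :
    IsFixedM.{v, u} (adjMonad F) ↔ IsComonadic F :=
  (isFixedM_iff_isComonadic_projObj _).trans <|
    (isComonadic_iff_of_isEquivalence.{v, u} (projMap (compareEM.{v, u} F))
      (inferInstanceAs (𝟭 F.A).IsEquivalence) (isEquivalence_projMap_compareEM_K F)).symm.trans
    (isComonadic_projObj_iff.{v, u} F)

/-- The comonad induced by an adjunction is fixed by the Street monad if and only if the right
adjoint is monadic, since the injective coalgebras are the retracts of the objects `R b`. -/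
theorem isFixedE_adjComonad_iff (F : Adj.{v, max u v}) :
    IsFixedE.{v, u} (adjComonad F) ↔ IsMonadic F :=
  (isFixedE_iff_isMonadic_injObj _).trans <|
    (isMonadic_iff_of_isEquivalence.{v, u} (injMap (compareEC.{v, u} F))
      (isEquivalence_injMap_compareEC_H F) (inferInstanceAs (𝟭 F.B).IsEquivalence)).symm.trans
    (isMonadic_injObj_iff.{v, u} F)

theorem isEquiv_unitM_streetM (T : Mnd.{v, max u v}) :
    IsEquiv (unitM.{v, u}.app (streetM.{v, u}.obj T)) :=
  (isFixedM_adjMonad_iff.{v, u} _).2 (isComonadic_ecObj.{v, u} _)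

theorem isEquiv_unitE_streetE (S : Cmn.{v, max u v}) :
    IsEquiv (unitE.{v, u}.app (streetE.{v, u}.obj S)) :=
  (isFixedE_adjComonad_iff.{v, u} _).2 (isMonadic_emObj.{v, u} _)

/-! ### The Street monads carry their units to equivalences -/

theorem isProj_projObj (F : Adj.{v, u}) (b : (projObj F).B) : isProj (projObj F) b := by
  obtain ⟨a, ⟨r⟩⟩ := b.property
  exact ⟨a, ⟨{ i := ObjectProperty.homMk r.i
               r := ObjectProperty.homMk r.r
               retract := ObjectProperty.hom_ext _ r.retract }⟩⟩

theorem isInj_injObj (F : Adj.{v, u}) (a : (injObj F).A) : isInj (injObj F) a := by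
  obtain ⟨b, ⟨r⟩⟩ := a.property
  exact ⟨b, ⟨{ i := ObjectProperty.homMk r.i
               r := ObjectProperty.homMk r.r
               retract := ObjectProperty.hom_ext _ r.retract }⟩⟩

theorem isEquivalence_projMap_K {F G : Adj.{v, u}} (f : F ⟶ G) (hf : f.K.IsEquivalence)
    (hF : ∀ b, isProj F b) : (projMap f).K.IsEquivalence where
  faithful := ⟨fun {b b' _ _} h =>
    ObjectProperty.hom_ext _ (f.K.map_injective (congrArg
      (fun k : (projMap f).K.obj b ⟶ (projMap f).K.obj b' => InducedCategory.Hom.hom k) h))⟩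
  full := ⟨fun g => ⟨ObjectProperty.homMk (f.K.preimage g.hom),
    ObjectProperty.hom_ext _ (f.K.map_preimage g.hom)⟩⟩
  essSurj := ⟨fun b => ⟨⟨f.K.objPreimage b.obj, hF _⟩,
    ⟨(isProj G).isoMk (f.K.objObjPreimageIso b.obj)⟩⟩⟩

theorem isEquivalence_injMap_H {F G : Adj.{v, u}} (f : F ⟶ G) (hf : f.H.IsEquivalence)
    (hF : ∀ a, isInj F a) : (injMap f).H.IsEquivalence where
  faithful := ⟨fun {b b' _ _} h =>
    ObjectProperty.hom_ext _ (f.H.map_injective (congrArg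
      (fun k : (injMap f).H.obj b ⟶ (injMap f).H.obj b' => InducedCategory.Hom.hom k) h))⟩
  full := ⟨fun g => ⟨ObjectProperty.homMk (f.H.preimage g.hom),
    ObjectProperty.hom_ext _ (f.H.map_preimage g.hom)⟩⟩
  essSurj := ⟨fun a => ⟨⟨f.H.objPreimage a.obj, hF _⟩,
    ⟨(isInj G).isoMk (f.H.objObjPreimageIso a.obj)⟩⟩⟩

/-- If a morphism of adjunctions is an equivalence between the retracts of the objects `L a`, then
the morphism of the induced monads is an equivalence between the projective algebras. -/
theorem isEquivalence_KM_map_AM_map_K {F G : Adj.{v, max u v}} (f : F ⟶ G)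
    (hf : (projMap f).K.IsEquivalence) : (KM.{v, u}.map (AM.map f)).K.IsEquivalence := by
  let kF : (projObj F).B ⥤ (projObj (emObj.{v, u} (adjMonad F))).B :=
    (projMap (compareEM.{v, u} F)).K
  let kG : (projObj G).B ⥤ (projObj (emObj.{v, u} (adjMonad G))).B :=
    (projMap (compareEM.{v, u} G)).K
  let k : (projObj (emObj.{v, u} (adjMonad F))).B ⥤ (projObj (emObj.{v, u} (adjMonad G))).B :=
    (KM.{v, u}.map (AM.map f)).K
  have e : (projMap f).K ⋙ kG ≅ kF ⋙ k :=
    Adj.natIsoK ((projPart.mapComp _ _).symm ≪≫ projPart.map₂Iso (compareEMNat.{v, u} f) ≪≫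
      projPart.mapComp _ _)
  have hkF : kF.IsEquivalence := isEquivalence_projMap_compareEM_K.{v, u} F
  have hkG : kG.IsEquivalence := isEquivalence_projMap_compareEM_K.{v, u} G
  have : (kF ⋙ k).IsEquivalence := Functor.isEquivalence_of_iso e
  exact Functor.isEquivalence_of_comp_left kF k

/-- If a morphism of adjunctions is an equivalence between the retracts of the objects `R b`, then
the morphism of the induced comonads is an equivalence between the injective coalgebras. -/
theorem isEquivalence_KC_map_AC_map_H {F G : Adj.{v, max u v}} (f : F ⟶ G)
    (hf : (injMap f).H.IsEquivalence) : (KC.{v, u}.map (AC.map f)).H.IsEquivalence := by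
  let kF : (injObj F).A ⥤ (injObj (ecObj.{v, u} (adjComonad F))).A :=
    (injMap (compareEC.{v, u} F)).H
  let kG : (injObj G).A ⥤ (injObj (ecObj.{v, u} (adjComonad G))).A :=
    (injMap (compareEC.{v, u} G)).H
  let k : (injObj (ecObj.{v, u} (adjComonad F))).A ⥤ (injObj (ecObj.{v, u} (adjComonad G))).A :=
    (KC.{v, u}.map (AC.map f)).H
  have e : (injMap f).H ⋙ kG ≅ kF ⋙ k :=
    Adj.natIsoH ((injPart.mapComp _ _).symm ≪≫ injPart.map₂Iso (compareECNat.{v, u} f) ≪≫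
      injPart.mapComp _ _)
  have hkF : kF.IsEquivalence := isEquivalence_injMap_compareEC_H.{v, u} F
  have hkG : kG.IsEquivalence := isEquivalence_injMap_compareEC_H.{v, u} G
  have : (kF ⋙ k).IsEquivalence := Functor.isEquivalence_of_iso e
  exact Functor.isEquivalence_of_comp_left kF k

/-- The comparison of `KM T` with coalgebras is the identity on the projective algebras, so that
`KM (AM -)` carries it to an equivalence there, and the comonad on the projective algebras
determines the value of the Street monad. -/
theorem isEquiv_streetM_map_unitM (T : Mnd.{v, max u v}) :
    IsEquiv (streetM.{v, u}.map (unitM.{v, u}.app T)) := by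
  have h₁ : IsEquiv (streetM.{v, u}.map (toAMKM.{v, u} T)) :=
    ((Mnd.isEquiv_iff _).2 (inferInstanceAs (𝟭 T.carrier).IsEquivalence)).map _
  have h₂ : IsEquiv (streetM.{v, u}.map (AM.map (compareEC.{v, u} (KM.{v, u}.obj T)))) := by
    have h := isEquivalence_KM_map_AM_map_K.{v, u} (compareEC.{v, u} (KM.{v, u}.obj T))
      (isEquivalence_projMap_K _ (inferInstanceAs (𝟭 (KM.{v, u}.obj T).B).IsEquivalence)
        (isProj_projObj _))
    exact IsEquiv.map (EC.{v, u}.comp AM) ((Cmn.isEquiv_iff (AC.map _)).2 h)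
  rw [Mnd.isEquiv_iff] at h₁ h₂ ⊢
  have e := Mnd.natIso (streetM.{v, u}.mapComp (toAMKM.{v, u} T)
    (AM.map (compareEC.{v, u} (KM.{v, u}.obj T))))
  have : (Functor.comp (streetM.{v, u}.map (toAMKM.{v, u} T)).functor
      (streetM.{v, u}.map (AM.map (compareEC.{v, u} (KM.{v, u}.obj T)))).functor).IsEquivalence :=
    Functor.isEquivalence_trans _ _
  exact (Functor.isEquivalence_iff_of_iso e).2 this

/-- The comparison of `KC S` with algebras is the identity on the injective coalgebras, so that
`KC (AC -)` carries it to an equivalence there, and the monad on the injective coalgebras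
determines the value of the Street monad. -/
theorem isEquiv_streetE_map_unitE (S : Cmn.{v, max u v}) :
    IsEquiv (streetE.{v, u}.map (unitE.{v, u}.app S)) := by
  have h₁ : IsEquiv (streetE.{v, u}.map (toACKC.{v, u} S)) :=
    ((Cmn.isEquiv_iff _).2 (inferInstanceAs (𝟭 S.carrier).IsEquivalence)).map _
  have h₂ : IsEquiv (streetE.{v, u}.map (AC.map (compareEM.{v, u} (KC.{v, u}.obj S)))) := by
    have h := isEquivalence_KC_map_AC_map_H.{v, u} (compareEM.{v, u} (KC.{v, u}.obj S))
      (isEquivalence_injMap_H _ (inferInstanceAs (𝟭 (KC.{v, u}.obj S).A).IsEquivalence)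
        (isInj_injObj _))
    exact IsEquiv.map (EM.{v, u}.comp AC) ((Mnd.isEquiv_iff (AM.map _)).2 h)
  rw [Cmn.isEquiv_iff] at h₁ h₂ ⊢
  have e := Cmn.natIso (streetE.{v, u}.mapComp (toACKC.{v, u} S)
    (AC.map (compareEM.{v, u} (KC.{v, u}.obj S))))
  have : (Functor.comp (streetE.{v, u}.map (toACKC.{v, u} S)).functor
      (streetE.{v, u}.map (AC.map (compareEM.{v, u} (KC.{v, u}.obj S)))).functor).IsEquivalence :=
    Functor.isEquivalence_trans _ _
  exact (Functor.isEquivalence_iff_of_iso e).2 this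

/-! ### Nuclear adjunctions -/

theorem isEquiv_compareEM_iff (F : Adj.{v, max u v}) :
    IsEquiv (compareEM.{v, u} F) ↔ IsMonadic F :=
  (Adj.isEquiv_iff _).trans
    ⟨fun h => h.2, fun h => ⟨inferInstanceAs (𝟭 F.A).IsEquivalence, h⟩⟩

theorem isEquiv_compareEC_iff (F : Adj.{v, max u v}) :
    IsEquiv (compareEC.{v, u} F) ↔ IsComonadic F :=
  (Adj.isEquiv_iff _).trans
    ⟨fun h => h.1, fun h => ⟨h, inferInstanceAs (𝟭 F.B).IsEquivalence⟩⟩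

theorem isNuclear_iff (F : Adj.{v, max u v}) :
    IsNuclear F ↔ IsEquiv (unitEM.{v, u}.app F) ∧ IsEquiv (unitEC.{v, u}.app F) :=
  and_congr (isEquiv_compareEM_iff F).symm (isEquiv_compareEC_iff F).symm

/-! ### Morphisms into adjunctions with a monadic right adjoint -/

section

variable {F G : Adj.{v, max u v}}

theorem isMonadic_R_map_injective (hG : IsMonadic G) {b b' : G.B} {f g : b ⟶ b'}
    (h : G.R.map f = G.R.map g) : f = g :=
  (Monad.comparison G.adj).map_injective (Monad.Algebra.Hom.ext' _ _ _ _ h)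

theorem isComonadic_L_map_injective (hG : IsComonadic G) {a a' : G.A} {f g : a ⟶ a'}
    (h : G.L.map f = G.L.map g) : f = g :=
  (Comonad.comparison G.adj).map_injective (Comonad.Coalgebra.Hom.ext' _ _ _ _ h)

theorem AM_map₂_injective (hG : IsMonadic G) {f g : F ⟶ G} {x y : f ⟶ g}
    (h : AM.map₂ x = AM.map₂ y) : x = y := by
  have h₁ (a : F.A) : x.natH.app a = y.natH.app a :=
    congrArg (fun z : AM.map f ⟶ AM.map g => z.nat.app a) h
  refine Adj.hom₂_ext h₁ fun b => isMonadic_R_map_injective.{v, u} hG ?_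
  rw [← cancel_epi (f.isoR b).hom, ← x.commR, ← y.commR, h₁]

theorem AC_map₂_injective (hG : IsComonadic G) {f g : F ⟶ G} {x y : f ⟶ g}
    (h : AC.map₂ x = AC.map₂ y) : x = y := by
  have h₁ (b : F.B) : x.natK.app b = y.natK.app b :=
    congrArg (fun z : AC.map f ⟶ AC.map g => z.nat.app b) h
  refine Adj.hom₂_ext (fun a => isComonadic_L_map_injective.{v, u} hG ?_) h₁
  rw [← cancel_epi (f.isoL a).hom, ← x.commL, ← y.commL, h₁]

/-- If the right adjoint of `G` is monadic, a 2-cell between the induced morphisms of monads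
extends along `R` because it acts on algebras. -/
theorem AM_map₂_surjective (hG : IsMonadic G) {f g : F ⟶ G} (z : AM.map f ⟶ AM.map g) :
    ∃ x : f ⟶ g, AM.map₂ x = z := by
  -- The component of `z` at `R b` becomes a morphism of algebras by naturality of the comparison.
  let w : f ≫ compareEM.{v, u} G ⟶ g ≫ compareEM.{v, u} G :=
    (compareEMNat f).hom ≫ compareEM F ◁ EM.{v, u}.map₂ z ≫ (compareEMNat g).inv
  let w' : f.K ⋙ Monad.comparison G.adj ⟶ g.K ⋙ Monad.comparison G.adj := w.natK
  let k : f.K ⟶ g.K :=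
    ((Functor.FullyFaithful.ofFullyFaithful (Monad.comparison G.adj)).whiskeringRight _).preimage w'
  have hk (b : F.B) : G.R.map (k.app b) =
      (f.isoR b).inv ≫ z.nat.app (F.R.obj b) ≫ (g.isoR b).hom := by
    have h : Functor.whiskerRight k (Monad.comparison G.adj) = w' :=
      ((Functor.FullyFaithful.ofFullyFaithful
        (Monad.comparison G.adj)).whiskeringRight _).map_preimage w'
    exact congrArg Monad.Algebra.Hom.f (congrArg (fun t => t.app b) h)
  let ζ : f.H ⟶ g.H := z.nat
  replace hk (b : F.B) : G.R.map (k.app b) =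
      (f.isoR b).inv ≫ ζ.app (F.R.obj b) ≫ (g.isoR b).hom := hk b
  refine ⟨Adj.Hom₂.mk ζ k (fun a => isMonadic_R_map_injective.{v, u} hG ?_) (fun b => ?_), rfl⟩
  · have h : ζ.app (F.R.obj (F.L.obj a)) ≫ (g.isoR (F.L.obj a)).hom ≫ G.R.map (g.isoL a).hom =
      ((f.isoR (F.L.obj a)).hom ≫ G.R.map (f.isoL a).hom) ≫ G.R.map (G.L.map (ζ.app a)) :=
      z.comm a
    rw [Functor.map_comp, Functor.map_comp, hk, Category.assoc, Category.assoc, h]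
    simp
  · rw [hk, Iso.hom_inv_id_assoc]

/-- If the left adjoint of `G` is comonadic, a 2-cell between the induced morphisms of comonads
extends along `L` because it acts on coalgebras. -/
theorem AC_map₂_surjective (hG : IsComonadic G) {f g : F ⟶ G} (z : AC.map f ⟶ AC.map g) :
    ∃ x : f ⟶ g, AC.map₂ x = z := by
  -- The component of `z` at `L a` becomes a morphism of coalgebras by naturality of the comparison.
  let w : f ≫ compareEC.{v, u} G ⟶ g ≫ compareEC.{v, u} G :=
    (compareECNat f).hom ≫ compareEC F ◁ EC.{v, u}.map₂ z ≫ (compareECNat g).inv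
  let w' : f.H ⋙ Comonad.comparison G.adj ⟶ g.H ⋙ Comonad.comparison G.adj := w.natH
  let k : f.H ⟶ g.H :=
    ((Functor.FullyFaithful.ofFullyFaithful
      (Comonad.comparison G.adj)).whiskeringRight _).preimage w'
  have hk (a : F.A) : G.L.map (k.app a) =
      (f.isoL a).inv ≫ z.nat.app (F.L.obj a) ≫ (g.isoL a).hom := by
    have h : Functor.whiskerRight k (Comonad.comparison G.adj) = w' :=
      ((Functor.FullyFaithful.ofFullyFaithful
        (Comonad.comparison G.adj)).whiskeringRight _).map_preimage w'
    exact congrArg Comonad.Coalgebra.Hom.f (congrArg (fun t => t.app a) h)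
  let ζ : f.K ⟶ g.K := z.nat
  replace hk (a : F.A) : G.L.map (k.app a) =
      (f.isoL a).inv ≫ ζ.app (F.L.obj a) ≫ (g.isoL a).hom := hk a
  refine ⟨Adj.Hom₂.mk k ζ (fun a => ?_) (fun b => isComonadic_L_map_injective.{v, u} hG ?_), rfl⟩
  · rw [hk, Iso.hom_inv_id_assoc]
  · have h : ζ.app (F.L.obj (F.R.obj b)) ≫ (g.isoL (F.R.obj b)).hom ≫ G.L.map (g.isoR b).hom =
      ((f.isoL (F.R.obj b)).hom ≫ G.L.map (f.isoR b).hom) ≫ G.L.map (G.R.map (ζ.app b)) :=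
      z.comm b
    rw [Functor.map_comp, Functor.map_comp, hk, Category.assoc, Category.assoc, h]
    simp

/-- The comparison with algebras does not change the induced monad, naturally in the monad. -/
def AMEMNat (h : AM.obj F ⟶ AM.obj G) :
    AM.map (compareEM.{v, u} F) ≫ AM.map (EM.{v, u}.map h) ≅ h ≫ AM.map (compareEM.{v, u} G) :=
  Mnd.isoMk (f := AM.map (compareEM.{v, u} F) ≫ AM.map (EM.{v, u}.map h))
    (g := h ≫ AM.map (compareEM.{v, u} G)) (Iso.refl h.functor) (fun a => by
      let H : F.A ⥤ G.A := h.functor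
      let i (a : F.A) : H.obj (F.R.obj (F.L.obj a)) ≅ G.R.obj (G.L.obj (H.obj a)) := h.iso a
      change 𝟙 _ ≫ (i a).hom ≫ 𝟙 (G.R.obj (G.L.obj (H.obj a))) ≫ 𝟙 _ =
        (H.map (𝟙 (F.R.obj (F.L.obj a)) ≫ 𝟙 _) ≫ 𝟙 _ ≫ (i a).hom) ≫
          G.R.map (G.L.map (𝟙 (H.obj a)))
      simp only [CategoryTheory.Functor.map_id, Category.comp_id, Category.id_comp])

/-- The comparison with coalgebras does not change the induced comonad, naturally in the
comonad. -/
def ACECNat (h : AC.obj F ⟶ AC.obj G) :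
    AC.map (compareEC.{v, u} F) ≫ AC.map (EC.{v, u}.map h) ≅ h ≫ AC.map (compareEC.{v, u} G) :=
  Cmn.isoMk (f := AC.map (compareEC.{v, u} F) ≫ AC.map (EC.{v, u}.map h))
    (g := h ≫ AC.map (compareEC.{v, u} G)) (Iso.refl h.functor) (fun b => by
      let K : F.B ⥤ G.B := h.functor
      let i (b : F.B) : K.obj (F.L.obj (F.R.obj b)) ≅ G.L.obj (G.R.obj (K.obj b)) := h.iso b
      change 𝟙 _ ≫ (i b).hom ≫ 𝟙 (G.L.obj (G.R.obj (K.obj b))) ≫ 𝟙 _ =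
        (K.map (𝟙 (F.L.obj (F.R.obj b)) ≫ 𝟙 _) ≫ 𝟙 _ ≫ (i b).hom) ≫
          G.L.map (G.R.map (𝟙 (K.obj b)))
      simp only [CategoryTheory.Functor.map_id, Category.comp_id, Category.id_comp])

/-- If the right adjoint of `G` is monadic, a morphism of monads into the monad of `G` lifts to the
morphism of adjunctions `F ⟶ EM (AM F) ⟶ EM (AM G) ≌ G`. -/
theorem exists_AM_map_iso (hG : IsMonadic G) (h : AM.obj F ⟶ AM.obj G) :
    ∃ f : F ⟶ G, Nonempty (AM.map f ≅ h) := by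
  obtain ⟨e, he⟩ := (isEquiv_compareEM_iff G).2 hG
  have i : AM.map (compareEM.{v, u} G) ≫ AM.map e.inv ≅ 𝟙 (AM.obj G) := by
    rw [← he]
    exact (AM.mapComp _ _).symm ≪≫ AM.map₂Iso e.unit.symm ≪≫ AM.mapId _
  exact ⟨compareEM.{v, u} F ≫ EM.{v, u}.map h ≫ e.inv,
    ⟨AM.mapComp _ _ ≪≫ whiskerLeftIso _ (AM.mapComp _ _) ≪≫ (α_ _ _ _).symm ≪≫
      whiskerRightIso (AMEMNat.{v, u} h) _ ≪≫ α_ _ _ _ ≪≫ whiskerLeftIso h i ≪≫ ρ_ h⟩⟩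

/-- If the left adjoint of `G` is comonadic, a morphism of comonads into the comonad of `G` lifts to
the morphism of adjunctions `F ⟶ EC (AC F) ⟶ EC (AC G) ≌ G`. -/
theorem exists_AC_map_iso (hG : IsComonadic G) (h : AC.obj F ⟶ AC.obj G) :
    ∃ f : F ⟶ G, Nonempty (AC.map f ≅ h) := by
  obtain ⟨e, he⟩ := (isEquiv_compareEC_iff G).2 hG
  have i : AC.map (compareEC.{v, u} G) ≫ AC.map e.inv ≅ 𝟙 (AC.obj G) := by
    rw [← he]
    exact (AC.mapComp _ _).symm ≪≫ AC.map₂Iso e.unit.symm ≪≫ AC.mapId _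
  exact ⟨compareEC.{v, u} F ≫ EC.{v, u}.map h ≫ e.inv,
    ⟨AC.mapComp _ _ ≪≫ whiskerLeftIso _ (AC.mapComp _ _) ≪≫ (α_ _ _ _).symm ≪≫
      whiskerRightIso (ACECNat.{v, u} h) _ ≪≫ α_ _ _ _ ≪≫ whiskerLeftIso h i ≪≫ ρ_ h⟩⟩

end

/-! ### The biequivalences -/

section

universe w₁ w₂ v₁ v₂ u₁ u₂

variable {B : Type u₁} [Bicategory.{w₁, v₁} B] {C : Type u₂} [Bicategory.{w₂, v₂} C]

/-- An equivalence between objects with a property is an equivalence in the full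
sub-bicategory. -/
theorem IsEquiv.nonempty_fullSub {P : C → Prop} {X Y : FullSub P} {f : X.1 ⟶ Y.1}
    (hf : IsEquiv f) : Nonempty (Y ≌ X) := by
  obtain ⟨e, rfl⟩ := hf
  let p : X ⟶ Y := InducedBicategory.mkHom e.hom
  let q : Y ⟶ X := InducedBicategory.mkHom e.inv
  exact ⟨Bicategory.Equivalence.mkOfAdjointifyCounit (f := q) (g := p)
    (InducedBicategory.isoMk e.counit.symm) (InducedBicategory.isoMk e.unit.symm)⟩

/-- The restriction of a pseudofunctor to full sub-bicategories is a biequivalence if the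
pseudofunctor is fully faithful on 2-cells and essentially full on 1-cells into the objects with the
first property, and reaches the objects with the second property from them. -/
theorem isBiequivalence_restrict (F : B ⥤ᵖ C) {P : B → Prop} {Q : C → Prop}
    (h : ∀ b, P b → Q (F.obj b))
    (inj : ∀ {a b : B}, P b → ∀ {f g : a ⟶ b} {x y : f ⟶ g}, F.map₂ x = F.map₂ y → x = y)
    (surj : ∀ {a b : B}, P b → ∀ {f g : a ⟶ b} (z : F.map f ⟶ F.map g), ∃ x, F.map₂ x = z)
    (iso : ∀ {a b : B}, P b → ∀ (g : F.obj a ⟶ F.obj b), ∃ f, Nonempty (F.map f ≅ g))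
    (obj : ∀ c, Q c → ∃ b, P b ∧ ∃ f : c ⟶ F.obj b, IsEquiv f) :
    IsBiequivalence (restrict F h) where
  isEquivalence X Y :=
    { faithful := ⟨fun {f g _ _} hxy => InducedBicategory.hom₂_ext (inj Y.2 (congrArg
        (fun k : (restrict F h).map f ⟶ (restrict F h).map g => InducedBicategory.Hom₂.hom k)
        hxy))⟩
      full := ⟨fun z => by
        obtain ⟨x, hx⟩ := surj Y.2 z.hom
        exact ⟨⟨x⟩, InducedBicategory.hom₂_ext hx⟩⟩
      essSurj := ⟨fun g => by
        obtain ⟨f, ⟨e⟩⟩ := iso Y.2 g.hom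
        exact ⟨InducedBicategory.mkHom f, ⟨InducedBicategory.isoMk e⟩⟩⟩ }
  essSurj c := by
    obtain ⟨b, hb, f, hf⟩ := obj c.1 c.2
    exact ⟨⟨b, hb⟩, IsEquiv.nonempty_fullSub hf⟩

end

theorem isBiequivalence_AM (h : ∀ F, IsNuclear.{v, max u v} F → IsFixedM.{v, u} (AM.obj F)) :
    IsBiequivalence (restrict AM h : Nuc.{v, u} ⥤ᵖ AlgM.{v, u}) :=
  isBiequivalence_restrict AM h (fun hG => AM_map₂_injective.{v, u} hG.1)
    (fun hG => AM_map₂_surjective.{v, u} hG.1) (fun hG => exists_AM_map_iso.{v, u} hG.1)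
    (fun T hT => ⟨emObj.{v, u} T, ⟨isMonadic_emObj.{v, u} T, (isFixedM_iff T).1 hT⟩,
      toAMKM.{v, u} T ≫ AM.map (projIncl (emObj.{v, u} T)),
      (Mnd.isEquiv_iff _).2 (inferInstanceAs (𝟭 T.carrier ⋙ 𝟭 T.carrier).IsEquivalence)⟩)

theorem isBiequivalence_AC (h : ∀ F, IsNuclear.{v, max u v} F → IsFixedE.{v, u} (AC.obj F)) :
    IsBiequivalence (restrict AC h : Nuc.{v, u} ⥤ᵖ AlgE.{v, u}) :=
  isBiequivalence_restrict AC h (fun hG => AC_map₂_injective.{v, u} hG.2)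
    (fun hG => AC_map₂_surjective.{v, u} hG.2) (fun hG => exists_AC_map_iso.{v, u} hG.2)
    (fun S hS => ⟨ecObj.{v, u} S, ⟨(isFixedE_iff S).1 hS, isComonadic_ecObj.{v, u} S⟩,
      toACKC.{v, u} S ≫ AC.map (injIncl (ecObj.{v, u} S)),
      (Cmn.isEquiv_iff _).2 (inferInstanceAs (𝟭 S.carrier ⋙ 𝟭 S.carrier).IsEquivalence)⟩)

end StreetNucleus

theorem mainTheorem1 :
    -- the Street monads are strictly idempotent
    (∀ T : StreetNucleus.Mnd.{v, max u v},
      StreetNucleus.IsEquiv (StreetNucleus.unitM.{v, u}.app (StreetNucleus.streetM.{v, u}.obj T)) ∧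
      StreetNucleus.IsEquiv (StreetNucleus.streetM.{v, u}.map (StreetNucleus.unitM.{v, u}.app T))) ∧
    (∀ S : StreetNucleus.Cmn.{v, max u v},
      StreetNucleus.IsEquiv (StreetNucleus.unitE.{v, u}.app (StreetNucleus.streetE.{v, u}.obj S)) ∧
      StreetNucleus.IsEquiv (StreetNucleus.streetE.{v, u}.map (StreetNucleus.unitE.{v, u}.app S))) ∧
    -- an adjunction is nuclear if and only if the units of `EM ∘ AM` and `EC ∘ AC` are
    -- equivalences at it
    (∀ F : StreetNucleus.Adj.{v, max u v}, StreetNucleus.IsNuclear F ↔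
      StreetNucleus.IsEquiv (StreetNucleus.unitEM.{v, u}.app F) ∧
      StreetNucleus.IsEquiv (StreetNucleus.unitEC.{v, u}.app F)) ∧
    -- the algebras of the Street monads are the nuclear adjunctions
    (∃ h : ∀ F, StreetNucleus.IsNuclear.{v, max u v} F →
        StreetNucleus.IsFixedM.{v, u} (StreetNucleus.AM.obj F),
      StreetNucleus.IsBiequivalence (StreetNucleus.restrict StreetNucleus.AM h :
        StreetNucleus.Nuc.{v, u} ⥤ᵖ StreetNucleus.AlgM.{v, u})) ∧
    (∃ h : ∀ F, StreetNucleus.IsNuclear.{v, max u v} F →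
        StreetNucleus.IsFixedE.{v, u} (StreetNucleus.AC.obj F),
      StreetNucleus.IsBiequivalence (StreetNucleus.restrict StreetNucleus.AC h :
        StreetNucleus.Nuc.{v, u} ⥤ᵖ StreetNucleus.AlgE.{v, u})) :=
  ⟨fun T => ⟨StreetNucleus.isEquiv_unitM_streetM T, StreetNucleus.isEquiv_streetM_map_unitM T⟩,
    fun S => ⟨StreetNucleus.isEquiv_unitE_streetE S, StreetNucleus.isEquiv_streetE_map_unitE S⟩,
    StreetNucleus.isNuclear_iff,
    ⟨fun F hF => (StreetNucleus.isFixedM_adjMonad_iff F).2 hF.2,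
      StreetNucleus.isBiequivalence_AM _⟩,
    ⟨fun F hF => (StreetNucleus.isFixedE_adjComonad_iff F).2 hF.1,
      StreetNucleus.isBiequivalence_AC _⟩⟩
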